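/- A solution $(c_1,c_2,c_3,x_1,x_2,x_3)$, with $c_j$ positive real numbers and $x_j\in\mathbb{C}$ roots of unity, of the two relations $$\sum_{j=1}^3 c_j\,(x_j^{r}-x_j^{-r})=0,\qquad r=1,2,$$ is called admissible if the following conditions hold. (a) The eight numbers $\pm1,\ x_1^{\pm1},\ x_2^{\pm1},\ x_3^{\pm1}$ are distinct. (b) There are positive real numbers $h_1,h_2,h_3$ such that $(c_1,c_2,c_3)$ and $(h_1,h_2,h_3)$ are $\mathbb{Q}$-bases of the same number field $K\subset\mathbb{R}$, dual to each other with respect to the trace pairing $(a,b)\mapsto \mathrm{Tr}_{K/\mathbb{Q}}(ab)$, with $K\subset\mathbb{Q}(x_1,x_2,x_3)$, and such that the moduli $m_j=h_j/c_j$ have rational ratios. (c) Write $x_j=\exp(\pi i\,n_j/N)$ with integers $N\ge 1$ and $-N<n_j<N$, and put $s=\sum_{j=1}^3 c_j\left(\mathrm{sgn}(n_j)-\frac{n_j}{N}\right)$ (this does not depend on the choice of $N$). Then $s>0$ and $(-1)^k s+\sum_{j=1}^k(-1)^{k-j}c_j>0$ for $k=1,2,3$. (In other words, the numbers $\ell_0=s$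 and $\ell_k=c_k-\ell_{k-1}$, $k=1,2,3$, are positive; they are the lengths of the saddle connections in a chain of three cylinders with circumferences $c_1,c_2,c_3$.) Theorem. (i) Let $(c_1,c_2,c_3,x_1,x_2,x_3)$ be an admissible solution, let $K=\mathbb{Q}(c_1,c_2,c_3)$, and let $n$ be the least common multiple of the orders of $x_1,x_2,x_3$. Then either $n\in\{7,14\}$ and $K=\mathbb{Q}(\cos(\pi/7))$, or $n=18$ and $K=\mathbb{Q}(\cos(\pi/9))$. (ii) Let $n\ge1$ and $0\le n_1,n_2,n_3<n$ be integers with $\gcd(n_1,n_2,n_3,n)=1$, and let $x_j=\exp(2\pi i n_j/n)$. Then $x_1,x_2,x_3$ are part of an admissible solution $(c_1,c_2,c_3,x_1,x_2,x_3)$ if and only if one of the following holds: - $n=7$ and $(n_1,n_2,n_3)$ is one of $(1,3,5),(1,5,3),(5,3,1)$; - $n=14$ and $(n_1,n_2,n_3)$ is one of $(1,11,5),(11,5,1)$; - $n=18$ and $(n_1,n_2,n_3)$ is one of $(1,5,14)$, $(1,11,8)$, $(1,14,5)$, $(1,15,6)$, $(1,16,8)$, $(2,7,13)$, $(2,13,7)$,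 $(2,14,7)$, $(2,15,6)$, $(3,6,13)$, $(3,7,12)$, $(3,12,7)$, $(3,12,8)$, $(3,13,6)$, $(3,14,6)$, $(4,8,13)$, $(4,13,8)$, $(5,1,14)$, $(5,14,1)$, $(6,3,14)$, $(6,13,3)$, $(6,14,3)$, $(7,2,14)$, $(7,13,2)$, $(7,14,2)$, $(8,13,4)$, $(12,7,3)$, $(13,7,2)$, $(14,1,5)$, $(14,2,7)$, $(14,5,1)$, $(15,6,1)$. -/

import Mathlib

/-- `c` and `h` are (the real values of) two `ℚ`-bases of one and the same number field
`K ⊂ ℝ`, with `K ⊂ ℚ(x 0, x 1, x 2)`; the two bases are dual with respect to the trace pairing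
`(a, b) ↦ Tr_{K/ℚ}(ab)`, and the ratios of the moduli `h j / c j` are rational. -/
def IsDualPair (c h : Fin 3 → ℝ) (x : Fin 3 → ℂ) : Prop :=
  (∃ (K : IntermediateField ℚ ℝ) (b b' : Module.Basis (Fin 3) ℚ K),
    (∀ j, (b j : ℝ) = c j) ∧ (∀ j, (b' j : ℝ) = h j) ∧
    (∀ j k, Algebra.trace ℚ K (b j * b' k) = if j = k then 1 else 0) ∧
    (∀ a ∈ K, (a : ℂ) ∈ IntermediateField.adjoin ℚ (Set.range x))) ∧
  ∀ j k, ∃ q : ℚ, (h j / c j) / (h k / c k) = (q : ℝ)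

/-- With `x j = exp (π i n j / N)` and `-N < n j < N`, the number
`s = ∑ j, c j * (sgn (n j) - n j / N)`. -/
noncomputable def saddleLength (c : Fin 3 → ℝ) (N : ℕ) (n : Fin 3 → ℤ) : ℝ :=
  ∑ j, c j * (((n j).sign : ℝ) - (n j : ℝ) / (N : ℝ))

/-- `x j = exp (π i n j / N)` with `-N < n j < N`, and the four horizontal saddle connection
lengths `ℓ 0 = s` and `ℓ k = c (k-1) - ℓ (k-1)` for `k = 1, 2, 3` of a chain of three
cylinders with circumferences `c 0, c 1, c 2` (in this order along the chain) are positive. -/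
def HasPositiveLengths (c : Fin 3 → ℝ) (x : Fin 3 → ℂ) : Prop :=
  ∃ (N : ℕ) (n : Fin 3 → ℤ), 0 < N ∧ (∀ j, -(N : ℤ) < n j ∧ n j < (N : ℤ)) ∧
    (∀ j, x j = Complex.exp ((Real.pi : ℂ) * Complex.I * (n j : ℂ) / (N : ℂ))) ∧
    0 < saddleLength c N n ∧
    0 < c 0 - saddleLength c N n ∧
    0 < c 1 - c 0 + saddleLength c N n ∧
    0 < c 2 - c 1 + c 0 - saddleLength c N n

/-- Admissible solutions of the two relations `∑ j, c j * (x j ^ r - x j ^ (-r)) = 0`,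
`r = 1, 2`. The `c j` are the circumferences and the `h j` the heights of three cylinders. -/
structure IsAdmissible (c : Fin 3 → ℝ) (x : Fin 3 → ℂ) : Prop where
  circumference_pos : ∀ j, 0 < c j
  exists_heights : ∃ h : Fin 3 → ℝ, (∀ j, 0 < h j) ∧ IsDualPair c h x
  rootOfUnity : ∀ j, ∃ m : ℕ, 0 < m ∧ x j ^ m = 1
  distinct : [1, -1, x 0, (x 0)⁻¹, x 1, (x 1)⁻¹, x 2, (x 2)⁻¹].Nodup
  relation_one : ∑ j, (c j : ℂ) * (x j - (x j)⁻¹) = 0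
  relation_two : ∑ j, (c j : ℂ) * (x j ^ 2 - (x j)⁻¹ ^ 2) = 0
  positiveLengths : HasPositiveLengths c x

/-- The triples of exponents for `n = 7`, `14`, `18` (none for other `n`). -/
def exponentTriples (n : ℕ) : List (ℕ × ℕ × ℕ) :=
  if n = 7 then [(1, 3, 5), (1, 5, 3), (5, 3, 1)]
  else if n = 14 then [(1, 11, 5), (11, 5, 1)]
  else if n = 18 then
    [(1, 5, 14), (1, 11, 8), (1, 14, 5), (1, 15, 6), (1, 16, 8), (2, 7, 13), (2, 13, 7),
     (2, 14, 7), (2, 15, 6), (3, 6, 13), (3, 7, 12), (3, 12, 7), (3, 12, 8), (3, 13, 6),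
     (3, 14, 6), (4, 8, 13), (4, 13, 8), (5, 1, 14), (5, 14, 1), (6, 3, 14), (6, 13, 3),
     (6, 14, 3), (7, 2, 14), (7, 13, 2), (7, 14, 2), (8, 13, 4), (12, 7, 3), (13, 7, 2),
     (14, 1, 5), (14, 2, 7), (14, 5, 1), (15, 6, 1)]
  else []

/-!
Let `c`, `x` be an admissible solution. The field `K` with basis the three circumferences is a
subfield of a cyclotomic field, hence cyclic of degree `3` over `ℚ`. So the cube of every
automorphism of the cyclotomic field fixes the `c j`, and the two relations stay true when the `x j`
are replaced by `x j ^ u ^ 3`, for every `u` prime to their common order `n`. Moreover a basis is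
orthogonal to the proper conjugates of its dual basis; as the heights are, up to a common factor,
positive rational multiples of the `c j`, the vector `c` is orthogonal to its proper conjugates for
a positive rational diagonal form. These facts are collected in `GaloisSolution`, and
`IsAdmissible.exists_galoisSolution` extracts them.

The order is bounded by the cubes. If many residues `1 + t * d` are cubes modulo `n = m * d`,
Fourier inversion separates the classes of `x j ^ d`, and a Vandermonde argument
(`cube_eq_of_vandermonde`) puts the `x j`, up to inversion, into one coset of the cube roots of
unity. There the `c j` agree up to sign, against their linear independence. So `n` is not divisible
by `16`, `27` or the square of a prime `p ≥ 5` (`GaloisSolution.not_sq_dvd`). For a prime `p ≥ 5`,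
`p ≠ 7`, dividing `n` once, the `p`-parts of the `x j` may be raised to the powers `±1`, `±8`, which
are distinct modulo `p`. Modulo a prime above `p` the resulting exponential sums have zeros of
order `4` at `1`. The ensuing equations between moments lead back to a coset of the cube roots of
unity, or to a Vandermonde system without solutions (`GaloisSolution.not_prime_dvd`). Hence
`n ∣ 504`.

For `n ∣ 504` the relations with exponents `r * u ^ 3` and the orthogonality relations are
polynomial identities with rational coefficients in a primitive `504`-th root of unity. They
survive in `ZMod 1009`, where `2` has order `504`, and what is left of a finite search there is
eliminated because the terms of an orthogonality relation cannot all have the same sign. Only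
the orders `7`, `14`, `18` remain (`GaloisSolution.order_eq`).

For these orders `K` is the field of `2 cos (2 π / n)`. The two relations determine `c` up to a
factor as a cross product, whose coordinates are computed in the basis `1`, `t`, `t ^ 2` of `K`,
where `t = 2 cos (2 π / n)`. Signs of circumferences and lengths are read off from a rational
approximation of `t`; together with the obstructions above, they leave exactly the triples of the
list (`IsAdmissible.mem_exponentTriples`). Conversely, for each triple of the list the cross
product, together with weights that make it orthogonal to its conjugates, defines an admissible
solution (`exists_isAdmissible`).
-/


/-! ### Linear algebra in three unknowns -/

theorem cube_eq_of_vandermonde_aux {F : Type*} [Field F] {d₁ d₂ d₃ y₁ y₂ y₃ : F} (hd : d₁ ≠ 0)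
    (h12 : y₁ ≠ y₂) (h13 : y₁ ≠ y₃) (h₁ : y₁ ≠ 0) (h₂ : y₂ ≠ 0) (h₃ : y₃ ≠ 0)
    (e₁ : d₁ * y₁ + d₂ * y₂ + d₃ * y₃ = 0)
    (e₂ : d₁ * y₁ ^ 2 + d₂ * y₂ ^ 2 + d₃ * y₃ ^ 2 = 0)
    (f₁ : d₁ * y₁⁻¹ + d₂ * y₂⁻¹ + d₃ * y₃⁻¹ = 0)
    (f₂ : d₁ * y₁⁻¹ ^ 2 + d₂ * y₂⁻¹ ^ 2 + d₃ * y₃⁻¹ ^ 2 = 0) :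
    y₁ ^ 3 = y₂ ^ 3 ∧ y₁ ^ 3 = y₃ ^ 3 := by
  obtain ⟨b₁, hb₁⟩ : ∃ b, d₁ = b * y₁ ^ 2 := ⟨d₁ / y₁ ^ 2, by field_simp⟩
  obtain ⟨b₂, hb₂⟩ : ∃ b, d₂ = b * y₂ ^ 2 := ⟨d₂ / y₂ ^ 2, by field_simp⟩
  obtain ⟨b₃, hb₃⟩ : ∃ b, d₃ = b * y₃ ^ 2 := ⟨d₃ / y₃ ^ 2, by field_simp⟩
  have hb : b₁ ≠ 0 := by rintro rfl; simp [hb₁] at hd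
  subst hb₁ hb₂ hb₃
  have g₀ : b₁ + b₂ + b₃ = 0 := by
    have : ∀ b y : F, y ≠ 0 → b * y ^ 2 * y⁻¹ ^ 2 = b := by intro b y hy; field_simp
    rwa [this _ _ h₁, this _ _ h₂, this _ _ h₃] at f₂
  have g₁ : b₁ * y₁ + b₂ * y₂ + b₃ * y₃ = 0 := by
    have : ∀ b y : F, y ≠ 0 → b * y ^ 2 * y⁻¹ = b * y := by intro b y hy; field_simp
    rwa [this _ _ h₁, this _ _ h₂, this _ _ h₃] at f₁
  have hu : b₁ * ((y₁ - y₂) * (y₁ - y₃)) ≠ 0 :=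
    mul_ne_zero hb (mul_ne_zero (sub_ne_zero.2 h12) (sub_ne_zero.2 h13))
  -- Test the functional `p ↦ ∑ b p(y)` on multiples of `(Y - y₂) (Y - y₃)` without `Y²` term.
  have s₁ : y₁ + y₂ + y₃ = 0 := by
    have : b₁ * ((y₁ - y₂) * (y₁ - y₃)) * (y₁ + y₂ + y₃) = 0 := by
      linear_combination e₁ - (y₂ ^ 2 + y₂ * y₃ + y₃ ^ 2) * g₁ + (y₂ * y₃ * (y₂ + y₃)) * g₀
    exact (mul_eq_zero.1 this).resolve_left hu
  have s₂ : y₁ ^ 2 - y₂ * y₃ = 0 := by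
    have : b₁ * ((y₁ - y₂) * (y₁ - y₃)) * (y₁ ^ 2 - y₂ * y₃) = 0 := by
      linear_combination e₂ - (y₂ + y₃) * e₁ + (y₂ * y₃ * (y₂ + y₃)) * g₁
        - (y₂ * y₃) ^ 2 * g₀
    exact (mul_eq_zero.1 this).resolve_left hu
  have : y₁ = -(y₂ + y₃) := by linear_combination s₁
  subst this
  exact ⟨by linear_combination (-2 * y₂ - y₃) * s₂, by linear_combination (-y₂ - 2 * y₃) * s₂⟩

/-- Three distinct points of the multiplicative group which are linearly dependent, with common
coefficients, in the characters of weight `±1`, `±2` form a coset of the group of cube roots of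
unity. -/
theorem cube_eq_of_vandermonde {F : Type*} [Field F] {d y : Fin 3 → F} (hd : ∃ j, d j ≠ 0)
    (hy : Function.Injective y) (h0 : ∀ j, y j ≠ 0)
    (e₁ : ∑ j, d j * y j = 0) (e₂ : ∑ j, d j * y j ^ 2 = 0)
    (f₁ : ∑ j, d j * (y j)⁻¹ = 0) (f₂ : ∑ j, d j * (y j)⁻¹ ^ 2 = 0) (i j : Fin 3) :
    y i ^ 3 = y j ^ 3 := by
  simp only [Fin.sum_univ_three] at e₁ e₂ f₁ f₂
  have hn : ∀ a b : Fin 3, a ≠ b → y a ≠ y b := fun a b h => hy.ne h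
  have key : y 0 ^ 3 = y 1 ^ 3 ∧ y 0 ^ 3 = y 2 ^ 3 := by
    obtain ⟨l, hl⟩ := hd
    fin_cases l <;> simp only [Fin.zero_eta, Fin.mk_one, Fin.reduceFinMk] at hl
    · exact cube_eq_of_vandermonde_aux hl (hn 0 1 (by decide)) (hn 0 2 (by decide)) (h0 0) (h0 1)
        (h0 2) e₁ e₂ f₁ f₂
    · have := cube_eq_of_vandermonde_aux (d₂ := d 0) (d₃ := d 2) hl (hn 1 0 (by decide))
        (hn 1 2 (by decide)) (h0 1) (h0 0) (h0 2) (by linear_combination e₁)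
        (by linear_combination e₂) (by linear_combination f₁) (by linear_combination f₂)
      exact ⟨this.1.symm, this.1.symm.trans this.2⟩
    · have := cube_eq_of_vandermonde_aux (d₂ := d 0) (d₃ := d 1) hl (hn 2 0 (by decide))
        (hn 2 1 (by decide)) (h0 2) (h0 0) (h0 1) (by linear_combination e₁)
        (by linear_combination e₂) (by linear_combination f₁) (by linear_combination f₂)
      exact ⟨this.1.symm.trans this.2, this.1.symm⟩
  fin_cases i <;> fin_cases j <;> simp [key.1.symm, key.2.symm]

/-! ### Solutions in the residue field -/

/-- If exactly two of the `e j` agree up to sign, the equations separate into one for the third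
term, which forces its coefficient to vanish, and a system for the other two, which makes the
corresponding roots of unity equal or inverse to each other. -/
theorem residue_two_classes {k : Type*} [Field k] (h2 : (2 : k) ≠ 0)
    {c₁ c₂ c₃ s₁ s₂ s₃ w₁ w₂ w₃ e₁ e₂ e₃ : k}
    (hc : ¬ (c₁ = 0 ∧ c₂ = 0 ∧ c₃ = 0))
    (q₁ : w₁ ^ 2 - s₁ ^ 2 = 4) (q₂ : w₂ ^ 2 - s₂ ^ 2 = 4) (q₃ : w₃ ^ 2 - s₃ ^ 2 = 4)
    (he : e₁ ^ 2 = e₂ ^ 2) (he3 : e₃ ^ 2 ≠ e₁ ^ 2)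
    (a₀ : c₁ * s₁ + c₂ * s₂ + c₃ * s₃ = 0)
    (a₂ : c₁ * s₁ * e₁ ^ 2 + c₂ * s₂ * e₂ ^ 2 + c₃ * s₃ * e₃ ^ 2 = 0)
    (a₁ : c₁ * w₁ * e₁ + c₂ * w₂ * e₂ + c₃ * w₃ * e₃ = 0)
    (a₃ : c₁ * w₁ * e₁ ^ 3 + c₂ * w₂ * e₂ ^ 3 + c₃ * w₃ * e₃ ^ 3 = 0)
    (b₀ : c₁ * (s₁ * w₁) + c₂ * (s₂ * w₂) + c₃ * (s₃ * w₃) = 0)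
    (b₂ : c₁ * (s₁ * w₁) * e₁ ^ 2 + c₂ * (s₂ * w₂) * e₂ ^ 2 + c₃ * (s₃ * w₃) * e₃ ^ 2 = 0)
    (b₁ : c₁ * (w₁ ^ 2 - 2) * e₁ + c₂ * (w₂ ^ 2 - 2) * e₂ + c₃ * (w₃ ^ 2 - 2) * e₃ = 0)
    (b₃ : c₁ * (w₁ ^ 2 - 2) * e₁ ^ 3 + c₂ * (w₂ ^ 2 - 2) * e₂ ^ 3
      + c₃ * (w₃ ^ 2 - 2) * e₃ ^ 3 = 0)
    (n₁ : ¬ (s₁ = 0 ∧ e₁ = 0)) (n₂ : ¬ (s₂ = 0 ∧ e₂ = 0)) (n₃ : ¬ (s₃ = 0 ∧ e₃ = 0))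
    (m : ¬ (s₁ = s₂ ∧ w₁ = w₂ ∧ e₁ = e₂)) (m' : ¬ (s₁ = -s₂ ∧ w₁ = w₂ ∧ e₁ = -e₂)) : False := by
  have hv : e₃ ^ 2 - e₁ ^ 2 ≠ 0 := sub_ne_zero.2 he3
  have z₁ : c₃ * s₃ = 0 := (mul_eq_zero.1 (show (e₃ ^ 2 - e₁ ^ 2) * (c₃ * s₃) = 0 by
    linear_combination a₂ - e₁ ^ 2 * a₀ + c₂ * s₂ * he)).resolve_left hv
  have z₂ : c₃ * (w₃ * e₃) = 0 := (mul_eq_zero.1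
    (show (e₃ ^ 2 - e₁ ^ 2) * (c₃ * (w₃ * e₃)) = 0 by
      linear_combination a₃ - e₁ ^ 2 * a₁ + c₂ * w₂ * e₂ * he)).resolve_left hv
  have z₃ : c₃ = 0 := by
    by_contra h
    have hs : s₃ = 0 := (mul_eq_zero.1 z₁).resolve_left h
    have hw : w₃ * e₃ = 0 := (mul_eq_zero.1 z₂).resolve_left h
    rcases mul_eq_zero.1 hw with hw | hw
    · rw [hs, hw] at q₃
      exact mul_ne_zero h2 h2 (by linear_combination -q₃)
    · exact n₃ ⟨hs, hw⟩
  subst z₃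
  have hc1 : ¬ (c₁ = 0 ∧ c₂ = 0) := fun h => hc ⟨h.1, h.2, rfl⟩
  simp only [zero_mul, add_zero] at a₀ a₁ b₀ b₁
  have hw : c₁ * s₁ = 0 ∨ w₁ = w₂ := by
    have : (c₁ * s₁) * (w₁ - w₂) = 0 := by linear_combination b₀ - w₂ * a₀
    rcases mul_eq_zero.1 this with h | h
    · exact Or.inl h
    · exact Or.inr (sub_eq_zero.1 h)
  by_cases he1 : e₁ = 0
  · have he2 : e₂ = 0 := by
      have : e₂ ^ 2 = 0 := by rw [← he, he1]; ring
      exact pow_eq_zero_iff (two_ne_zero) |>.1 this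
    have hs1 : s₁ ≠ 0 := fun h => n₁ ⟨h, he1⟩
    have hs2 : s₂ ≠ 0 := fun h => n₂ ⟨h, he2⟩
    have hc2 : c₁ ≠ 0 := by
      rintro rfl
      exact hc1 ⟨rfl, (mul_eq_zero.1 (by linear_combination a₀ : c₂ * s₂ = 0)).resolve_right hs2⟩
    have hww : w₁ = w₂ := hw.resolve_left (mul_ne_zero hc2 hs1)
    have : (s₁ - s₂) * (s₁ + s₂) = 0 := by rw [hww] at q₁; linear_combination q₂ - q₁
    rcases mul_eq_zero.1 this with h | h
    · exact m ⟨sub_eq_zero.1 h, hww, by rw [he1, he2]⟩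
    · exact m' ⟨eq_neg_of_add_eq_zero_left h, hww, by rw [he1, he2, neg_zero]⟩
  · obtain ⟨t, ht, het⟩ : ∃ t : k, t ^ 2 = 1 ∧ e₂ = t * e₁ := by
      refine ⟨e₂ / e₁, ?_, by field_simp⟩
      rw [div_pow, ← he]; exact div_self (pow_ne_zero 2 he1)
    subst het
    have d₁ : c₁ * w₁ + t * (c₂ * w₂) = 0 := (mul_eq_zero.1
      (show e₁ * (c₁ * w₁ + t * (c₂ * w₂)) = 0 by linear_combination a₁)).resolve_left he1
    have d₂ : c₁ * (w₁ ^ 2 - 2) + t * (c₂ * (w₂ ^ 2 - 2)) = 0 := (mul_eq_zero.1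
      (show e₁ * (c₁ * (w₁ ^ 2 - 2) + t * (c₂ * (w₂ ^ 2 - 2))) = 0 by
        linear_combination b₁)).resolve_left he1
    have htt : t ≠ 0 := by rintro rfl; simp at ht
    by_cases hww : w₁ = w₂
    · subst hww
      have hct : c₁ + t * c₂ = 0 := by
        have : (2 : k) * (c₁ + t * c₂) = 0 := by linear_combination w₁ * d₁ - d₂
        exact (mul_eq_zero.1 this).resolve_left h2
      have hc2 : c₂ ≠ 0 := by
        rintro rfl
        exact hc1 ⟨by linear_combination hct, rfl⟩
      have hs : s₂ - t * s₁ = 0 := (mul_eq_zero.1 (show c₂ * (s₂ - t * s₁) = 0 by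
        linear_combination a₀ - s₁ * hct)).resolve_left hc2
      have : (t - 1) * (t + 1) = 0 := by linear_combination ht
      rcases mul_eq_zero.1 this with h | h
      · have : t = 1 := sub_eq_zero.1 h
        subst this
        exact m ⟨by linear_combination -hs, rfl, by ring⟩
      · have : t = -1 := eq_neg_of_add_eq_zero_left h
        subst this
        exact m' ⟨by linear_combination hs, rfl, by ring⟩
    · have h1 : c₁ * s₁ = 0 := hw.resolve_right hww
      have h2' : c₂ * s₂ = 0 := by linear_combination a₀ - h1
      have h4 : (4 : k) ≠ 0 := fun h => mul_ne_zero h2 h2 (by linear_combination h)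
      have key : ∀ {s w : k}, w ^ 2 - s ^ 2 = 4 → s = 0 → w ≠ 0 := by
        rintro s w q rfl rfl
        exact h4 (by linear_combination -q)
      have hc₁ : c₁ ≠ 0 := by
        intro h
        have h0 : c₂ ≠ 0 := fun h' => hc1 ⟨h, h'⟩
        have := key q₂ ((mul_eq_zero.1 h2').resolve_left h0)
        exact mul_ne_zero htt (mul_ne_zero h0 this) (by linear_combination d₁ - w₁ * h)
      have hs₁ := (mul_eq_zero.1 h1).resolve_left hc₁
      have hw₁ := key q₁ hs₁
      have hc₂ : c₂ ≠ 0 := by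
        intro h
        exact mul_ne_zero hc₁ hw₁ (by linear_combination d₁ - t * w₂ * h)
      have hs₂ := (mul_eq_zero.1 h2').resolve_left hc₂
      rw [hs₁] at q₁
      rw [hs₂] at q₂
      have hw₂ : w₁ + w₂ = 0 := (mul_eq_zero.1 (show (w₁ - w₂) * (w₁ + w₂) = 0 by
        linear_combination q₁ - q₂)).resolve_left (sub_ne_zero.2 hww)
      have hct : c₁ - t * c₂ = 0 := (mul_eq_zero.1 (show w₁ * (c₁ - t * c₂) = 0 by
        linear_combination d₁ - t * c₂ * hw₂)).resolve_left hw₁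
      have : 4 * c₁ = 0 := by
        linear_combination d₂ - c₁ * q₁ - t * c₂ * q₂ + 2 * hct
      exact mul_ne_zero h4 hc₁ this

theorem exists_eq_mul_of_sum_eq_zero {k : Type*} [Field k] {a f : Fin 3 → k}
    (hf : Function.Injective f) (h₀ : ∑ j, a j = 0) (h₁ : ∑ j, a j * f j = 0) :
    ∃ l, ∀ j, a j = l * (f (j + 1) - f (j + 2)) := by
  simp only [Fin.sum_univ_three] at h₀ h₁
  have hn : f 1 - f 2 ≠ 0 := sub_ne_zero.2 (hf.ne (by decide))
  refine ⟨a 0 / (f 1 - f 2), fun j => ?_⟩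
  rw [div_mul_eq_mul_div, eq_div_iff hn]
  fin_cases j
  · change a 0 * (f 1 - f 2) = a 0 * (f 1 - f 2)
    rfl
  · change a 1 * (f 1 - f 2) = a 0 * (f 2 - f 0)
    linear_combination h₁ - f 2 * h₀
  · change a 2 * (f 1 - f 2) = a 0 * (f 0 - f 1)
    linear_combination -h₁ + f 1 * h₀

/-- If the `e j ^ 2` are distinct, any two equations with weights `1` and `e j ^ 2` determine their
terms up to a common factor; comparing the four pairs leaves only `s = 0` with constant
`w`. -/
theorem residue_distinct_classes {k : Type*} [Field k] (h2 : (2 : k) ≠ 0)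
    {c s w e : Fin 3 → k} (hc : ∃ j, c j ≠ 0) (q : ∀ j, w j ^ 2 - s j ^ 2 = 4)
    (he : Function.Injective fun j => e j ^ 2)
    (a₀ : ∑ j, c j * s j = 0) (a₂ : ∑ j, c j * s j * e j ^ 2 = 0)
    (a₁ : ∑ j, c j * w j * e j = 0) (a₃ : ∑ j, c j * w j * e j ^ 3 = 0)
    (b₀ : ∑ j, c j * (s j * w j) = 0) (b₂ : ∑ j, c j * (s j * w j) * e j ^ 2 = 0)
    (b₁ : ∑ j, c j * (w j ^ 2 - 2) * e j = 0) (b₃ : ∑ j, c j * (w j ^ 2 - 2) * e j ^ 3 = 0)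
    (n : ∀ j, ¬ (s j = 0 ∧ e j = 0)) : (∀ j, s j = 0) ∧ ∀ i j, w i = w j := by
  have h4 : (4 : k) ≠ 0 := fun h => mul_ne_zero h2 h2 (by linear_combination h)
  have hE : ∀ j, e (j + 1) ^ 2 - e (j + 2) ^ 2 ≠ 0 := by
    intro j
    refine sub_ne_zero.2 (he.ne ?_)
    revert j; decide
  have hpow : ∀ (u : Fin 3 → k), ∑ j, u j * e j ^ 3 = 0 → ∑ j, u j * e j * e j ^ 2 = 0 := by
    intro u hu
    rw [← hu]
    exact Finset.sum_congr rfl fun j _ => by ring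
  obtain ⟨l, hl⟩ := exists_eq_mul_of_sum_eq_zero he a₀ a₂
  obtain ⟨l', hl'⟩ := exists_eq_mul_of_sum_eq_zero he b₀ b₂
  obtain ⟨m, hm⟩ := exists_eq_mul_of_sum_eq_zero he a₁ (hpow _ a₃)
  obtain ⟨m', hm'⟩ := exists_eq_mul_of_sum_eq_zero he b₁ (hpow _ b₃)
  by_cases hl0 : l = 0
  · have hcs : ∀ j, c j * s j = 0 := fun j => by rw [hl j, hl0, zero_mul]
    have hw : ∀ j, c j ≠ 0 → w j ^ 2 = 4 ∧ s j = 0 := by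
      intro j hj
      have : s j = 0 := (mul_eq_zero.1 (hcs j)).resolve_left hj
      have h := q j
      rw [this] at h
      exact ⟨by linear_combination h, this⟩
    obtain ⟨i, hi⟩ := hc
    have hm0 : m ≠ 0 := by
      intro h
      have h1 := hm i
      rw [h, zero_mul] at h1
      rcases mul_eq_zero.1 h1 with h1 | h1
      · have h3 := (mul_eq_zero.1 h1).resolve_left hi
        have := (hw i hi).1
        rw [h3] at this
        exact h4 (by linear_combination -this)
      · exact n i ⟨(hw i hi).2, h1⟩
    have hcj : ∀ j, c j ≠ 0 := by
      intro j hj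
      have h1 := hm j
      rw [hj] at h1
      exact mul_ne_zero hm0 (hE j) (by linear_combination -h1)
    refine ⟨fun j => (hw j (hcj j)).2, ?_⟩
    -- All `w j` equal `2 m / m'`.
    have key : ∀ j, w j * m' = 2 * m := by
      intro j
      have h1 := hm j
      have h3 := hm' j
      have h5 := (hw j (hcj j)).1
      apply mul_left_cancel₀ (hE j)
      linear_combination 2 * h1 - w j * h3 + c j * w j * e j * h5
    have hm0' : m' ≠ 0 := by
      intro h
      have := key i
      rw [h, mul_zero] at this
      exact mul_ne_zero h2 hm0 this.symm
    intro a b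
    exact mul_right_cancel₀ hm0' ((key a).trans (key b).symm)
  · exfalso
    have hw : ∀ j, w j * l = l' := by
      intro j
      apply mul_left_cancel₀ (hE j)
      linear_combination hl' j - w j * hl j
    have hww : ∀ j, w j = l' / l := fun j => by rw [eq_div_iff hl0, hw j]
    set w₀ := l' / l
    obtain ⟨ν, hν⟩ : ∃ ν, ∀ j, c j * e j = ν * (e (j + 1) ^ 2 - e (j + 2) ^ 2) := by
      refine ⟨(w₀ * m - m') / 2, fun j => ?_⟩
      have h1 := hm j
      have h3 := hm' j
      rw [hww j] at h1 h3
      field_simp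
      linear_combination w₀ * h1 - h3
    have hes : ∀ j, e j * l = ν * s j := by
      intro j
      apply mul_left_cancel₀ (hE j)
      linear_combination s j * hν j - e j * hl j
    have h01 : e 0 ^ 2 = e 1 ^ 2 := by
      apply mul_right_cancel₀ (pow_ne_zero 2 hl0)
      have q0 := q 0
      have q1 := q 1
      rw [hww] at q0 q1
      linear_combination (e 0 * l + ν * s 0) * hes 0 - (e 1 * l + ν * s 1) * hes 1
        - ν ^ 2 * (q0 - q1)
    exact absurd (he h01) (by decide)

/-- The equations modulo a prime `𝔭` above `p`, for roots of unity `y j * ζ ^ e j` with `ζ` of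
order `p`; here `s j = y j - 1 / y j` and `w j = y j + 1 / y j`. Unless all `y j` agree and are
`±1`, the `e j` agree up to sign. -/
theorem residue_cases {k : Type*} [Field k] (h2 : (2 : k) ≠ 0)
    {c s w e : Fin 3 → k} (hc : ∃ j, c j ≠ 0) (q : ∀ j, w j ^ 2 - s j ^ 2 = 4)
    (a₀ : ∑ j, c j * s j = 0) (a₂ : ∑ j, c j * s j * e j ^ 2 = 0)
    (a₁ : ∑ j, c j * w j * e j = 0) (a₃ : ∑ j, c j * w j * e j ^ 3 = 0)
    (b₀ : ∑ j, c j * (s j * w j) = 0) (b₂ : ∑ j, c j * (s j * w j) * e j ^ 2 = 0)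
    (b₁ : ∑ j, c j * (w j ^ 2 - 2) * e j = 0) (b₃ : ∑ j, c j * (w j ^ 2 - 2) * e j ^ 3 = 0)
    (n : ∀ j, ¬ (s j = 0 ∧ e j = 0))
    (m : ∀ i j, i ≠ j → ¬ (s i = s j ∧ w i = w j ∧ e i = e j))
    (m' : ∀ i j, i ≠ j → ¬ (s i = -s j ∧ w i = w j ∧ e i = -e j)) :
    (((∀ j, s j = 0) ∧ ∀ i j, w i = w j) ∧ Function.Injective fun j => e j ^ 2) ∨
      ∀ i j, e i ^ 2 = e j ^ 2 := by
  have hc' : ¬ (c 0 = 0 ∧ c 1 = 0 ∧ c 2 = 0) := by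
    rintro ⟨h0, h1, h2⟩
    obtain ⟨j, hj⟩ := hc
    fin_cases j
    exacts [hj h0, hj h1, hj h2]
  by_cases h01 : e 0 ^ 2 = e 1 ^ 2
  · by_cases h02 : e 2 ^ 2 = e 0 ^ 2
    · right
      have h : ∀ i, e i ^ 2 = e 0 ^ 2 := by
        intro i
        fin_cases i
        exacts [rfl, h01.symm, h02]
      exact fun i j => (h i).trans (h j).symm
    · exfalso
      simp only [Fin.sum_univ_three] at a₀ a₁ a₂ a₃ b₀ b₁ b₂ b₃
      exact residue_two_classes h2 hc' (q 0) (q 1) (q 2) h01 h02 a₀ a₂ a₁ a₃ b₀ b₂ b₁ b₃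
        (n 0) (n 1) (n 2) (m 0 1 (by decide)) (m' 0 1 (by decide))
  · by_cases h02 : e 0 ^ 2 = e 2 ^ 2
    · exfalso
      simp only [Fin.sum_univ_three] at a₀ a₁ a₂ a₃ b₀ b₁ b₂ b₃
      exact residue_two_classes h2 (c₁ := c 0) (c₂ := c 2) (c₃ := c 1)
        (fun h => hc' ⟨h.1, h.2.2, h.2.1⟩) (q 0) (q 2) (q 1) h02 (fun h => h01 h.symm)
        (by linear_combination a₀) (by linear_combination a₂) (by linear_combination a₁)
        (by linear_combination a₃) (by linear_combination b₀) (by linear_combination b₂)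
        (by linear_combination b₁) (by linear_combination b₃)
        (n 0) (n 2) (n 1) (m 0 2 (by decide)) (m' 0 2 (by decide))
    · by_cases h12 : e 1 ^ 2 = e 2 ^ 2
      · exfalso
        simp only [Fin.sum_univ_three] at a₀ a₁ a₂ a₃ b₀ b₁ b₂ b₃
        exact residue_two_classes h2 (c₁ := c 1) (c₂ := c 2) (c₃ := c 0)
          (fun h => hc' ⟨h.2.2, h.1, h.2.1⟩) (q 1) (q 2) (q 0) h12 h01
          (by linear_combination a₀) (by linear_combination a₂) (by linear_combination a₁)
          (by linear_combination a₃) (by linear_combination b₀) (by linear_combination b₂)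
          (by linear_combination b₁) (by linear_combination b₃)
          (n 1) (n 2) (n 0) (m 1 2 (by decide)) (m' 1 2 (by decide))
      · left
        have hinj : Function.Injective fun j => e j ^ 2 := by
          intro i j hij
          fin_cases i <;> fin_cases j <;> simp_all
        exact ⟨residue_distinct_classes h2 hc q hinj a₀ a₂ a₁ a₃ b₀ b₂ b₁ b₃ n, hinj⟩


/-! ### Solutions over a cyclotomic field -/

/-- The algebraic content of admissibility, over an abelian extension `L` of `ℚ`: the two relations,
with `c` linearly independent over `ℚ`, invariant under the cubes of all automorphisms (the field
generated by the `c j` being cyclic cubic), and orthogonal to its proper conjugates for the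
positive rational quadratic form with diagonal `q` (the ratios of moduli). -/
structure GaloisSolution {L : Type*} [Field L] [Algebra ℚ L] (c x : Fin 3 → L) (q : Fin 3 → ℚ) :
    Prop where
  relation_one : ∑ j, c j * (x j - (x j)⁻¹) = 0
  relation_two : ∑ j, c j * (x j ^ 2 - (x j)⁻¹ ^ 2) = 0
  independent : ∀ g : Fin 3 → ℚ, ∑ j, (g j : L) * c j = 0 → ∀ j, g j = 0
  ne_zero : ∀ j, x j ≠ 0
  sq_ne_one : ∀ j, x j ^ 2 ≠ 1
  injective : Function.Injective x
  mul_ne_one : ∀ i j, i ≠ j → x i * x j ≠ 1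
  map_cube : ∀ (σ : L ≃ₐ[ℚ] L) (j), σ (σ (σ (c j))) = c j
  pos : ∀ j, 0 < q j
  orthogonal : ∀ σ : L ≃ₐ[ℚ] L, (∃ j, σ (c j) ≠ c j) → ∑ j, (q j : L) * c j * σ (c j) = 0

/-- The `n`-th roots of unity of the `N`-th cyclotomic field, `n ∣ N`, are raised to any power `u`
prime to `n` by some automorphism, although `u` need not be prime to `N`. -/
theorem exists_algEquiv_eq_pow {L : Type*} [Field L] [Algebra ℚ L] {N : ℕ} [NeZero N]
    [IsCyclotomicExtension {N} ℚ L] {n : ℕ} (hn : n ∣ N) {u : ℕ} (hu : u.Coprime n) :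
    ∃ σ : L ≃ₐ[ℚ] L, ∀ x : L, x ^ n = 1 → σ x = x ^ u := by
  obtain ⟨v, hv⟩ := ZMod.unitsMap_surjective hn (ZMod.unitOfCoprime u hu)
  have hirr : Irreducible (Polynomial.cyclotomic N ℚ) :=
    Polynomial.cyclotomic.irreducible_rat (NeZero.pos N)
  have hζ := IsCyclotomicExtension.zeta_spec N ℚ L
  refine ⟨(IsCyclotomicExtension.autEquivPow L hirr).symm v, fun x hx => ?_⟩
  have hσ : (IsCyclotomicExtension.autEquivPow L hirr).symm v (IsCyclotomicExtension.zeta N ℚ L)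
      = IsCyclotomicExtension.zeta N ℚ L ^ (v : ZMod N).val := by
    have := hζ.autToPow_spec ℚ ((IsCyclotomicExtension.autEquivPow L hirr).symm v)
    rw [← this]
    congr 3
    exact ((IsCyclotomicExtension.autEquivPow L hirr).apply_symm_apply v)
  have hxN : x ^ N = 1 := by
    obtain ⟨d, rfl⟩ := hn
    rw [pow_mul, hx, one_pow]
  obtain ⟨i, -, rfl⟩ := hζ.eq_pow_of_pow_eq_one hxN
  rw [map_pow, hσ, ← pow_mul, mul_comm, pow_mul]
  apply pow_eq_pow_of_modEq _ hx
  have h1 : ((v : ZMod N).cast : ZMod n) = (u : ZMod n) := by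
    have := congrArg Units.val hv
    rwa [ZMod.unitsMap_val, ZMod.coe_unitOfCoprime] at this
  rw [← ZMod.natCast_eq_natCast_iff, ← h1, ZMod.natCast_val]

namespace GaloisSolution

variable {L : Type*} [Field L] [Algebra ℚ L] {c x : Fin 3 → L} {q : Fin 3 → ℚ}

theorem coeff_ne_zero (h : GaloisSolution c x q) (j : Fin 3) : c j ≠ 0 := by
  intro hj
  have := h.independent (Pi.single j 1) (by
    rw [Finset.sum_eq_single j (fun i _ hi => by simp [hi]) (by simp)]
    simp [hj]) j
  simp at this

theorem coeff_ne (h : GaloisSolution c x q) {i j : Fin 3} (hij : i ≠ j) (r : ℚ) :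
    c i ≠ r * c j := by
  intro he
  have := algebraRat.charZero L
  have := h.independent (Pi.single i 1 - Pi.single j r) (by
    simp only [Pi.sub_apply, Rat.cast_sub, sub_mul, Finset.sum_sub_distrib]
    rw [Finset.sum_eq_single i (fun l _ hl => by simp [hl]) (by simp),
      Finset.sum_eq_single j (fun l _ hl => by simp [hl]) (by simp)]
    simp [he]) i
  simp [hij] at this

theorem sub_inv_ne_zero (h : GaloisSolution c x q) (j : Fin 3) : x j - (x j)⁻¹ ≠ 0 := by
  intro h0
  apply h.sq_ne_one j
  have := h.ne_zero j
  field_simp at h0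
  linear_combination h0

/-- Two terms satisfy the relations only trivially. -/
theorem two_terms (h : GaloisSolution c x q) {i j : Fin 3} (hij : i ≠ j) {a b : L}
    (h₁ : a * (x i - (x i)⁻¹) + b * (x j - (x j)⁻¹) = 0)
    (h₂ : a * (x i ^ 2 - (x i)⁻¹ ^ 2) + b * (x j ^ 2 - (x j)⁻¹ ^ 2) = 0) : a = 0 := by
  have hi := h.ne_zero i
  have hj := h.ne_zero j
  have hd : (x i + (x i)⁻¹) - (x j + (x j)⁻¹) ≠ 0 := by
    have h1 : x i - x j ≠ 0 := sub_ne_zero.2 (h.injective.ne hij)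
    have h2 : x i * x j - 1 ≠ 0 := sub_ne_zero.2 (h.mul_ne_one i j hij)
    intro h0
    apply mul_ne_zero h1 h2
    field_simp at h0
    linear_combination h0
  have : a * ((x i - (x i)⁻¹) * ((x i + (x i)⁻¹) - (x j + (x j)⁻¹))) = 0 := by
    linear_combination h₂ - (x j + (x j)⁻¹) * h₁
  exact (mul_eq_zero.1 this).resolve_right (mul_ne_zero (h.sub_inv_ne_zero i) hd)

end GaloisSolution

/-- `x` or its inverse. -/
def orient {L : Type*} [Field L] (b : Bool) (x : L) : L := if b then x else x⁻¹

/-- `c` or its negative: the coefficient of `orient b x - (orient b x)⁻¹` in place of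
`c * (x - x⁻¹)`. -/
def orientSign {L : Type*} [Field L] (b : Bool) (c : L) : L := if b then c else -c

namespace GaloisSolution

variable {L : Type*} [Field L] [Algebra ℚ L] {c x : Fin 3 → L} {q : Fin 3 → ℚ}

theorem orient_injective (h : GaloisSolution c x q) (b : Fin 3 → Bool) :
    Function.Injective fun j => orient (b j) (x j) := by
  intro i j hij
  by_contra hne
  have hi := h.ne_zero i
  have hj := h.ne_zero j
  have h1 := h.injective.ne hne
  have h2 := h.mul_ne_one i j hne
  simp only [orient] at hij
  cases hbi : b i <;> cases hbj : b j <;> simp only [hbi, hbj, if_true, if_false,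
    Bool.false_eq_true] at hij
  · exact h1 (inv_injective hij)
  · exact h2 (by rw [← hij, mul_inv_cancel₀ hi])
  · exact h2 (by rw [hij, inv_mul_cancel₀ hj])
  · exact h1 hij

theorem orient_ne_zero (h : GaloisSolution c x q) (b : Bool) (j : Fin 3) :
    orient b (x j) ≠ 0 := by
  have := h.ne_zero j
  unfold orient
  split_ifs <;> simpa

/-- A coset of the cube roots of unity forces `c` to be constant up to sign. -/
theorem false_of_orient_cube_eq (h : GaloisSolution c x q) (b : Fin 3 → Bool)
    (hb : ∀ i j, orient (b i) (x i) ^ 3 = orient (b j) (x j) ^ 3) : False := by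
  set X : Fin 3 → L := fun j => orient (b j) (x j) with hX
  set D : Fin 3 → L := fun j => orientSign (b j) (c j) with hD
  have hX0 : ∀ j, X j ≠ 0 := fun j => h.orient_ne_zero (b j) j
  have hinj : Function.Injective X := h.orient_injective b
  have hquad : ∀ i j, i ≠ j → X i ^ 2 + X i * X j + X j ^ 2 = 0 := by
    intro i j hij
    have h1 : X i - X j ≠ 0 := sub_ne_zero.2 (hinj.ne hij)
    have h3 : X i ^ 3 = X j ^ 3 := hb i j
    exact (mul_eq_zero.1 (show (X i - X j) * (X i ^ 2 + X i * X j + X j ^ 2) = 0 by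
      linear_combination h3)).resolve_left h1
  have hsum : X 0 + X 1 + X 2 = 0 := by
    have h1 : X 1 - X 2 ≠ 0 := sub_ne_zero.2 (hinj.ne (by decide))
    exact (mul_eq_zero.1 (show (X 1 - X 2) * (X 0 + X 1 + X 2) = 0 by
      linear_combination hquad 0 1 (by decide) - hquad 0 2 (by decide))).resolve_left h1
  have hsq : X 0 ^ 2 + X 1 ^ 2 + X 2 ^ 2 = 0 := by
    linear_combination 2 * hquad 0 1 (by decide) + (X 2 - X 0 - X 1) * hsum
  have hinv : (X 0)⁻¹ + (X 1)⁻¹ + (X 2)⁻¹ = 0 := by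
    have h0 := hX0 0
    have h1 := hX0 1
    have h2 := hX0 2
    field_simp
    linear_combination -hquad 0 1 (by decide) + (X 0 + X 1) * hsum
  have hinvsq : (X 0)⁻¹ ^ 2 + (X 1)⁻¹ ^ 2 + (X 2)⁻¹ ^ 2 = 0 := by
    have h0 := hX0 0
    have h1 := hX0 1
    have h2 := hX0 2
    have : X 1 * X 2 + X 0 * X 2 + X 0 * X 1 = 0 := by
      linear_combination -hquad 0 1 (by decide) + (X 0 + X 1) * hsum
    field_simp
    linear_combination (X 1 * X 2 + X 0 * X 2 + X 0 * X 1) * this - 2 * X 0 * X 1 * X 2 * hsum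
  have s₁ : ∀ j, orientSign (b j) (1 : L) * (x j - (x j)⁻¹) = X j - (X j)⁻¹ := by
    intro j
    simp only [hX, orient, orientSign]
    split_ifs <;> simp
  have s₂ : ∀ j, orientSign (b j) (1 : L) * (x j ^ 2 - (x j)⁻¹ ^ 2) = X j ^ 2 - (X j)⁻¹ ^ 2 := by
    intro j
    simp only [hX, orient, orientSign]
    split_ifs <;> simp
  have r₁ := h.relation_one
  have r₂ := h.relation_two
  simp only [Fin.sum_univ_three] at r₁ r₂
  have hε : ∀ j, orientSign (b j) (1 : L) ^ 2 = 1 := by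
    intro j
    simp only [orientSign]
    split_ifs <;> simp
  set ε : Fin 3 → L := fun j => orientSign (b j) (1 : L) with hεdef
  have hz : c 1 - ε 1 * ε 0 * c 0 = 0 := by
    apply h.two_terms (i := 1) (j := 2) (by decide) (b := c 2 - ε 2 * ε 0 * c 0)
    · linear_combination r₁ - ε 0 * c 0 * (s₁ 0 + s₁ 1 + s₁ 2) - ε 0 * c 0 * (hsum - hinv)
        + c 0 * (x 0 - (x 0)⁻¹) * hε 0
    · linear_combination r₂ - ε 0 * c 0 * (s₂ 0 + s₂ 1 + s₂ 2) - ε 0 * c 0 * (hsq - hinvsq)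
        + c 0 * (x 0 ^ 2 - (x 0)⁻¹ ^ 2) * hε 0
  have : ∃ r : ℚ, ε 1 * ε 0 = (r : L) := by
    simp only [hεdef, orientSign]
    split_ifs
    · exact ⟨1, by simp⟩
    · exact ⟨-1, by simp⟩
    · exact ⟨-1, by simp⟩
    · exact ⟨1, by simp⟩
  obtain ⟨r, hr⟩ := this
  refine h.coeff_ne (i := 1) (j := 0) (by decide) r ?_
  rw [← hr]
  linear_combination hz

end GaloisSolution


/-! ### Splitting along a square factor of the order -/

namespace GaloisSolution

variable {L : Type*} [Field L] [Algebra ℚ L] {c x : Fin 3 → L} {q : Fin 3 → ℚ}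

/-- The relations hold for the conjugates of `x` under cubes. -/
theorem relation_conj {N : ℕ} [NeZero N] [IsCyclotomicExtension {N} ℚ L]
    (h : GaloisSolution c x q) {n : ℕ} (hn : n ∣ N) (hx : ∀ j, x j ^ n = 1)
    {u : ℕ} (hu : u.Coprime n) {r : ℕ} (hr : r = 1 ∨ r = 2) :
    ∑ j, c j * (x j ^ (r * u ^ 3) - (x j)⁻¹ ^ (r * u ^ 3)) = 0 := by
  obtain ⟨σ, hσ⟩ := exists_algEquiv_eq_pow (L := L) hn hu
  have h1 : ∀ j, σ (σ (σ (x j))) = x j ^ u ^ 3 := by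
    intro j
    rw [hσ _ (hx j), map_pow, hσ _ (hx j), map_pow, map_pow, hσ _ (hx j), ← pow_mul, ← pow_mul]
    ring_nf
  have h0 : ∑ j, c j * (x j ^ r - (x j)⁻¹ ^ r) = 0 := by
    rcases hr with rfl | rfl
    · simpa using h.relation_one
    · exact h.relation_two
  have := congrArg (fun z => σ (σ (σ z))) h0
  simp only [map_sum, map_mul, h.map_cube, map_sub, map_pow, map_inv₀, h1, map_zero] at this
  rw [← this]
  refine Finset.sum_congr rfl fun j _ => ?_
  rw [mul_comm r, pow_mul, pow_mul, inv_pow]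

/-- Fourier inversion on the group of `m`-th roots of unity, for the relation `r`. -/
theorem fiber_relation {m : ℕ} (hm : m ≠ 0) {w : Fin 3 → L} (hw : ∀ j, w j ^ m = 1)
    (hrel : ∀ t : ℕ, ∑ j, c j * (x j * w j ^ t - (x j)⁻¹ * (w j)⁻¹ ^ t) = 0)
    {v : L} (hv : v ^ m = 1) [DecidableEq L] :
    ∑ j, c j * ((if w j = v then x j else 0) - (if (w j)⁻¹ = v then (x j)⁻¹ else 0)) = 0 := by
  have := algebraRat.charZero L
  have hv0 : v ≠ 0 := by rintro rfl; simp [hm] at hv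
  have hgeom : ∀ z : L, z ^ m = 1 →
      ∑ t ∈ Finset.range m, v⁻¹ ^ t * z ^ t = if z = v then (m : L) else 0 := by
    intro z hz
    have : ∀ t, v⁻¹ ^ t * z ^ t = (v⁻¹ * z) ^ t := fun t => (mul_pow _ _ _).symm
    simp only [this]
    split_ifs with hzv
    · rw [hzv, inv_mul_cancel₀ hv0]; simp
    · have hne : v⁻¹ * z ≠ 1 := by
        intro h
        apply hzv
        field_simp at h
        exact h
      rw [geom_sum_eq hne, mul_pow, inv_pow, hz, hv]
      simp
  have hsum : ∑ t ∈ Finset.range m,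
      v⁻¹ ^ t * ∑ j, c j * (x j * w j ^ t - (x j)⁻¹ * (w j)⁻¹ ^ t) = 0 :=
    Finset.sum_eq_zero fun t _ => by rw [hrel, mul_zero]
  have hm' : (m : L) ≠ 0 := Nat.cast_ne_zero.2 hm
  apply mul_left_cancel₀ hm'
  rw [mul_zero]
  refine Eq.trans ?_ hsum
  simp only [Finset.mul_sum (ι := Fin 3)]
  rw [Finset.sum_comm]
  refine Finset.sum_congr rfl fun j _ => ?_
  have h1 := hgeom (w j) (hw j)
  have h2 := hgeom (w j)⁻¹ (by rw [inv_pow, hw j, inv_one])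
  calc (m : L) * (c j * ((if w j = v then x j else 0) - if (w j)⁻¹ = v then (x j)⁻¹ else 0))
      = c j * (x j * (if w j = v then (m : L) else 0)
          - (x j)⁻¹ * (if (w j)⁻¹ = v then (m : L) else 0)) := by
        split_ifs <;> ring
    _ = _ := by
        rw [← h1, ← h2, Finset.mul_sum, Finset.mul_sum, ← Finset.sum_sub_distrib, Finset.mul_sum]
        exact Finset.sum_congr rfl fun t _ => by ring

theorem exists_ne_of_sum_eq_zero {M : Type*} [AddCommGroup M] {a : Fin 3 → M}
    (h : ∑ j, a j = 0) {l : Fin 3} (hl : a l ≠ 0) : ∃ m, m ≠ l ∧ a m ≠ 0 := by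
  by_contra! hc
  exact hl ((Finset.sum_eq_single l (fun m _ hm => hc m hm)
    (fun h' => absurd (Finset.mem_univ l) h')).symm.trans h)

/-- If all `a ≡ 1` modulo `n / m` are cubes modulo `n`, then `x j ^ (n / m)` has order dividing
`4`. Otherwise the relations hold on each class of the `x j ^ (n / m)` separately, which forces all
`x j`, up to inversion, into one coset of the cube roots of unity. -/
theorem pow_eq_one_of_cubes {N : ℕ} [NeZero N] [IsCyclotomicExtension {N} ℚ L]
    (h : GaloisSolution c x q) {n m d : ℕ} (hn : n ∣ N) (hx : ∀ j, x j ^ n = 1) (hnm : n = m * d)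
    (hu : ∀ t : ℕ, ∃ u : ℕ, u.Coprime n ∧ u ^ 3 ≡ 1 + t * d [MOD n]) (j₀ : Fin 3) :
    (x j₀ ^ d) ^ 4 = 1 := by
  classical
  by_contra hv4
  have hN : N ≠ 0 := NeZero.ne N
  have hm : m ≠ 0 := by
    rintro rfl
    rw [zero_mul] at hnm
    exact hN (Nat.eq_zero_of_zero_dvd (hnm ▸ hn))
  set w : Fin 3 → L := fun j => x j ^ d with hwdef
  have hw : ∀ j, w j ^ m = 1 := fun j => by rw [hwdef, ← pow_mul, mul_comm, ← hnm, hx]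
  have hrel : ∀ r : ℕ, r = 1 ∨ r = 2 → ∀ t : ℕ,
      ∑ j, c j * (x j ^ r * (w j ^ r) ^ t - (x j ^ r)⁻¹ * (w j ^ r)⁻¹ ^ t) = 0 := by
    intro r hr t
    obtain ⟨u, hun, hut⟩ := hu t
    rw [← h.relation_conj hn hx hun hr]
    refine Finset.sum_congr rfl fun j _ => ?_
    have : x j ^ (r * u ^ 3) = x j ^ r * (w j ^ r) ^ t := by
      rw [mul_comm, pow_mul, pow_eq_pow_of_modEq hut (hx j), ← pow_mul, hwdef]
      simp only [← pow_mul, ← pow_add]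
      congr 1; ring
    rw [inv_pow (x j), this, mul_inv, inv_pow (w j ^ r)]
  have hE : ∀ v : L, v ^ m = 1 → ∑ j, c j * ((if w j = v then x j else 0)
      - (if (w j)⁻¹ = v then (x j)⁻¹ else 0)) = 0 := fun v hv =>
    fiber_relation hm hw (by simpa using hrel 1 (Or.inl rfl)) hv
  have hw0 : ∀ j, w j ≠ 0 := fun j => pow_ne_zero _ (h.ne_zero j)
  -- No `w l` is isolated up to inversion, so that all of them agree up to inversion.
  have hpart : ∀ l, ∃ j, j ≠ l ∧ (w j = w l ∨ (w j)⁻¹ = w l) := by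
    intro l
    have hl : c l * ((if w l = w l then x l else 0)
        - (if (w l)⁻¹ = w l then (x l)⁻¹ else 0)) ≠ 0 := by
      apply mul_ne_zero (h.coeff_ne_zero l)
      rw [if_pos rfl]
      split_ifs
      · exact h.sub_inv_ne_zero l
      · simpa using h.ne_zero l
    obtain ⟨j, hj, hne⟩ := exists_ne_of_sum_eq_zero (hE (w l) (hw l)) hl
    refine ⟨j, hj, ?_⟩
    by_contra hcon
    push Not at hcon
    simp [hcon.1, hcon.2] at hne
  have hsymm : ∀ i j, (w i = w j ∨ (w i)⁻¹ = w j) → (w j = w i ∨ (w j)⁻¹ = w i) := by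
    rintro i j (h1 | h1)
    · exact Or.inl h1.symm
    · exact Or.inr (by rw [← h1, inv_inv])
  have htrans : ∀ i j k, (w i = w j ∨ (w i)⁻¹ = w j) → (w j = w k ∨ (w j)⁻¹ = w k) →
      (w i = w k ∨ (w i)⁻¹ = w k) := by
    rintro i j k (h1 | h1) (h2 | h2)
    · exact Or.inl (h1.trans h2)
    · exact Or.inr (by rw [h1, h2])
    · exact Or.inr (h1.trans h2)
    · exact Or.inl (by rw [← h2, ← h1, inv_inv])
  have hall : ∀ j, w j = w j₀ ∨ (w j)⁻¹ = w j₀ := by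
    intro j
    by_cases hj : j = j₀
    · exact Or.inl (by rw [hj])
    obtain ⟨a, ha, ha'⟩ := hpart j₀
    obtain ⟨b, hb, hb'⟩ := hpart j
    by_cases haj : a = j
    · exact haj ▸ ha'
    by_cases hbj : b = j₀
    · exact hsymm _ _ (hbj ▸ hb')
    have : a = b := by
      clear * - hj ha hb haj hbj
      revert j j₀ a b; decide
    subst this
    exact htrans _ _ _ (hsymm _ _ hb') ha'
  set v := w j₀ with hv
  have hv0 : v ≠ 0 := hw0 j₀
  have hvv : v⁻¹ ≠ v := by
    intro h1
    apply hv4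
    have : v * v = 1 := by nth_rewrite 1 [← h1]; exact inv_mul_cancel₀ hv0
    linear_combination (v * v + 1) * this
  have hvv2 : (v ^ 2)⁻¹ ≠ v ^ 2 := by
    intro h1
    apply hv4
    have h2 : v ^ 2 * v ^ 2 = 1 := by
      nth_rewrite 1 [← h1]; exact inv_mul_cancel₀ (pow_ne_zero 2 hv0)
    linear_combination h2
  set b : Fin 3 → Bool := fun j => decide (w j = v) with hb
  set X : Fin 3 → L := fun j => orient (b j) (x j) with hX
  set D : Fin 3 → L := fun j => orientSign (b j) (c j) with hD
  have hcase : ∀ j, (b j = true ∧ w j = v) ∨ (b j = false ∧ w j = v⁻¹) := by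
    intro j
    rcases hall j with h1 | h1
    · exact Or.inl ⟨by simp [hb, h1], h1⟩
    · have h2 : w j = v⁻¹ := by rw [← h1, inv_inv]
      exact Or.inr ⟨by simp only [hb, h2, decide_eq_false_iff_not]; exact hvv, h2⟩
  -- The relations on the classes of `v`, `v⁻¹` (and of their squares) form a Vandermonde system for
  -- the `x j`, inverted where `w j = v⁻¹`.
  have e₁ : ∑ j, D j * X j = 0 := by
    rw [← hE v (hw j₀)]
    refine Finset.sum_congr rfl fun j _ => ?_
    rcases hcase j with ⟨h1, h2⟩ | ⟨h1, h2⟩ <;> simp [hD, hX, orient, orientSign, h1, h2, hvv]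
  have f₁ : ∑ j, D j * (X j)⁻¹ = 0 := by
    have := hE v⁻¹ (by rw [inv_pow, hw j₀, inv_one])
    rw [← neg_eq_zero, ← Finset.sum_neg_distrib, ← this]
    refine Finset.sum_congr rfl fun j _ => ?_
    rcases hcase j with ⟨h1, h2⟩ | ⟨h1, h2⟩ <;>
      simp [hD, hX, orient, orientSign, h1, h2, hvv.symm]
  have hE2 : ∀ v' : L, v' ^ m = 1 → ∑ j, c j * ((if w j ^ 2 = v' then x j ^ 2 else 0)
      - (if (w j ^ 2)⁻¹ = v' then (x j ^ 2)⁻¹ else 0)) = 0 := fun v' hv' =>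
    fiber_relation hm (x := fun j => x j ^ 2) (w := fun j => w j ^ 2)
      (fun j => by rw [← pow_mul, mul_comm, pow_mul, hw, one_pow]) (hrel 2 (Or.inr rfl)) hv'
  have hvm : (v ^ 2) ^ m = 1 := by rw [← pow_mul, mul_comm, pow_mul, hw j₀, one_pow]
  have e₂ : ∑ j, D j * X j ^ 2 = 0 := by
    rw [← hE2 (v ^ 2) hvm]
    refine Finset.sum_congr rfl fun j _ => ?_
    rcases hcase j with ⟨h1, h2⟩ | ⟨h1, h2⟩ <;> simp [hD, hX, orient, orientSign, h1, h2, hvv2]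
  have f₂ : ∑ j, D j * (X j)⁻¹ ^ 2 = 0 := by
    have := hE2 (v ^ 2)⁻¹ (by rw [inv_pow, hvm, inv_one])
    rw [← neg_eq_zero, ← Finset.sum_neg_distrib, ← this]
    refine Finset.sum_congr rfl fun j _ => ?_
    rcases hcase j with ⟨h1, h2⟩ | ⟨h1, h2⟩ <;>
      simp [hD, hX, orient, orientSign, h1, h2, hvv2.symm]
  refine h.false_of_orient_cube_eq b fun i j => ?_
  refine cube_eq_of_vandermonde (d := D) ⟨0, ?_⟩ (h.orient_injective b)
    (fun j => h.orient_ne_zero _ j) e₁ e₂ f₁ f₂ i j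
  have := h.coeff_ne_zero 0
  simp only [hD, orientSign]
  split_ifs <;> simpa

/-- If all `a ≡ 1` modulo `n / m` are cubes modulo the common order `n` of the `x j`, then `m` is a
divisor of `4`. -/
theorem not_sq_dvd {N : ℕ} [NeZero N] [IsCyclotomicExtension {N} ℚ L]
    (h : GaloisSolution c x q) {n m d : ℕ} (hn : n ∣ N) (hn0 : n ≠ 0)
    (hx : ∀ k, (∀ j, x j ^ k = 1) ↔ n ∣ k) (hnm : n = m * d)
    (hu : ∀ t : ℕ, ∃ u : ℕ, u.Coprime n ∧ u ^ 3 ≡ 1 + t * d [MOD n]) : m ∣ 4 := by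
  have h1 : n ∣ d * 4 := by
    rw [← hx]
    intro j
    rw [pow_mul]
    exact h.pow_eq_one_of_cubes hn ((hx n).2 dvd_rfl) hnm hu j
  rw [hnm, mul_comm] at h1
  have hd : 0 < d := Nat.pos_of_ne_zero (by rintro rfl; simp at hnm; exact hn0 hnm)
  exact Nat.dvd_of_mul_dvd_mul_left hd h1

end GaloisSolution


/-! ### Reduction modulo a prime above `p` -/

open Polynomial in
/-- An exponential sum with a zero of order `m` at `1` has vanishing moments of order below `m`. -/
theorem sum_mul_pow_eq_zero_of_dvd {k ι : Type*} [CommRing k] [Fintype ι] (e : ι → ℕ) :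
    ∀ (r m : ℕ) (A : ι → k), r < m → (X - C 1) ^ m ∣ ∑ i, C (A i) * X ^ e i →
      ∑ i, A i * (e i : k) ^ r = 0 := by
  intro r
  induction r with
  | zero =>
    intro m A hm hdvd
    have h1 := (dvd_pow_self (X - C (1 : k)) (Nat.pos_iff_ne_zero.1 hm)).trans hdvd
    rw [dvd_iff_isRoot, IsRoot.def, eval_finsetSum] at h1
    simpa using h1
  | succ r ih =>
    intro m A hm hdvd
    -- Apply the derivation `X d/dX`.
    have h1 : (X - C 1) ^ (m - 1) ∣ X * derivative (∑ i, C (A i) * X ^ e i) :=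
      (pow_sub_one_dvd_derivative_of_pow_dvd hdvd).mul_left _
    have h2 : X * derivative (∑ i, C (A i) * X ^ e i) =
        ∑ i, C (A i * (e i : k)) * X ^ e i := by
      rw [derivative_sum, Finset.mul_sum]
      refine Finset.sum_congr rfl fun i _ => ?_
      rw [derivative_C_mul_X_pow]
      rcases Nat.eq_zero_or_pos (e i) with h | h
      · simp [h]
      · rw [mul_left_comm, ← pow_succ', Nat.sub_add_cancel h]
    rw [h2] at h1
    rw [← ih (m - 1) _ (by omega) h1]
    exact Finset.sum_congr rfl fun i _ => by ring

open Polynomial in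
/-- If an exponential sum with coefficients in a valuation ring above `p` vanishes at several powers
of a `p`-th root of unity `ζ`, its low order derivatives at `1` vanish in the residue field, as
`ζ` reduces to `1`. -/
theorem sum_residue_eq_zero {L : Type*} [Field L] (V : ValuationSubring L) {p : ℕ} [Fact p.Prime]
    [CharP (IsLocalRing.ResidueField V) p] {ζ : V} (hζ : ζ ^ p = 1)
    {ι κ : Type*} [Fintype ι] [Fintype κ] (A : ι → V) (e : ι → ℕ) (a : κ → ℕ)
    (ha : Function.Injective fun l => ζ ^ a l)
    (h : ∀ l, ∑ i, A i * ζ ^ (a l * e i) = 0) {r : ℕ} (hr : r < Fintype.card κ) :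
    ∑ i, IsLocalRing.residue V (A i) * (e i : IsLocalRing.ResidueField V) ^ r = 0 := by
  have hζ1 : IsLocalRing.residue V ζ = 1 := by
    have : (IsLocalRing.residue V ζ - 1) ^ p = 0 := by
      rw [sub_pow_char, ← map_pow, hζ, map_one, one_pow, sub_self]
    exact sub_eq_zero.1 (pow_eq_zero_iff (Fact.out : p.Prime).ne_zero |>.1 this)
  set F : V[X] := ∑ i, C (A i) * X ^ e i with hF
  have hdvd : ∏ l, (X - C (ζ ^ a l)) ∣ F := by
    by_cases hF0 : F = 0
    · rw [hF0]; exact dvd_zero _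
    have h1 : (Multiset.map (fun b => X - C b)
        (Finset.univ.val.map fun l => ζ ^ a l)).prod ∣ F := by
      rw [Multiset.prod_X_sub_C_dvd_iff_le_roots hF0,
        Multiset.le_iff_subset (Finset.univ.nodup.map ha)]
      intro b hb
      obtain ⟨l, -, rfl⟩ := Multiset.mem_map.1 hb
      rw [mem_roots hF0, IsRoot.def, hF, eval_finsetSum, ← h l]
      refine Finset.sum_congr rfl fun i _ => ?_
      rw [eval_C_mul, eval_pow, eval_X, pow_mul]
    rwa [Multiset.map_map] at h1
  have h2 := map_dvd (mapRingHom (IsLocalRing.residue V)) hdvd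
  apply sum_mul_pow_eq_zero_of_dvd e r (Fintype.card κ) _ hr
  simpa [hF, map_prod, Polynomial.map_sum, hζ1] using h2

/-- There is a valuation ring of `L` above every prime. -/
theorem exists_valuationSubring_mem_nonunits (L : Type*) [Field L] [CharZero L] {p : ℕ}
    (hp : p.Prime) : ∃ V : ValuationSubring L, (p : L) ∈ V.nonunits := by
  set f := Int.castRingHom L
  have hI : Ideal.span {f.rangeRestrict (p : ℤ)} ≠ ⊤ := by
    rw [Ne, Ideal.span_singleton_eq_top]
    intro h
    obtain ⟨b, hb⟩ := isUnit_iff_exists_inv.1 h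
    obtain ⟨b, rfl⟩ := f.rangeRestrict_surjective b
    rw [← map_mul] at hb
    have h1 : ((p * b : ℤ) : L) = ((1 : ℤ) : L) := by
      have := congrArg Subtype.val hb
      simpa [f] using this
    have h2 := Int.cast_injective h1
    have := Int.isUnit_iff.1 (IsUnit.of_mul_eq_one _ h2)
    have := hp.two_le
    omega
  obtain ⟨V, -, hV⟩ := Ideal.image_subset_nonunits_valuationSubring _ hI
  refine ⟨V, hV ⟨f.rangeRestrict (p : ℤ), Ideal.subset_span rfl, ?_⟩⟩
  simp [f]

theorem ValuationSubring.charP_residueField {L : Type*} [Field L] {V : ValuationSubring L} {p : ℕ}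
    (hp : p.Prime) (hV : (p : L) ∈ V.nonunits) : CharP (IsLocalRing.ResidueField V) p := by
  rw [CharP.charP_iff_prime_eq_zero hp]
  rw [ValuationSubring.mem_nonunits_iff_exists_mem_maximalIdeal] at hV
  obtain ⟨h1, h2⟩ := hV
  have : (⟨(p : L), h1⟩ : V) = (p : V) := Subtype.ext (by simp)
  rw [this, ← IsLocalRing.residue_eq_zero_iff, map_natCast] at h2
  exact h2

theorem ValuationSubring.mem_of_pow_eq_one {L : Type*} [Field L] (V : ValuationSubring L) {x : L}
    {n : ℕ} (hn : n ≠ 0) (hx : x ^ n = 1) : x ∈ V := by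
  rcases V.mem_or_inv_mem x with h | h
  · exact h
  · have hx0 : x ≠ 0 := by rintro rfl; simp [hn] at hx
    have : x = x⁻¹ ^ (n - 1) := by
      obtain ⟨m, rfl⟩ := Nat.exists_eq_succ_of_ne_zero hn
      rw [Nat.succ_sub_one, inv_pow]
      rw [pow_succ] at hx
      field_simp
      linear_combination hx
    rw [this]
    exact pow_mem h _

/-- Roots of unity of order prime to the residue characteristic reduce injectively. -/
theorem eq_one_of_residue_eq_one {L : Type*} [Field L] {V : ValuationSubring L} {p : ℕ}
    [CharP (IsLocalRing.ResidueField V) p] {x : V} {d : ℕ} (hx : x ^ d = 1) (hd : ¬ p ∣ d)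
    (h1 : IsLocalRing.residue V x = 1) : x = 1 := by
  by_contra hne
  have h2 : ∑ i ∈ Finset.range d, x ^ i = 0 := by
    have := mul_geom_sum x d
    rw [hx, sub_self] at this
    exact (mul_eq_zero.1 this).resolve_left (sub_ne_zero.2 hne)
  have h3 := congrArg (IsLocalRing.residue V) h2
  rw [map_sum] at h3
  simp only [map_pow, h1, one_pow, Finset.sum_const, Finset.card_range, nsmul_eq_mul, mul_one,
    map_zero] at h3
  exact hd ((CharP.cast_eq_zero_iff _ p d).1 h3)


/-! ### No prime other than `2`, `3`, `7` divides the order exactly once -/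

namespace GaloisSolution

variable {L : Type*} [Field L] [Algebra ℚ L] {c x : Fin 3 → L} {q : Fin 3 → ℚ}

/-- Splitting off the `p`-part of the `x j`, and conjugating it alone. -/
theorem exists_prime_part {N : ℕ} [NeZero N] [IsCyclotomicExtension {N} ℚ L]
    (h : GaloisSolution c x q) {p d : ℕ} (hp : p.Prime) (hn : p * d ∣ N) (hpd : ¬ p ∣ d)
    (hx : ∀ j, x j ^ (p * d) = 1) :
    ∃ y z : Fin 3 → L, (∀ j, x j = y j * z j) ∧ (∀ j, y j ^ d = 1) ∧ (∀ j, z j ^ p = 1) ∧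
      ∀ t r : ℕ, t.Coprime p → (r = 1 ∨ r = 2) →
        ∑ j, c j * (y j ^ r * z j ^ (r * t ^ 3) - (y j)⁻¹ ^ r * (z j)⁻¹ ^ (r * t ^ 3)) = 0 := by
  have hcop : Nat.Coprime p d := (Nat.Prime.coprime_iff_not_dvd hp).2 hpd
  obtain ⟨α, hα, hα'⟩ := Nat.chineseRemainder hcop 0 1
  obtain ⟨β, hβ, hβ'⟩ := Nat.chineseRemainder hcop 1 0
  have hy : ∀ j, (x j ^ α) ^ d = 1 := fun j => by
    obtain ⟨a, rfl⟩ := (Nat.modEq_zero_iff_dvd).1 hα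
    rw [← pow_mul, show p * a * d = p * d * a by ring, pow_mul, hx, one_pow]
  have hz : ∀ j, (x j ^ β) ^ p = 1 := fun j => by
    obtain ⟨a, rfl⟩ := (Nat.modEq_zero_iff_dvd).1 hβ'
    rw [← pow_mul, show d * a * p = p * d * a by ring, pow_mul, hx, one_pow]
  have hxyz : ∀ j, x j = x j ^ α * x j ^ β := fun j => by
    have : α + β ≡ 1 [MOD p * d] := (Nat.modEq_and_modEq_iff_modEq_mul hcop).1
      ⟨by simpa using hα.add hβ, by simpa using hα'.add hβ'⟩
    rw [← pow_add, pow_eq_pow_of_modEq this (hx j), pow_one]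
  refine ⟨fun j => x j ^ α, fun j => x j ^ β, hxyz, hy, hz, fun t r ht hr => ?_⟩
  obtain ⟨u, hu, hu'⟩ := Nat.chineseRemainder hcop t 1
  have hun : u.Coprime (p * d) := Nat.Coprime.mul_right
    (by rw [Nat.Coprime, hu.gcd_eq]; exact ht) (by rw [Nat.Coprime, hu'.gcd_eq]; simp)
  have := h.relation_conj hn hx hun hr
  rw [← this]
  refine Finset.sum_congr rfl fun j _ => ?_
  have h1 : x j ^ (r * u ^ 3) = (x j ^ α) ^ r * (x j ^ β) ^ (r * t ^ 3) := by
    conv_lhs => rw [hxyz j]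
    rw [mul_pow]
    congr 1
    · exact pow_eq_pow_of_modEq (by simpa using (hu'.pow 3).mul_left r) (hy j)
    · exact pow_eq_pow_of_modEq ((hu.pow 3).mul_left r) (hz j)
  rw [inv_pow (x j), h1, mul_inv, inv_pow (x j ^ α), inv_pow (x j ^ β)]

end GaloisSolution

/-- `sum_residue_eq_zero` for antisymmetric exponential sums. -/
theorem sum_residue_sub_eq_zero {L : Type*} [Field L] (V : ValuationSubring L) {p : ℕ}
    [Fact p.Prime] [CharP (IsLocalRing.ResidueField V) p] {ζ : V} (hζ : ζ ^ p = 1) {κ : Type*}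
    [Fintype κ] (C u u' : Fin 3 → V) (e : Fin 3 → ℕ) (a : κ → ℕ)
    (ha : Function.Injective fun l => ζ ^ a l)
    (h : ∀ l, ∑ j, C j * (u j * ζ ^ (a l * e j) - u' j * ζ ^ (a l * ((p - 1) * e j))) = 0) {r : ℕ}
    (hr : r < Fintype.card κ) :
    ∑ j, IsLocalRing.residue V (C j) *
      (IsLocalRing.residue V (u j) * (e j : IsLocalRing.ResidueField V) ^ r
        - IsLocalRing.residue V (u' j) * (-(e j : IsLocalRing.ResidueField V)) ^ r) = 0 := by
  have hp : p.Prime := Fact.out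
  have h1 := sum_residue_eq_zero V hζ (ι := Fin 3 ⊕ Fin 3)
    (Sum.elim (fun j => C j * u j) (fun j => -(C j * u' j)))
    (Sum.elim e fun j => (p - 1) * e j) a ha (fun l => by
      rw [Fintype.sum_sum_type, ← h l, ← Finset.sum_add_distrib]
      refine Finset.sum_congr rfl fun j _ => ?_
      simp only [Sum.elim_inl, Sum.elim_inr]
      ring) hr
  rw [Fintype.sum_sum_type, ← Finset.sum_add_distrib] at h1
  rw [← h1]
  refine Finset.sum_congr rfl fun j _ => ?_
  have h2 : (((p - 1) * e j : ℕ) : IsLocalRing.ResidueField V) = -(e j) := by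
    rw [Nat.cast_mul, Nat.cast_sub hp.one_le, CharP.cast_eq_zero]
    ring
  simp only [Sum.elim_inl, Sum.elim_inr, h2, map_mul, map_neg]
  ring

theorem pow_injective_of_cast_injective {M κ : Type*} [CommMonoid M] {p : ℕ} (hp : p ≠ 0) {ζ : M}
    (hζ : IsPrimitiveRoot ζ p) {a : κ → ℕ}
    (ha : Function.Injective fun l => (a l : ZMod p)) : Function.Injective fun l => ζ ^ a l := by
  intro i j hij
  apply ha
  change ζ ^ a i = ζ ^ a j at hij
  rw [(hζ.isOfFinOrder hp).pow_eq_pow_iff_modEq, ← hζ.eq_orderOf] at hij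
  exact (ZMod.natCast_eq_natCast_iff _ _ _).2 hij

/-- The cubes of `±1`, `±2` are distinct in characteristic other than `2`, `3`, `7`. -/
theorem cubes_injective {F : Type*} [Field F] (h2 : (2 : F) ≠ 0) (h3 : (3 : F) ≠ 0)
    (h7 : (7 : F) ≠ 0) : Function.Injective (![1, 8, -1, -8] : Fin 4 → F) := by
  have h9 : (9 : F) ≠ 0 := by intro h; exact mul_ne_zero h3 h3 (by linear_combination h)
  have h16 : (16 : F) ≠ 0 := by
    intro h; exact mul_ne_zero (mul_ne_zero h2 h2) (mul_ne_zero h2 h2) (by linear_combination h)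
  intro i j hij
  fin_cases i <;> fin_cases j <;> first
    | rfl
    | exfalso
      simp at hij
      first
      | exact h2 (by linear_combination hij)
      | exact h2 (by linear_combination -hij)
      | exact h7 (by linear_combination hij)
      | exact h7 (by linear_combination -hij)
      | exact h9 (by linear_combination hij)
      | exact h9 (by linear_combination -hij)
      | exact h16 (by linear_combination hij)
      | exact h16 (by linear_combination -hij)

/-- In addition to `±1`, `±8`, the powers `±2` come from the second relation. -/
theorem cubes_and_two_injective {F : Type*} [Field F] (h2 : (2 : F) ≠ 0) (h3 : (3 : F) ≠ 0)
    (h5 : (5 : F) ≠ 0) (h7 : (7 : F) ≠ 0) :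
    Function.Injective (![1, 8, -1, -8, 2, -2] : Fin 6 → F) := by
  have h9 : (9 : F) ≠ 0 := by intro h; exact mul_ne_zero h3 h3 (by linear_combination h)
  have h4 : (4 : F) ≠ 0 := by intro h; exact mul_ne_zero h2 h2 (by linear_combination h)
  have h6 : (6 : F) ≠ 0 := by intro h; exact mul_ne_zero h2 h3 (by linear_combination h)
  have h10 : (10 : F) ≠ 0 := by intro h; exact mul_ne_zero h2 h5 (by linear_combination h)
  have h16 : (16 : F) ≠ 0 := by intro h; exact mul_ne_zero h4 h4 (by linear_combination h)
  intro i j hij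
  fin_cases i <;> fin_cases j <;> first
    | rfl
    | exfalso
      simp only [Fin.zero_eta, Fin.mk_one, Fin.reduceFinMk, Matrix.cons_val, Matrix.cons_val_zero,
        Matrix.cons_val_one] at hij
      first
      | exact one_ne_zero (α := F) (by linear_combination hij)
      | exact one_ne_zero (α := F) (by linear_combination -hij)
      | exact h2 (by linear_combination hij)
      | exact h2 (by linear_combination -hij)
      | exact h3 (by linear_combination hij)
      | exact h3 (by linear_combination -hij)
      | exact h4 (by linear_combination hij)
      | exact h4 (by linear_combination -hij)
      | exact h6 (by linear_combination hij)
      | exact h6 (by linear_combination -hij)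
      | exact h7 (by linear_combination hij)
      | exact h7 (by linear_combination -hij)
      | exact h9 (by linear_combination hij)
      | exact h9 (by linear_combination -hij)
      | exact h10 (by linear_combination hij)
      | exact h10 (by linear_combination -hij)
      | exact h16 (by linear_combination hij)
      | exact h16 (by linear_combination -hij)

/-- Three distinct nodes `e j ^ 2` and the weights `e, e³, e⁵`. -/
theorem mul_eq_zero_of_vandermonde {k : Type*} [Field k] {c e : Fin 3 → k}
    (he : Function.Injective fun j => e j ^ 2) (h₁ : ∑ j, c j * e j = 0)
    (h₃ : ∑ j, c j * e j ^ 3 = 0) (h₅ : ∑ j, c j * e j ^ 5 = 0) (j : Fin 3) : c j * e j = 0 := by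
  obtain ⟨l, hl⟩ := exists_eq_mul_of_sum_eq_zero (a := fun j => c j * e j) he h₁ (by
    rw [← h₃]; exact Finset.sum_congr rfl fun j _ => by ring)
  have h : l * ((e 0 ^ 2 - e 1 ^ 2) * (e 0 ^ 2 - e 2 ^ 2) * (e 1 ^ 2 - e 2 ^ 2)) = 0 := by
    simp only [Fin.sum_univ_three] at h₅
    have l0 : c 0 * e 0 = l * (e 1 ^ 2 - e 2 ^ 2) := hl 0
    have l1 : c 1 * e 1 = l * (e 2 ^ 2 - e 0 ^ 2) := hl 1
    have l2 : c 2 * e 2 = l * (e 0 ^ 2 - e 1 ^ 2) := hl 2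
    linear_combination h₅ - e 0 ^ 4 * l0 - e 1 ^ 4 * l1 - e 2 ^ 4 * l2
  have hn : ∀ i j : Fin 3, i ≠ j → e i ^ 2 - e j ^ 2 ≠ 0 := fun i j hij =>
    sub_ne_zero.2 (he.ne hij)
  have : l = 0 := (mul_eq_zero.1 h).resolve_right (mul_ne_zero (mul_ne_zero (hn 0 1 (by decide))
    (hn 0 2 (by decide))) (hn 1 2 (by decide)))
  have := hl j
  simpa [‹l = 0›] using this

namespace GaloisSolution

variable {L : Type*} [Field L] [Algebra ℚ L] {c x : Fin 3 → L} {q : Fin 3 → ℚ}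

/-- One of the `c j` has maximal valuation. -/
theorem exists_normalization (h : GaloisSolution c x q) (V : ValuationSubring L) :
    ∃ (i : Fin 3) (C : Fin 3 → V), (∀ j, (C j : L) = c j / c i) ∧ C i = 1 := by
  obtain ⟨i, hi⟩ := Finite.exists_max fun j => V.valuation (c j)
  have hc := h.coeff_ne_zero i
  have hmem : ∀ j, c j / c i ∈ V := by
    intro j
    rw [← V.valuation_le_one_iff, map_div₀]
    exact div_le_one_of_le₀ (hi j) zero_le
  exact ⟨i, fun j => ⟨c j / c i, hmem j⟩, fun j => rfl, Subtype.ext (div_self hc)⟩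

/-- Modulo a prime above `p`, the relations for the `p`-parts raised to the powers `±1`, `±8` are the
equations of `residue_cases`. If the `p`-parts agree up to inversion, the prime-to-`p` parts lie, up
to inversion, in one coset of the cube roots of unity; otherwise the prime-to-`p` parts are all
`1` or all `-1`, with three distinct squares of exponents of the `p`-parts. This is impossible for
`p = 5`, and for `p > 7` because the powers `±1`, `±2`, `±8` give a zero of order `6`. -/
theorem not_prime_dvd {N : ℕ} [NeZero N] [IsCyclotomicExtension {N} ℚ L]
    (h : GaloisSolution c x q) {p d : ℕ} (hp : p.Prime) (h5 : 5 ≤ p) (h7 : p ≠ 7)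
    (hn : p * d ∣ N) (hpd : ¬ p ∣ d) (hx : ∀ j, x j ^ (p * d) = 1) (j₁ : Fin 3) :
    x j₁ ^ d = 1 := by
  by_contra hj₁
  have := algebraRat.charZero L
  have : Fact p.Prime := ⟨hp⟩
  have hN : N ≠ 0 := NeZero.ne N
  have hd0 : d ≠ 0 := by rintro rfl; simp at hpd
  obtain ⟨y, z, hxyz, hy, hz, hrel⟩ := h.exists_prime_part hp hn hpd hx
  obtain ⟨V, hV⟩ := exists_valuationSubring_mem_nonunits L hp
  have := V.charP_residueField hp hV
  set k := IsLocalRing.ResidueField V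
  let ρ : V →+* k := IsLocalRing.residue V
  -- A primitive `p`-th root of unity, and the exponents of the `z j`.
  obtain ⟨ζ', hζ'⟩ : ∃ ζ' : L, IsPrimitiveRoot ζ' p := by
    obtain ⟨b, hb⟩ := (dvd_mul_right p d).trans hn
    exact ⟨_, (IsCyclotomicExtension.zeta_spec N ℚ L).pow (Nat.pos_of_ne_zero hN)
      (hb.trans (mul_comm _ _))⟩
  set ζ : V := ⟨ζ', V.mem_of_pow_eq_one hp.ne_zero hζ'.pow_eq_one⟩ with hζdef
  have hζ : IsPrimitiveRoot ζ p := by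
    apply IsPrimitiveRoot.of_map_of_injective (f := V.subtype) (by exact hζ')
    exact Subtype.val_injective
  have hze : ∀ j, ∃ e : ℕ, z j = ζ' ^ e := fun j => by
    obtain ⟨e, -, he⟩ := hζ'.eq_pow_of_pow_eq_one (hz j)
    exact ⟨e, he.symm⟩
  choose e he using hze
  have hyi : ∀ j, ((y j)⁻¹) ^ d = 1 := fun j => by rw [inv_pow, hy, inv_one]
  set Y : Fin 3 → V := fun j => ⟨y j, V.mem_of_pow_eq_one hd0 (hy j)⟩ with hY
  set Y' : Fin 3 → V := fun j => ⟨(y j)⁻¹, V.mem_of_pow_eq_one hd0 (hyi j)⟩ with hY'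
  have hy0 : ∀ j, y j ≠ 0 := fun j => by
    have := hy j
    rintro h0
    simp [h0, hd0] at this
  have hYY' : ∀ j, Y j * Y' j = 1 := fun j => Subtype.ext (mul_inv_cancel₀ (hy0 j))
  obtain ⟨i₀, C, hC, hC1⟩ := h.exists_normalization V
  have hζinv : ζ'⁻¹ = ζ' ^ (p - 1) := by
    have h1 : ζ' * ζ' ^ (p - 1) = 1 := by
      rw [← pow_succ', Nat.sub_add_cancel hp.one_le, hζ'.pow_eq_one]
    exact inv_eq_of_mul_eq_one_right h1
  have hrelV : ∀ t r : ℕ, t.Coprime p → (r = 1 ∨ r = 2) →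
      ∑ j, C j * (Y j ^ r * ζ ^ (r * t ^ 3 * e j)
        - Y' j ^ r * ζ ^ (r * t ^ 3 * ((p - 1) * e j))) = 0 := by
    intro t r ht hr
    apply Subtype.ext
    have h1 := hrel t r ht hr
    have h2 := congrArg (fun b => b / c i₀) h1
    simp only [zero_div, Finset.sum_div] at h2
    push_cast
    rw [← h2]
    refine Finset.sum_congr rfl fun j _ => ?_
    simp only [hC, hY, hY', hζdef, he, ← inv_pow ζ', hζinv]
    simp only [← pow_mul]
    ring_nf
  -- The powers `±1`, `±8` give zeros of order `4` at `1`, whence moments of order `0` to `3`.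
  have hp2 : (2 : ZMod p) ≠ 0 := by
    intro h0
    have := (ZMod.natCast_eq_zero_iff 2 p).1 (by exact_mod_cast h0)
    have := Nat.le_of_dvd (by norm_num) this
    omega
  have hp3 : (3 : ZMod p) ≠ 0 := by
    intro h0
    have := (ZMod.natCast_eq_zero_iff 3 p).1 (by exact_mod_cast h0)
    have := Nat.le_of_dvd (by norm_num) this
    omega
  have hp7 : (7 : ZMod p) ≠ 0 := by
    intro h0
    have := (ZMod.natCast_eq_zero_iff 7 p).1 (by exact_mod_cast h0)
    exact h7 ((Nat.prime_dvd_prime_iff_eq hp (by norm_num)).1 this)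
  have h2k : (2 : k) ≠ 0 := by
    intro h0
    have := (CharP.cast_eq_zero_iff k p 2).1 (by exact_mod_cast h0)
    have := Nat.le_of_dvd (by norm_num) this
    omega
  have hsub : ∀ m, m ≤ p → ((p - m : ℕ) : ZMod p) = -m := fun m hm => by
    rw [Nat.cast_sub hm]; simp
  have hcop1 : (p - 1).Coprime p := (Nat.coprime_self_sub_left hp.one_le).2 (Nat.coprime_one_left p)
  have hcop2' : Nat.Coprime 2 p := (Nat.coprime_primes Nat.prime_two hp).2 (by omega)
  have hcop2 : (p - 2).Coprime p := (Nat.coprime_self_sub_left (by omega)).2 hcop2'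
  have hres : ∀ r m : ℕ, (r = 1 ∨ r = 2) → m < 4 →
      ∑ j, ρ (C j) * (ρ (Y j) ^ r * (e j : k) ^ m - ρ (Y' j) ^ r * (-(e j : k)) ^ m) = 0 := by
    intro r m hr hm
    have hr0 : (r : ZMod p) ≠ 0 := by
      rcases hr with rfl | rfl
      · simp
      · exact_mod_cast hp2
    have := sum_residue_sub_eq_zero V hζ.pow_eq_one C (fun j => Y j ^ r) (fun j => Y' j ^ r) e
      (κ := Fin 4) (fun l => r * (![1, 2, p - 1, p - 2] l) ^ 3)
      (pow_injective_of_cast_injective hp.ne_zero hζ (by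
        have h1 : ∀ l : Fin 4, ((r * (![1, 2, p - 1, p - 2] l) ^ 3 : ℕ) : ZMod p) =
            r * (![1, 8, -1, -8] : Fin 4 → ZMod p) l := by
          intro l
          fin_cases l <;> simp [hsub 1 hp.one_le, hsub 2 (by omega)] <;> norm_num
        intro i j hij
        simp only [h1] at hij
        exact cubes_injective hp2 hp3 hp7 (mul_left_cancel₀ hr0 hij)))
      (fun l => hrelV _ r (by
        fin_cases l
        · exact Nat.coprime_one_left p
        · exact hcop2'
        · exact hcop1
        · exact hcop2) hr) (r := m) (by simpa using hm)
    simpa only [map_pow] using this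
  set s : Fin 3 → k := fun j => ρ (Y j) - ρ (Y' j) with hs
  set w : Fin 3 → k := fun j => ρ (Y j) + ρ (Y' j) with hw
  have hYk : ∀ j, ρ (Y j) * ρ (Y' j) = 1 := fun j => by rw [← map_mul, hYY', map_one]
  have hsw : ∀ j, w j ^ 2 - s j ^ 2 = 4 := fun j => by
    simp only [hs, hw]; linear_combination 4 * hYk j
  have hYinj : ∀ (u : V), u ^ d = 1 → ρ u = 1 → u = 1 := fun u hu h1 =>
    eq_one_of_residue_eq_one hu hpd h1
  have hYd : ∀ j, Y j ^ d = 1 := fun j => Subtype.ext (hy j)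
  have hYd' : ∀ j, Y' j ^ d = 1 := fun j => Subtype.ext (hyi j)
  have hyeq : ∀ i j, ρ (Y i) = ρ (Y j) → y i = y j := by
    intro i j hij
    have h1 := hYinj (Y i * Y' j) (by rw [mul_pow, hYd, hYd', one_mul]) (by
      rw [map_mul, hij, hYk])
    have h2 : y i * (y j)⁻¹ = 1 := congrArg Subtype.val h1
    have := hy0 j
    field_simp at h2
    exact h2
  have hymul : ∀ i j, ρ (Y i) * ρ (Y j) = 1 → y i * y j = 1 := by
    intro i j hij
    have h1 := hYinj (Y i * Y j) (by rw [mul_pow, hYd, hYd, one_mul]) (by rw [map_mul, hij])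
    exact congrArg Subtype.val h1
  have hzeq : ∀ i j, (e i : k) = e j → z i = z j := by
    intro i j hij
    rw [CharP.natCast_eq_natCast k p] at hij
    rw [he, he]
    exact pow_eq_pow_of_modEq hij hζ'.pow_eq_one
  have hzmul : ∀ i j, (e i : k) = -(e j) → z i * z j = 1 := by
    intro i j hij
    have : ((e i + e j : ℕ) : k) = ((0 : ℕ) : k) := by push_cast; rw [hij]; ring
    rw [CharP.natCast_eq_natCast k p] at this
    rw [he, he, ← pow_add, pow_eq_pow_of_modEq this hζ'.pow_eq_one, pow_zero]
  have hz1 : ∀ i, (e i : k) = 0 → z i = 1 := by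
    intro i hij
    rw [CharP.cast_eq_zero_iff k p] at hij
    rw [he, ← hζ'.pow_eq_one]
    obtain ⟨b, hb⟩ := hij
    rw [hb, pow_mul, hζ'.pow_eq_one, one_pow]
  have n : ∀ j, ¬ (s j = 0 ∧ (e j : k) = 0) := by
    rintro j ⟨h1, h2⟩
    apply h.sq_ne_one j
    have h3 : ρ (Y j) * ρ (Y j) = 1 := by
      have := hYk j
      rwa [← sub_eq_zero.1 h1] at this
    rw [hxyz, hz1 j h2, mul_one, pow_two, hymul j j h3]
  have hne₁ : ∀ i j, i ≠ j → ¬ (ρ (Y i) = ρ (Y j) ∧ (e i : k) = e j) := by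
    rintro i j hij ⟨h1, h2⟩
    exact h.injective.ne hij (by rw [hxyz, hxyz, hyeq i j h1, hzeq i j h2])
  have hne₂ : ∀ i j, i ≠ j → ¬ (ρ (Y i) * ρ (Y j) = 1 ∧ (e i : k) = -e j) := by
    rintro i j hij ⟨h1, h2⟩
    apply h.mul_ne_one i j hij
    rw [hxyz i, hxyz j]
    linear_combination z i * z j * hymul i j h1 + hzmul i j h2
  have hcne : ∃ j, ρ (C j) ≠ 0 := ⟨i₀, by rw [hC1, map_one]; exact one_ne_zero⟩
  have hS₁ : ∀ m, m < 4 → ∑ j, ρ (C j) * (ρ (Y j) - (-1) ^ m * ρ (Y' j)) * (e j : k) ^ m = 0 := by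
    intro m hm
    rw [← hres 1 m (Or.inl rfl) hm]
    exact Finset.sum_congr rfl fun j _ => by rw [neg_pow]; ring
  have hS₂ : ∀ m, m < 4 →
      ∑ j, ρ (C j) * (ρ (Y j) ^ 2 - (-1) ^ m * ρ (Y' j) ^ 2) * (e j : k) ^ m = 0 := by
    intro m hm
    rw [← hres 2 m (Or.inr rfl) hm]
    exact Finset.sum_congr rfl fun j _ => by rw [neg_pow]; ring
  have hsw' : ∀ j, s j * w j = ρ (Y j) ^ 2 - ρ (Y' j) ^ 2 := fun j => by simp only [hs, hw]; ring
  have hww' : ∀ j, w j ^ 2 - 2 = ρ (Y j) ^ 2 + ρ (Y' j) ^ 2 := fun j => by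
    simp only [hw]; linear_combination 2 * hYk j
  have a₀ : ∑ j, ρ (C j) * s j = 0 := by
    rw [← hS₁ 0 (by norm_num)]
    exact Finset.sum_congr rfl fun j _ => by simp only [hs]; ring
  have a₁ : ∑ j, ρ (C j) * w j * (e j : k) = 0 := by
    rw [← hS₁ 1 (by norm_num)]
    exact Finset.sum_congr rfl fun j _ => by simp only [hw]; ring
  have a₂ : ∑ j, ρ (C j) * s j * (e j : k) ^ 2 = 0 := by
    rw [← hS₁ 2 (by norm_num)]
    exact Finset.sum_congr rfl fun j _ => by simp only [hs]; ring
  have a₃ : ∑ j, ρ (C j) * w j * (e j : k) ^ 3 = 0 := by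
    rw [← hS₁ 3 (by norm_num)]
    exact Finset.sum_congr rfl fun j _ => by simp only [hw]; ring
  have b₀ : ∑ j, ρ (C j) * (s j * w j) = 0 := by
    rw [← hS₂ 0 (by norm_num)]
    exact Finset.sum_congr rfl fun j _ => by rw [hsw' j]; ring
  have b₁ : ∑ j, ρ (C j) * (w j ^ 2 - 2) * (e j : k) = 0 := by
    rw [← hS₂ 1 (by norm_num)]
    exact Finset.sum_congr rfl fun j _ => by rw [hww' j]; ring
  have b₂ : ∑ j, ρ (C j) * (s j * w j) * (e j : k) ^ 2 = 0 := by
    rw [← hS₂ 2 (by norm_num)]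
    exact Finset.sum_congr rfl fun j _ => by rw [hsw' j]; ring
  have b₃ : ∑ j, ρ (C j) * (w j ^ 2 - 2) * (e j : k) ^ 3 = 0 := by
    rw [← hS₂ 3 (by norm_num)]
    exact Finset.sum_congr rfl fun j _ => by rw [hww' j]; ring
  rcases residue_cases h2k hcne hsw a₀ a₂ a₁ a₃ b₀ b₂ b₁ b₃ n
    (by
      rintro i j hij ⟨h1, h2, h3⟩
      refine hne₁ i j hij ⟨mul_left_cancel₀ h2k ?_, h3⟩
      simp only [hs, hw] at h1 h2
      linear_combination h1 + h2)
    (by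
      rintro i j hij ⟨h1, h2, h3⟩
      refine hne₂ i j hij ⟨?_, h3⟩
      have : ρ (Y i) = ρ (Y' j) := mul_left_cancel₀ h2k (by
        simp only [hs, hw] at h1 h2
        linear_combination h1 + h2)
      rw [this, mul_comm, hYk]) with ⟨⟨hs0, hwc⟩, hinj⟩ | hsq
  · -- All `y j` are equal to one and the same sign.
    have hYY : ∀ j, ρ (Y j) = ρ (Y' j) := fun j => sub_eq_zero.1 (hs0 j)
    have hYc : ∀ j, Y j = Y 0 := fun j => Subtype.ext (hyeq j 0 (mul_left_cancel₀ h2k (by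
      have := hwc j 0
      simp only [hw, ← hYY] at this
      linear_combination this)))
    have hY0 : Y 0 * Y 0 = 1 := Subtype.ext (hymul 0 0 (by
      have := hYk 0
      rwa [← hYY] at this))
    have hYc' : ∀ j, Y' j = Y 0 := fun j => by
      have h1 := hYY' j
      rw [hYc] at h1
      linear_combination Y 0 * h1 - Y' j * hY0
    have he0 : ∀ j, (e j : k) ≠ 0 := fun j h1 => n j ⟨hs0 j, h1⟩
    by_cases hp5 : p = 5
    · -- There are only two nonzero squares modulo `5`.
      have hv : ∀ j, (e j : k) ^ 2 = 1 ∨ (e j : k) ^ 2 = -1 := by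
        intro j
        have h1 : (e j : k) ^ p = e j := by
          have := map_natCast (frobenius k p) (e j)
          rwa [frobenius_def] at this
        rw [hp5] at h1
        have h2 : ((e j : k) ^ 2 - 1) * ((e j : k) ^ 2 + 1) = 0 := by
          apply mul_left_cancel₀ (he0 j)
          linear_combination h1
        rcases mul_eq_zero.1 h2 with h3 | h3
        · exact Or.inl (sub_eq_zero.1 h3)
        · exact Or.inr (eq_neg_of_add_eq_zero_left h3)
      have hinj' : ∀ i j : Fin 3, i ≠ j → (e i : k) ^ 2 ≠ (e j : k) ^ 2 := fun i j hij =>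
        hinj.ne hij
      have h01 := hinj' 0 1 (by decide)
      have h02 := hinj' 0 2 (by decide)
      have h12 := hinj' 1 2 (by decide)
      rcases hv 0 with h1 | h1 <;> rcases hv 1 with h2 | h2 <;> rcases hv 2 with h3 | h3 <;>
        simp [h1, h2, h3] at h01 h02 h12
    · have hp5' : (5 : ZMod p) ≠ 0 := by
        intro h0
        have := (ZMod.natCast_eq_zero_iff 5 p).1 (by exact_mod_cast h0)
        exact hp5 ((Nat.prime_dvd_prime_iff_eq hp (by norm_num)).1 this)
      have hrel1 : ∀ t r : ℕ, t.Coprime p → (r = 1 ∨ r = 2) →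
          ∑ j, C j * (1 * ζ ^ (r * t ^ 3 * e j) - 1 * ζ ^ (r * t ^ 3 * ((p - 1) * e j))) = 0 := by
        intro t r ht hr
        have h1 := hrelV t r ht hr
        simp only [hYc, hYc'] at h1
        have h2 : Y 0 ^ r * Y 0 ^ r = 1 := by rw [← mul_pow, hY0, one_pow]
        have h3 := congrArg (fun b => Y 0 ^ r * b) h1
        simp only [mul_zero, Finset.mul_sum] at h3
        rw [← h3]
        refine Finset.sum_congr rfl fun j _ => ?_
        linear_combination -(C j * (ζ ^ (r * t ^ 3 * e j)
          - ζ ^ (r * t ^ 3 * ((p - 1) * e j)))) * h2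
      have hres1 : ∀ m, m < 6 →
          ∑ j, ρ (C j) * (1 * (e j : k) ^ m - 1 * (-(e j : k)) ^ m) = 0 := by
        intro m hm
        have := sum_residue_sub_eq_zero V hζ.pow_eq_one C (fun _ => 1) (fun _ => 1) e
          (κ := Fin 6) (fun l => ![1, 1, 1, 1, 2, 2] l * (![1, 2, p - 1, p - 2, 1, p - 1] l) ^ 3)
          (pow_injective_of_cast_injective hp.ne_zero hζ (by
            have h1 : ∀ l : Fin 6, ((![1, 1, 1, 1, 2, 2] l *
                (![1, 2, p - 1, p - 2, 1, p - 1] l) ^ 3 : ℕ) : ZMod p) =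
                (![1, 8, -1, -8, 2, -2] : Fin 6 → ZMod p) l := by
              intro l
              fin_cases l <;> simp [hsub 1 hp.one_le, hsub 2 (by omega)] <;> norm_num
            intro i j hij
            simp only [h1] at hij
            exact cubes_and_two_injective hp2 hp3 hp5' hp7 hij))
          (fun l => hrel1 _ _ (by
            fin_cases l
            · exact Nat.coprime_one_left p
            · exact hcop2'
            · exact hcop1
            · exact hcop2
            · exact Nat.coprime_one_left p
            · exact hcop1) (by fin_cases l <;> simp)) (r := m) (by simpa using hm)
        simpa only [map_one] using this
      have hodd : ∀ m, m < 6 → Odd m → ∑ j, ρ (C j) * (e j : k) ^ m = 0 := by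
        intro m hm hmo
        have h1 := hres1 m hm
        simp only [hmo.neg_pow] at h1
        apply mul_left_cancel₀ h2k
        rw [mul_zero, ← h1, Finset.mul_sum]
        exact Finset.sum_congr rfl fun j _ => by ring
      obtain ⟨i, hi⟩ := hcne
      have h1 := mul_eq_zero_of_vandermonde (c := fun j => ρ (C j)) hinj
        (by simpa using hodd 1 (by norm_num) (by decide)) (hodd 3 (by norm_num) (by decide))
        (hodd 5 (by norm_num) (by decide)) i
      exact mul_ne_zero hi (he0 i) h1
  · -- The `p`-parts agree up to inversion, and the equations become those of a Vandermonde system.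
    have he0 : ∀ j, (e j : k) ≠ 0 := by
      intro j h0
      apply hj₁
      have : (e j₁ : k) = 0 := by
        have h1 := hsq j₁ j
        rw [h0, zero_pow two_ne_zero] at h1
        exact pow_eq_zero_iff two_ne_zero |>.1 h1
      rw [hxyz, hz1 _ this, mul_one, hy]
    classical
    set b : Fin 3 → Bool := fun j => decide ((e j : k) = e 0) with hb
    have hcase : ∀ j, (b j = true ∧ (e j : k) = e 0) ∨ (b j = false ∧ (e j : k) = -e 0) := by
      intro j
      by_cases h1 : (e j : k) = e 0
      · exact Or.inl ⟨by simp [hb, h1], h1⟩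
      · refine Or.inr ⟨by simp [hb, h1], ?_⟩
        have h2 : ((e j : k) - e 0) * (e j + e 0) = 0 := by linear_combination hsq j 0
        exact eq_neg_of_add_eq_zero_left ((mul_eq_zero.1 h2).resolve_left (sub_ne_zero.2 h1))
    have hρinv : ∀ j, (ρ (Y j))⁻¹ = ρ (Y' j) := fun j => inv_eq_of_mul_eq_one_right (hYk j)
    have hρinv' : ∀ j, (ρ (Y' j))⁻¹ = ρ (Y j) := fun j => by rw [← hρinv, inv_inv]
    have hρ0 : ∀ j, ρ (Y j) ≠ 0 := fun j => left_ne_zero_of_mul_eq_one (hYk j)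
    set W : Fin 3 → k := fun j => orient (b j) (ρ (Y j)) with hW
    set D : Fin 3 → k := fun j => orientSign (b j) (ρ (C j)) with hD
    have hW0 : ∀ j, W j ≠ 0 := fun j => by
      simp only [hW, orient]
      split_ifs
      · exact hρ0 j
      · exact inv_ne_zero (hρ0 j)
    have hWinj : Function.Injective W := by
      intro i j hij
      by_contra hne
      simp only [hW, orient] at hij
      rcases hcase i with ⟨h1, h2⟩ | ⟨h1, h2⟩ <;> rcases hcase j with ⟨h3, h4⟩ | ⟨h3, h4⟩ <;>
        simp only [h1, h3, if_true, Bool.false_eq_true, if_false] at hij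
      · exact hne₁ i j hne ⟨hij, h2.trans h4.symm⟩
      · exact hne₂ i j hne ⟨by rw [hij, inv_mul_cancel₀ (hρ0 j)], by rw [h2, h4, neg_neg]⟩
      · exact hne₂ i j hne ⟨by rw [← hij, mul_inv_cancel₀ (hρ0 i)], by rw [h2, h4]⟩
      · exact hne₁ i j hne ⟨inv_injective hij, h2.trans h4.symm⟩
    have hDW : ∀ j, (W j - (W j)⁻¹) * D j = ρ (C j) * s j ∧
        (W j + (W j)⁻¹) * D j * e 0 = ρ (C j) * w j * e j ∧
        (W j ^ 2 - (W j)⁻¹ ^ 2) * D j = ρ (C j) * (s j * w j) ∧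
        (W j ^ 2 + (W j)⁻¹ ^ 2) * D j * e 0 = ρ (C j) * (w j ^ 2 - 2) * e j := by
      intro j
      rw [hsw', hww']
      rcases hcase j with ⟨h1, h2⟩ | ⟨h1, h2⟩ <;>
        simp only [hW, hD, orient, orientSign, h1, h2, if_true, Bool.false_eq_true, if_false,
          hs, hw, hρinv, hρinv'] <;> refine ⟨?_, ?_, ?_, ?_⟩ <;> ring
    have g₁ : ∑ j, (W j - (W j)⁻¹) * D j = 0 := by simpa only [(hDW _).1] using a₀
    have g₂ : (∑ j, (W j + (W j)⁻¹) * D j) * e 0 = 0 := by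
      rw [Finset.sum_mul]; simpa only [(hDW _).2.1] using a₁
    have g₃ : ∑ j, (W j ^ 2 - (W j)⁻¹ ^ 2) * D j = 0 := by simpa only [(hDW _).2.2.1] using b₀
    have g₄ : (∑ j, (W j ^ 2 + (W j)⁻¹ ^ 2) * D j) * e 0 = 0 := by
      rw [Finset.sum_mul]; simpa only [(hDW _).2.2.2] using b₁
    replace g₂ := (mul_eq_zero.1 g₂).resolve_right (he0 0)
    replace g₄ := (mul_eq_zero.1 g₄).resolve_right (he0 0)
    simp only [Fin.sum_univ_three] at g₁ g₂ g₃ g₄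
    have hcube := cube_eq_of_vandermonde (d := D) (y := W) (by
        obtain ⟨i, hi⟩ := hcne
        refine ⟨i, ?_⟩
        simp only [hD, orientSign]
        split_ifs <;> simpa) hWinj hW0
      (by
        apply mul_left_cancel₀ h2k
        simp only [Fin.sum_univ_three]
        linear_combination g₁ + g₂)
      (by
        apply mul_left_cancel₀ h2k
        simp only [Fin.sum_univ_three]
        linear_combination g₃ + g₄)
      (by
        apply mul_left_cancel₀ h2k
        simp only [Fin.sum_univ_three]
        linear_combination g₂ - g₁)
      (by
        apply mul_left_cancel₀ h2k
        simp only [Fin.sum_univ_three]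
        linear_combination g₄ - g₃)
    refine h.false_of_orient_cube_eq b fun i j => ?_
    have hy3 : ∀ i j, orient (b i) (y i) ^ 3 = orient (b j) (y j) ^ 3 := by
      intro i j
      set u : Fin 3 → V := fun j => if b j then Y j else Y' j with hu
      set u' : Fin 3 → V := fun j => if b j then Y' j else Y j with hu'
      have huu : ∀ j, u j * u' j = 1 := fun j => by
        simp only [hu, hu']
        split_ifs
        · exact hYY' j
        · rw [mul_comm]; exact hYY' j
      have hud : ∀ j, u j ^ d = 1 := fun j => by simp only [hu]; split_ifs <;> simp [hYd, hYd']
      have hud' : ∀ j, u' j ^ d = 1 := fun j => by simp only [hu']; split_ifs <;> simp [hYd, hYd']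
      have huW : ∀ j, ρ (u j) = W j := fun j => by
        simp only [hu, hW, orient]; split_ifs <;> simp [hρinv]
      have huy : ∀ j, ((u j : V) : L) = orient (b j) (y j) := fun j => by
        simp only [hu, orient]; split_ifs <;> rfl
      have h1 := hYinj ((u i * u' j) ^ 3)
        (by rw [← pow_mul, mul_comm 3, pow_mul, mul_pow, hud, hud', one_mul, one_pow])
        (by
          have h2 : W j * ρ (u' j) = 1 := by rw [← huW, ← map_mul, huu, map_one]
          rw [map_pow, map_mul, huW, mul_pow, hcube i j, ← mul_pow, h2, one_pow])
      have h2 : u i ^ 3 = u j ^ 3 := by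
        have h3 := huu j
        have : u i ^ 3 * (u j * u' j) ^ 3 = u j ^ 3 * (u i * u' j) ^ 3 := by ring
        rwa [h3, h1, one_pow, mul_one, mul_one] at this
      rw [← huy, ← huy]
      exact_mod_cast congrArg Subtype.val h2
    have hzz : ∀ i, orient (b i) (z i) = z 0 := by
      intro i
      rcases hcase i with ⟨h1, h2⟩ | ⟨h1, h2⟩ <;>
        simp only [orient, h1, if_true, Bool.false_eq_true, if_false]
      · exact hzeq i 0 h2
      · exact inv_eq_of_mul_eq_one_right (hzmul i 0 h2)
    have hmul : ∀ i, orient (b i) (x i) = orient (b i) (y i) * z 0 := by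
      intro i
      rw [← hzz i, hxyz i]
      simp only [orient]
      split_ifs
      · rfl
      · rw [mul_inv]
    rw [hmul, hmul, mul_pow, mul_pow, hy3 i j]

end GaloisSolution


/-! ### The order divides `504` -/

theorem Nat.coprime_one_add_mul (t e : ℕ) : (1 + t * e).Coprime e := by
  simp [Nat.Coprime]

theorem Nat.Coprime.of_dvd_pow {u n e k : ℕ} (h : u.Coprime e) (hn : n ∣ e ^ k) : u.Coprime n :=
  (h.pow_right k).of_dvd_right hn

theorem Nat.one_add_mul_pow_modEq {n d t : ℕ} (h : n ∣ d ^ 2) (a : ℕ) :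
    (1 + t * d) ^ a ≡ 1 + a * t * d [MOD n] := by
  induction a with
  | zero => simp; rfl
  | succ a ih =>
    rw [pow_succ]
    refine (ih.mul_right _).trans ?_
    obtain ⟨b, hb⟩ := h
    have : (1 + a * t * d) * (1 + t * d) = 1 + (a + 1) * t * d + n * (b * (a * t ^ 2)) := by
      linear_combination a * t ^ 2 * hb
    rw [this]
    simp [Nat.ModEq]

theorem Nat.sq_modEq_one {e a : ℕ} (he : Even e) (h : a ≡ 1 [MOD e]) :
    a ^ 2 ≡ 1 [MOD 2 * e] := by
  obtain ⟨f, rfl⟩ := he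
  have h' := (Nat.modEq_iff_dvd.1 h.symm)
  apply Nat.ModEq.symm
  rw [Nat.modEq_iff_dvd]
  obtain ⟨b, hb⟩ := h'
  refine ⟨b + f * b ^ 2, ?_⟩
  push_cast at hb ⊢
  linear_combination ((a : ℤ) + 1) * hb + (f + f) * b * hb

namespace GaloisSolution

variable {L : Type*} [Field L] [Algebra ℚ L] {c x : Fin 3 → L} {q : Fin 3 → ℚ}

/-- The residues congruent to `1` modulo `n / p` are cubes modulo `n` if `p ^ 2 ∣ n`, `p ≥ 5`; so are
those congruent to `1` modulo `n / 8` if `16 ∣ n`, and those congruent to `1` modulo `n / 3` if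
`27 ∣ n`. -/
theorem dvd_504 {N : ℕ} [NeZero N] [IsCyclotomicExtension {N} ℚ L]
    (h : GaloisSolution c x q) {n : ℕ} (hn : n ∣ N)
    (hx : ∀ k, (∀ j, x j ^ k = 1) ↔ n ∣ k) : n ∣ 504 := by
  have hn0 : n ≠ 0 := ne_zero_of_dvd_ne_zero (NeZero.ne N) hn
  rw [Nat.dvd_iff_prime_pow_dvd_dvd]
  intro p k hp hk
  -- Below each excluded power of `p`, smaller powers divide `504`.
  have key : ∀ m, ¬ p ^ (m + 1) ∣ n → p ^ m ∣ 504 → p ^ k ∣ 504 := fun m h1 h2 => by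
    refine (pow_dvd_pow p ?_).trans h2
    by_contra! h3
    exact h1 ((pow_dvd_pow p h3).trans hk)
  have hsq : 5 ≤ p → ¬ p ^ 2 ∣ n := by
    rintro h5 ⟨b, hb⟩
    have hd : n = p * (p * b) := by rw [hb]; ring
    have hnd : n ∣ (p * b) ^ 2 := ⟨b, by rw [hb]; ring⟩
    have h4 := h.not_sq_dvd hn hn0 hx hd (fun t => by
      have h3p : Nat.Coprime 3 p := (Nat.coprime_primes Nat.prime_three hp).2 (by omega)
      obtain ⟨s, -, hs⟩ := Nat.exists_mul_mod_eq_one_of_coprime h3p hp.one_lt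
      refine ⟨(1 + t * (p * b)) ^ s,
        ((Nat.coprime_one_add_mul _ _).of_dvd_pow hnd).pow_left s, ?_⟩
      rw [← pow_mul]
      refine (Nat.one_add_mul_pow_modEq hnd _).trans ?_
      have h1 : s * 3 = 1 + p * (s * 3 / p) := by
        rw [mul_comm s, ← hs]
        exact (Nat.mod_add_div _ _).symm
      rw [h1, show 1 + (1 + p * (s * 3 / p)) * t * (p * b) =
        1 + t * (p * b) + n * (s * 3 / p * t) by rw [hd]; ring]
      simp [Nat.ModEq])
    have := Nat.le_of_dvd (by norm_num) h4
    omega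
  by_cases h2 : p = 2
  · subst h2
    refine key 3 ?_ (by norm_num)
    rintro ⟨b, hb⟩
    have hd : n = 8 * (2 * b) := by rw [hb]; ring
    have h4 := h.not_sq_dvd hn hn0 hx hd (fun t => by
      refine ⟨(1 + t * (2 * b)) ^ 3, ((Nat.coprime_one_add_mul _ _).of_dvd_pow (k := 4)
        ⟨b ^ 3, by rw [hb]; ring⟩).pow_left 3, ?_⟩
      have e1 : Even (2 * b) := even_two_mul b
      have h1 : 1 + t * (2 * b) ≡ 1 [MOD 2 * b] := by simp [Nat.ModEq]
      have h3 := Nat.sq_modEq_one (even_two_mul _)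
        (Nat.sq_modEq_one (even_two_mul _) (Nat.sq_modEq_one e1 h1))
      rw [show 2 * (2 * (2 * (2 * b))) = n by rw [hd]; ring] at h3
      have h4 := h3.mul_left (1 + t * (2 * b))
      rw [mul_one] at h4
      rw [← pow_mul]
      refine Eq.trans ?_ h4
      ring_nf)
    omega
  by_cases h3 : p = 3
  · subst h3
    refine key 2 ?_ (by norm_num)
    rintro ⟨b, hb⟩
    have hd : n = 3 * (9 * b) := by rw [hb]; ring
    have h4 := h.not_sq_dvd hn hn0 hx hd (fun t => by
      refine ⟨1 + t * (3 * b), (Nat.coprime_one_add_mul _ _).of_dvd_pow (k := 3)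
        ⟨b ^ 2, by rw [hb]; ring⟩, ?_⟩
      rw [show (1 + t * (3 * b)) ^ 3 = 1 + t * (9 * b) + n * (t ^ 2 * b + t ^ 3 * b ^ 2) by
        rw [hb]; ring]
      simp [Nat.ModEq])
    omega
  have h5 : 5 ≤ p := by
    have := hp.two_le
    have : p ≠ 4 := by rintro rfl; norm_num at hp
    omega
  by_cases h7 : p = 7
  · exact key 1 (hsq h5) (by rw [h7]; norm_num)
  refine key 0 (fun h1 => ?_) (by simp)
  rw [zero_add, pow_one] at h1
  obtain ⟨d, rfl⟩ := h1
  have hpd : ¬ p ∣ d := fun h1 => hsq h5 (by rw [pow_two]; exact mul_dvd_mul_left p h1)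
  have h8 := (hx d).1 fun j => h.not_prime_dvd hp h5 h7 hn hpd ((hx _).2 dvd_rfl) j
  have hd0 : 0 < d := Nat.pos_of_ne_zero (by rintro rfl; simp at hn0)
  have := Nat.le_of_dvd hd0 h8
  nlinarith

end GaloisSolution


/-! ### Obstructions modulo `1009` and by signs -/

open Polynomial in
/-- Polynomial identities between `n`-th roots of unity in characteristic zero hold for every
primitive `n`-th root of unity in every domain. -/
theorem IsPrimitiveRoot.aeval_eq_zero_of_aeval_eq_zero {F R : Type*} [Field F] [CharZero F]
    [CommRing R] [IsDomain R] {n : ℕ} (hn : 0 < n) {ζ : F} (hζ : IsPrimitiveRoot ζ n) {g : R}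
    (hg : IsPrimitiveRoot g n) {P : ℤ[X]} (hP : aeval ζ P = 0) : aeval g P = 0 := by
  have h1 := minpoly.isIntegrallyClosed_dvd (hζ.isIntegral hn) hP
  rw [← cyclotomic_eq_minpoly hζ hn] at h1
  obtain ⟨Q, rfl⟩ := h1
  have h2 : aeval g (cyclotomic n ℤ) = 0 := by
    rw [aeval_def, eval₂_eq_eval_map, map_cyclotomic]
    exact hg.isRoot_cyclotomic hn
  rw [map_mul, h2, zero_mul]

/-- The difference `z ^ m - z ^ (-m)` for a `504`-th root of unity `z`; a multiple of a sine. -/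
def sinDiff {R : Type*} [CommRing R] (z : R) (m : ℕ) : R := z ^ m - z ^ (503 * m)

/-- One coordinate of the cross product of the vectors of differences `sinDiff z (a * k)` and
`sinDiff z (2 * a * k)`. -/
def crossDiff {R : Type*} [CommRing R] (z : R) (a k l : ℕ) : R :=
  sinDiff z (a * k) * sinDiff z (2 * a * l) - sinDiff z (a * l) * sinDiff z (2 * a * k)

/-- A slope: eliminates the first coefficient between the relations number `1` and `b`. -/
def slopeDiff {R : Type*} [CommRing R] (z : R) (k₁ b k : ℕ) : R :=
  sinDiff z (b * k) * sinDiff z k₁ - sinDiff z (b * k₁) * sinDiff z k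

/-- The determinant of the relations number `1`, `2` and `b`. -/
def detDiff {R : Type*} [CommRing R] (z : R) (b k₁ k₂ k₃ : ℕ) : R :=
  crossDiff z 1 k₂ k₃ * sinDiff z (b * k₁) + crossDiff z 1 k₃ k₁ * sinDiff z (b * k₂) +
    crossDiff z 1 k₁ k₂ * sinDiff z (b * k₃)

/-- The product of one coordinate of the cross product and of its conjugate. -/
def crossMul {R : Type*} [CommRing R] (z : R) (u a k l : ℕ) : R :=
  crossDiff z a k l * crossDiff z (a * u) k l

/-- The determinant of the orthogonality relations for three conjugate pairs. -/
def orthDet {R : Type*} [CommRing R] (z : R) (u k₁ k₂ k₃ : ℕ) : R :=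
  crossMul z u 1 k₂ k₃ * (crossMul z u u k₃ k₁ * crossMul z u (u * u) k₁ k₂
      - crossMul z u u k₁ k₂ * crossMul z u (u * u) k₃ k₁) +
  crossMul z u 1 k₃ k₁ * (crossMul z u u k₁ k₂ * crossMul z u (u * u) k₂ k₃
      - crossMul z u u k₂ k₃ * crossMul z u (u * u) k₁ k₂) +
  crossMul z u 1 k₁ k₂ * (crossMul z u u k₂ k₃ * crossMul z u (u * u) k₃ k₁
      - crossMul z u u k₃ k₁ * crossMul z u (u * u) k₂ k₃)

/-- A minor of the cross product and its conjugate under `ζ ↦ ζ ^ u`; these are not proportional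
if it is nonzero. -/
def conjMinor {R : Type*} [CommRing R] (z : R) (u k₁ k₂ k₃ : ℕ) : R :=
  crossDiff z 1 k₂ k₃ * crossDiff z u k₃ k₁ - crossDiff z 1 k₃ k₁ * crossDiff z u k₂ k₃

section Map

variable {R S F : Type*} [CommRing R] [CommRing S] [FunLike F R S] [RingHomClass F R S] (f : F)
  (z : R)

@[simp] theorem map_sinDiff (m : ℕ) : f (sinDiff z m) = sinDiff (f z) m := by simp [sinDiff]

@[simp] theorem map_crossDiff (a k l : ℕ) :
    f (crossDiff z a k l) = crossDiff (f z) a k l := by simp [crossDiff]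

@[simp] theorem map_slopeDiff (k₁ b k : ℕ) :
    f (slopeDiff z k₁ b k) = slopeDiff (f z) k₁ b k := by simp [slopeDiff]

@[simp] theorem map_detDiff (b k₁ k₂ k₃ : ℕ) :
    f (detDiff z b k₁ k₂ k₃) = detDiff (f z) b k₁ k₂ k₃ := by simp [detDiff]

@[simp] theorem map_crossMul (u a k l : ℕ) :
    f (crossMul z u a k l) = crossMul (f z) u a k l := by simp [crossMul]

@[simp] theorem map_orthDet (u k₁ k₂ k₃ : ℕ) :
    f (orthDet z u k₁ k₂ k₃) = orthDet (f z) u k₁ k₂ k₃ := by simp [orthDet]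

@[simp] theorem map_conjMinor (u k₁ k₂ k₃ : ℕ) :
    f (conjMinor z u k₁ k₂ k₃) = conjMinor (f z) u k₁ k₂ k₃ := by simp [conjMinor]

end Map

theorem sinDiff_pow {R : Type*} [CommRing R] (z : R) (u m : ℕ) :
    sinDiff (z ^ u) m = sinDiff z (u * m) := by
  simp only [sinDiff, ← pow_mul]
  ring_nf

theorem crossDiff_pow {R : Type*} [CommRing R] (z : R) (u a k l : ℕ) :
    crossDiff (z ^ u) a k l = crossDiff z (a * u) k l := by
  simp only [crossDiff, sinDiff_pow]
  ring_nf

theorem crossMul_pow {R : Type*} [CommRing R] (z : R) (v u a k l : ℕ) :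
    crossMul (z ^ v) u a k l = crossMul z u (a * v) k l := by
  simp only [crossMul, crossDiff_pow]
  ring_nf

theorem pow_503_mul_eq_inv {F : Type*} [Field F] {z : F} (hz : z ^ 504 = 1) (m : ℕ) :
    z ^ (503 * m) = (z ^ m)⁻¹ := by
  apply eq_inv_of_mul_eq_one_left
  rw [← pow_add, show 503 * m + m = 504 * m by ring, pow_mul, hz, one_pow]

theorem sinDiff_eq {F : Type*} [Field F] {z : F} (hz : z ^ 504 = 1) (m : ℕ) :
    sinDiff z m = z ^ m - (z ^ m)⁻¹ := by
  rw [sinDiff, pow_503_mul_eq_inv hz]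

/-- The prime `1009 = 2 * 504 + 1` splits completely in the `504`-th cyclotomic field. -/
theorem isPrimitiveRoot_two_zmod : IsPrimitiveRoot (2 : ZMod 1009) 504 := by
  have : orderOf (2 : ZMod 1009) = 504 := by
    apply orderOf_eq_of_pow_and_pow_div_prime (by norm_num) (by decide +kernel)
    intro p hp hd
    have : p ∈ Nat.primeFactors 504 := Nat.mem_primeFactors.2 ⟨hp, hd, by norm_num⟩
    have h1 : Nat.primeFactors 504 = {2, 3, 7} := by decide +kernel
    rw [h1] at this
    simp only [Finset.mem_insert, Finset.mem_singleton] at this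
    rcases this with rfl | rfl | rfl <;> decide +kernel
  rw [← this]
  exact IsPrimitiveRoot.orderOf _

instance fact_prime_1009 : Fact (Nat.Prime 1009) := ⟨by norm_num⟩

namespace GaloisSolution

variable {L : Type*} [Field L] [Algebra ℚ L] {c x : Fin 3 → L} {q : Fin 3 → ℚ} {ζ : L}
  {k : Fin 3 → ℕ}

theorem sum_mul_sinDiff {N : ℕ} [NeZero N] [IsCyclotomicExtension {N} ℚ L]
    (h : GaloisSolution c x q) (hN : 504 ∣ N) (hζ : ζ ^ 504 = 1) (hk : ∀ j, x j = ζ ^ k j)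
    {u r : ℕ} (hu : u.Coprime 504) (hr : r = 1 ∨ r = 2) :
    ∑ j, c j * sinDiff ζ (r * u ^ 3 * k j) = 0 := by
  have hx : ∀ j, x j ^ 504 = 1 := fun j => by
    rw [hk, ← pow_mul, mul_comm, pow_mul, hζ, one_pow]
  rw [← h.relation_conj hN hx hu hr]
  refine Finset.sum_congr rfl fun j _ => ?_
  rw [sinDiff_eq hζ, hk, inv_pow, ← pow_mul, mul_comm (k j)]

theorem sum_mul_sinDiff_one (h : GaloisSolution c x q) (hζ : ζ ^ 504 = 1)
    (hk : ∀ j, x j = ζ ^ k j) : ∑ j, c j * sinDiff ζ (k j) = 0 := by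
  rw [← h.relation_one]
  refine Finset.sum_congr rfl fun j _ => ?_
  rw [sinDiff_eq hζ, hk]

theorem sum_mul_sinDiff_two (h : GaloisSolution c x q) (hζ : ζ ^ 504 = 1)
    (hk : ∀ j, x j = ζ ^ k j) : ∑ j, c j * sinDiff ζ (2 * k j) = 0 := by
  rw [← h.relation_two]
  refine Finset.sum_congr rfl fun j _ => ?_
  rw [sinDiff_eq hζ, hk, pow_mul', inv_pow]

theorem detDiff_eq_zero {N : ℕ} [NeZero N] [IsCyclotomicExtension {N} ℚ L]
    (h : GaloisSolution c x q) (hN : 504 ∣ N) (hζ : IsPrimitiveRoot ζ 504)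
    (hk : ∀ j, x j = ζ ^ k j) {u r : ℕ} (hu : u.Coprime 504) (hr : r = 1 ∨ r = 2) :
    detDiff (2 : ZMod 1009) (r * u ^ 3) (k 0) (k 1) (k 2) = 0 := by
  have := algebraRat.charZero L
  have h1 : detDiff ζ (r * u ^ 3) (k 0) (k 1) (k 2) = 0 := by
    have r₁ := h.sum_mul_sinDiff_one hζ.pow_eq_one hk
    have r₂ := h.sum_mul_sinDiff_two hζ.pow_eq_one hk
    have r₃ := h.sum_mul_sinDiff hN hζ.pow_eq_one hk hu hr
    simp only [Fin.sum_univ_three] at r₁ r₂ r₃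
    apply (mul_eq_zero.1 _).resolve_left (h.coeff_ne_zero 0)
    simp only [detDiff, crossDiff, one_mul, mul_one]
    linear_combination r₃ * (sinDiff ζ (k 1) * sinDiff ζ (2 * k 2) -
      sinDiff ζ (k 2) * sinDiff ζ (2 * k 1)) - r₂ * (sinDiff ζ (k 1) *
      sinDiff ζ (r * u ^ 3 * k 2) - sinDiff ζ (k 2) * sinDiff ζ (r * u ^ 3 * k 1)) +
      r₁ * (sinDiff ζ (2 * k 1) * sinDiff ζ (r * u ^ 3 * k 2) -
        sinDiff ζ (2 * k 2) * sinDiff ζ (r * u ^ 3 * k 1))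
  simpa using hζ.aeval_eq_zero_of_aeval_eq_zero (by norm_num) isPrimitiveRoot_two_zmod
    (P := detDiff Polynomial.X (r * u ^ 3) (k 0) (k 1) (k 2))
    (by simpa using h1)

/-- Once the first coefficient is eliminated from the relations, the ratio of the slopes at the second
and third exponents does not depend on the relation. -/
theorem slopeDiff_mul_eq {N : ℕ} [NeZero N] [IsCyclotomicExtension {N} ℚ L]
    (h : GaloisSolution c x q) (hN : 504 ∣ N) (hζ : IsPrimitiveRoot ζ 504)
    (hk : ∀ j, x j = ζ ^ k j) {u r : ℕ} (hu : u.Coprime 504) (hr : r = 1 ∨ r = 2) :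
    slopeDiff (2 : ZMod 1009) (k 0) 2 (k 1) * slopeDiff 2 (k 0) (r * u ^ 3) (k 2) =
      slopeDiff 2 (k 0) (r * u ^ 3) (k 1) * slopeDiff 2 (k 0) 2 (k 2) := by
  have := algebraRat.charZero L
  have h1 : slopeDiff ζ (k 0) 2 (k 1) * slopeDiff ζ (k 0) (r * u ^ 3) (k 2) -
      slopeDiff ζ (k 0) (r * u ^ 3) (k 1) * slopeDiff ζ (k 0) 2 (k 2) = 0 := by
    have r₁ := h.sum_mul_sinDiff_one hζ.pow_eq_one hk
    have r₂ := h.sum_mul_sinDiff_two hζ.pow_eq_one hk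
    have r₃ := h.sum_mul_sinDiff hN hζ.pow_eq_one hk hu hr
    simp only [Fin.sum_univ_three] at r₁ r₂ r₃
    apply (mul_eq_zero.1 _).resolve_left (h.coeff_ne_zero 1)
    have e₂ : c 1 * slopeDiff ζ (k 0) 2 (k 1) + c 2 * slopeDiff ζ (k 0) 2 (k 2) = 0 := by
      simp only [slopeDiff]
      linear_combination sinDiff ζ (k 0) * r₂ - sinDiff ζ (2 * k 0) * r₁
    have e₃ : c 1 * slopeDiff ζ (k 0) (r * u ^ 3) (k 1) +
        c 2 * slopeDiff ζ (k 0) (r * u ^ 3) (k 2) = 0 := by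
      simp only [slopeDiff]
      linear_combination sinDiff ζ (k 0) * r₃ - sinDiff ζ (r * u ^ 3 * k 0) * r₁
    linear_combination slopeDiff ζ (k 0) (r * u ^ 3) (k 2) * e₂ - slopeDiff ζ (k 0) 2 (k 2) * e₃
  set P : Polynomial ℤ :=
    slopeDiff Polynomial.X (k 0) 2 (k 1) * slopeDiff Polynomial.X (k 0) (r * u ^ 3) (k 2) -
      slopeDiff Polynomial.X (k 0) (r * u ^ 3) (k 1) * slopeDiff Polynomial.X (k 0) 2 (k 2) with hP
  have h2 : Polynomial.aeval (2 : ZMod 1009) P = 0 :=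
    hζ.aeval_eq_zero_of_aeval_eq_zero (by norm_num) isPrimitiveRoot_two_zmod
      (by simpa [hP] using h1)
  apply sub_eq_zero.1
  rwa [hP, map_sub, map_mul, map_mul, map_slopeDiff, map_slopeDiff, map_slopeDiff, map_slopeDiff,
    Polynomial.aeval_X] at h2

/-- The solution space of the two relations is spanned by the cross product. -/
theorem exists_eq_mul_crossDiff (h : GaloisSolution c x q) (hζ : ζ ^ 504 = 1)
    (hk : ∀ j, x j = ζ ^ k j) : ∃ l : L, l ≠ 0 ∧ c 0 = l * crossDiff ζ 1 (k 1) (k 2) ∧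
      c 1 = l * crossDiff ζ 1 (k 2) (k 0) ∧ c 2 = l * crossDiff ζ 1 (k 0) (k 1) := by
  have r₁ := h.sum_mul_sinDiff_one hζ hk
  have r₂ := h.sum_mul_sinDiff_two hζ hk
  simp only [Fin.sum_univ_three] at r₁ r₂
  have e₁ : c 1 * crossDiff ζ 1 (k 1) (k 2) = c 0 * crossDiff ζ 1 (k 2) (k 0) := by
    simp only [crossDiff, one_mul, mul_one]
    linear_combination sinDiff ζ (2 * k 2) * r₁ - sinDiff ζ (k 2) * r₂
  have e₂ : c 2 * crossDiff ζ 1 (k 1) (k 2) = c 0 * crossDiff ζ 1 (k 0) (k 1) := by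
    simp only [crossDiff, one_mul, mul_one]
    linear_combination sinDiff ζ (k 1) * r₂ - sinDiff ζ (2 * k 1) * r₁
  have hne : crossDiff ζ 1 (k 1) (k 2) ≠ 0 := by
    intro h0
    have h1 : (sinDiff ζ (k 2)) = 0 := by
      apply h.two_terms (i := 1) (j := 2) (by decide) (b := -sinDiff ζ (k 1))
      · simp only [sinDiff_eq hζ, hk]
        ring
      · simp only [crossDiff, one_mul, sinDiff_eq hζ, pow_mul', mul_comm 2] at h0
        simp only [sinDiff_eq hζ, hk, ← inv_pow]
        linear_combination -h0
    rw [sinDiff_eq hζ, ← hk] at h1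
    exact h.sub_inv_ne_zero 2 h1
  refine ⟨c 0 / crossDiff ζ 1 (k 1) (k 2), div_ne_zero (h.coeff_ne_zero 0) hne, ?_, ?_, ?_⟩
  · field_simp
  · field_simp
    exact e₁
  · field_simp
    exact e₂

/-- The orthogonality relation for a conjugate pair of cross products. -/
theorem sum_mul_crossMul {N : ℕ} [NeZero N] [IsCyclotomicExtension {N} ℚ L]
    (h : GaloisSolution c x q) (hN : 504 ∣ N) (hζ : IsPrimitiveRoot ζ 504)
    (hk : ∀ j, x j = ζ ^ k j) {u a : ℕ} (hu : u.Coprime 504) (ha : a.Coprime 504)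
    (hm : conjMinor (2 : ZMod 1009) u (k 0) (k 1) (k 2) ≠ 0) :
    q 0 * crossMul ζ u a (k 1) (k 2) + q 1 * crossMul ζ u a (k 2) (k 0) +
      q 2 * crossMul ζ u a (k 0) (k 1) = 0 := by
  have := algebraRat.charZero L
  have hm' : conjMinor ζ u (k 0) (k 1) (k 2) ≠ 0 := by
    intro h0
    apply hm
    simpa using hζ.aeval_eq_zero_of_aeval_eq_zero (by norm_num) isPrimitiveRoot_two_zmod
      (P := conjMinor Polynomial.X u (k 0) (k 1) (k 2)) (by simpa using h0)
  obtain ⟨l, hl, h0, h1, h2⟩ := h.exists_eq_mul_crossDiff hζ.pow_eq_one hk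
  obtain ⟨σ, hσ⟩ := exists_algEquiv_eq_pow (L := L) hN hu
  obtain ⟨τ, hτ⟩ := exists_algEquiv_eq_pow (L := L) hN ha
  replace hσ := hσ ζ hζ.pow_eq_one
  replace hτ := hτ ζ hζ.pow_eq_one
  have hσl : σ l ≠ 0 := by simpa using hl
  have hne : ∃ j, σ (c j) ≠ c j := by
    by_contra! hfix
    apply hm'
    have f0 := hfix 0
    have f1 := hfix 1
    rw [h0, map_mul, map_crossDiff, hσ, crossDiff_pow, one_mul] at f0
    rw [h1, map_mul, map_crossDiff, hσ, crossDiff_pow, one_mul] at f1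
    apply (mul_eq_zero.1 _).resolve_left hσl
    simp only [conjMinor]
    linear_combination crossDiff ζ 1 (k 1) (k 2) * f1 - crossDiff ζ 1 (k 2) (k 0) * f0
  have horth := h.orthogonal σ hne
  simp only [Fin.sum_univ_three, h0, h1, h2, map_mul, map_crossDiff, hσ, crossDiff_pow,
    one_mul] at horth
  have h3 : q 0 * crossMul ζ u 1 (k 1) (k 2) + q 1 * crossMul ζ u 1 (k 2) (k 0) +
      q 2 * crossMul ζ u 1 (k 0) (k 1) = 0 := by
    apply (mul_eq_zero.1 _).resolve_left (mul_ne_zero hl hσl)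
    simp only [crossMul, one_mul]
    linear_combination horth
  have h4 := congrArg τ h3
  simpa only [map_add, map_mul, map_crossMul, hτ, crossMul_pow, one_mul, map_zero,
    map_ratCast] using h4

/-- Three conjugate orthogonality relations have the common nonzero solution `q`. -/
theorem orthDet_eq_zero {N : ℕ} [NeZero N] [IsCyclotomicExtension {N} ℚ L]
    (h : GaloisSolution c x q) (hN : 504 ∣ N) (hζ : IsPrimitiveRoot ζ 504)
    (hk : ∀ j, x j = ζ ^ k j) {u : ℕ} (hu : u.Coprime 504)
    (hm : conjMinor (2 : ZMod 1009) u (k 0) (k 1) (k 2) ≠ 0) :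
    orthDet (2 : ZMod 1009) u (k 0) (k 1) (k 2) = 0 := by
  have := algebraRat.charZero L
  have r₁ := h.sum_mul_crossMul hN hζ hk hu (a := 1) (by norm_num) hm
  have r₂ := h.sum_mul_crossMul hN hζ hk hu (a := u) hu hm
  have r₃ := h.sum_mul_crossMul hN hζ hk hu (a := u * u) (hu.mul_left hu) hm
  have h1 : orthDet ζ u (k 0) (k 1) (k 2) = 0 := by
    have hq : (q 0 : L) ≠ 0 := by exact_mod_cast (h.pos 0).ne'
    apply (mul_eq_zero.1 _).resolve_left hq
    simp only [orthDet]
    set A := crossMul ζ u 1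
    set B := crossMul ζ u u
    set C := crossMul ζ u (u * u)
    linear_combination r₁ * (B (k 2) (k 0) * C (k 0) (k 1) - B (k 0) (k 1) * C (k 2) (k 0))
      - r₂ * (A (k 2) (k 0) * C (k 0) (k 1) - A (k 0) (k 1) * C (k 2) (k 0))
      + r₃ * (A (k 2) (k 0) * B (k 0) (k 1) - A (k 0) (k 1) * B (k 2) (k 0))
  simpa using hζ.aeval_eq_zero_of_aeval_eq_zero (by norm_num) isPrimitiveRoot_two_zmod
    (P := orthDet Polynomial.X u (k 0) (k 1) (k 2)) (by simpa using h1)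

end GaloisSolution


/-! ### Arithmetic modulo `1009` on natural numbers -/

/-- Subtraction modulo `1009`. -/
def subMod (a b : ℕ) : ℕ := (a + (1009 - b % 1009)) % 1009

/-- `sinDiff` at the primitive `504`-th root of unity `2` modulo `1009`. Like the following
functions, it is a natural number so that the kernel computes it quickly. -/
def sinMod (m : ℕ) : ℕ := subMod (2 ^ (m % 504)) (2 ^ ((503 * m) % 504))

/-- `crossDiff` modulo `1009`. -/
def crossMod (a k l : ℕ) : ℕ :=
  subMod (sinMod (a * k) * sinMod (2 * a * l)) (sinMod (a * l) * sinMod (2 * a * k))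

/-- `slopeDiff` modulo `1009`. -/
def slopeMod (k₁ b k : ℕ) : ℕ :=
  subMod (sinMod (b * k) * sinMod k₁) (sinMod (b * k₁) * sinMod k)

/-- `detDiff` modulo `1009`. -/
def detMod (b k₁ k₂ k₃ : ℕ) : ℕ :=
  (crossMod 1 k₂ k₃ * sinMod (b * k₁) + crossMod 1 k₃ k₁ * sinMod (b * k₂) +
    crossMod 1 k₁ k₂ * sinMod (b * k₃)) % 1009

/-- `crossMul` modulo `1009`. -/
def crossMulMod (u a k l : ℕ) : ℕ := crossMod a k l * crossMod (a * u) k l % 1009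

/-- `orthDet` modulo `1009`. -/
def orthDetMod (u k₁ k₂ k₃ : ℕ) : ℕ :=
  (crossMulMod u 1 k₂ k₃ *
      subMod (crossMulMod u u k₃ k₁ * crossMulMod u (u * u) k₁ k₂)
        (crossMulMod u u k₁ k₂ * crossMulMod u (u * u) k₃ k₁) +
    crossMulMod u 1 k₃ k₁ *
      subMod (crossMulMod u u k₁ k₂ * crossMulMod u (u * u) k₂ k₃)
        (crossMulMod u u k₂ k₃ * crossMulMod u (u * u) k₁ k₂) +
    crossMulMod u 1 k₁ k₂ *
      subMod (crossMulMod u u k₂ k₃ * crossMulMod u (u * u) k₃ k₁)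
        (crossMulMod u u k₃ k₁ * crossMulMod u (u * u) k₂ k₃)) % 1009

/-- `conjMinor` modulo `1009`. -/
def conjMinorMod (u k₁ k₂ k₃ : ℕ) : ℕ :=
  subMod (crossMod 1 k₂ k₃ * crossMod u k₃ k₁) (crossMod 1 k₃ k₁ * crossMod u k₂ k₃)

theorem cast_subMod (a b : ℕ) : (subMod a b : ZMod 1009) = a - b := by
  rw [subMod, ZMod.natCast_mod, Nat.cast_add, Nat.cast_sub (Nat.mod_lt _ (by norm_num)).le,
    ZMod.natCast_mod, ZMod.natCast_self]
  ring

theorem cast_sinMod (m : ℕ) : (sinMod m : ZMod 1009) = sinDiff 2 m := by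
  have h : ∀ l : ℕ, (2 : ZMod 1009) ^ (l % 504) = 2 ^ l := fun l =>
    pow_eq_pow_of_modEq (Nat.mod_modEq _ _) isPrimitiveRoot_two_zmod.pow_eq_one
  simp only [sinMod, cast_subMod, Nat.cast_pow, Nat.cast_ofNat, h, sinDiff]

theorem cast_crossMod (a k l : ℕ) : (crossMod a k l : ZMod 1009) = crossDiff 2 a k l := by
  simp only [crossMod, cast_subMod, Nat.cast_mul, cast_sinMod, crossDiff]

theorem cast_slopeMod (k₁ b k : ℕ) : (slopeMod k₁ b k : ZMod 1009) = slopeDiff 2 k₁ b k := by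
  simp only [slopeMod, cast_subMod, Nat.cast_mul, cast_sinMod, slopeDiff]

theorem cast_detMod (b k₁ k₂ k₃ : ℕ) :
    (detMod b k₁ k₂ k₃ : ZMod 1009) = detDiff 2 b k₁ k₂ k₃ := by
  simp only [detMod, ZMod.natCast_mod, Nat.cast_add, Nat.cast_mul, cast_sinMod, cast_crossMod,
    detDiff]

theorem cast_crossMulMod (u a k l : ℕ) :
    (crossMulMod u a k l : ZMod 1009) = crossMul 2 u a k l := by
  simp only [crossMulMod, ZMod.natCast_mod, Nat.cast_mul, cast_crossMod, crossMul]

theorem cast_orthDetMod (u k₁ k₂ k₃ : ℕ) :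
    (orthDetMod u k₁ k₂ k₃ : ZMod 1009) = orthDet 2 u k₁ k₂ k₃ := by
  simp only [orthDetMod, ZMod.natCast_mod, Nat.cast_add, Nat.cast_mul, cast_subMod,
    cast_crossMulMod, orthDet]

theorem cast_conjMinorMod (u k₁ k₂ k₃ : ℕ) :
    (conjMinorMod u k₁ k₂ k₃ : ZMod 1009) = conjMinor 2 u k₁ k₂ k₃ := by
  simp only [conjMinorMod, cast_subMod, Nat.cast_mul, cast_crossMod, conjMinor]

theorem subMod_lt (a b : ℕ) : subMod a b < 1009 := Nat.mod_lt _ (by norm_num)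

theorem eq_zero_of_natCast_zmod {m : ℕ} (hm : m < 1009) (h : (m : ZMod 1009) = 0) : m = 0 :=
  Nat.eq_zero_of_dvd_of_lt ((ZMod.natCast_eq_zero_iff _ _).1 h) hm

/-! ### Signs -/

/-- The sign of `sin (2 π m / 504)`. -/
def signSin (m : ℕ) : SignType :=
  if m % 504 = 0 then 0 else if m % 504 < 252 then 1 else if m % 504 = 252 then 0 else -1

/-- The multiple of `π / 252` in `[0, π]` with the same cosine as `2 π m / 504`. -/
def foldAngle (m : ℕ) : ℕ := if m % 504 ≤ 252 then m % 504 else 504 - m % 504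

/-- The sign of `cos (2 π m / 504) - cos (2 π l / 504)`. -/
def signCosSub (m l : ℕ) : SignType :=
  if foldAngle m < foldAngle l then 1 else if foldAngle m = foldAngle l then 0 else -1

/-- The sign of `crossReal a k l`. -/
def signCross (a k l : ℕ) : SignType :=
  signSin (a * k) * signSin (a * l) * signCosSub (a * l) (a * k)

/-- A coordinate of the cross product of `(sin θⱼ)ⱼ` and `(sin 2θⱼ)ⱼ`, up to a factor `2`, where
`θⱼ = 2 π a kⱼ / 504`. -/
noncomputable def crossReal (a k l : ℕ) : ℝ :=
  Real.sin (2 * Real.pi * (a * k : ℕ) / 504) * Real.sin (2 * Real.pi * (a * l : ℕ) / 504) *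
    (Real.cos (2 * Real.pi * (a * l : ℕ) / 504) - Real.cos (2 * Real.pi * (a * k : ℕ) / 504))

theorem angle_eq (m : ℕ) : 2 * Real.pi * m / 504 =
    2 * Real.pi * (m % 504 : ℕ) / 504 + (m / 504 : ℕ) * (2 * Real.pi) := by
  conv_lhs => rw [← Nat.mod_add_div m 504]
  push_cast
  ring

theorem sign_sin (m : ℕ) : SignType.sign (Real.sin (2 * Real.pi * m / 504)) = signSin m := by
  rw [angle_eq, Real.sin_add_nat_mul_two_pi]
  have hm := Nat.mod_lt m (show 504 > 0 by norm_num)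
  have hπ := Real.pi_pos
  unfold signSin
  set r := m % 504
  split_ifs with h0 h1 h2
  · simp [h0]
  · rw [sign_eq_one_iff]
    have h1' : (r : ℝ) < 252 := by exact_mod_cast h1
    have h0' : (0 : ℝ) < r := by exact_mod_cast Nat.pos_of_ne_zero h0
    apply Real.sin_pos_of_pos_of_lt_pi
    · positivity
    · nlinarith
  · rw [h2, show 2 * Real.pi * ((252 : ℕ) : ℝ) / 504 = Real.pi by push_cast; ring, Real.sin_pi]
    exact sign_zero
  · rw [sign_eq_neg_one_iff]
    have h1' : (252 : ℝ) < r := by exact_mod_cast (by omega : 252 < r)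
    have hm' : (r : ℝ) < 504 := by exact_mod_cast hm
    rw [← Real.sin_sub_two_pi]
    apply Real.sin_neg_of_neg_of_neg_pi_lt <;> nlinarith

theorem cos_foldAngle (m : ℕ) :
    Real.cos (2 * Real.pi * m / 504) = Real.cos (2 * Real.pi * foldAngle m / 504) := by
  rw [angle_eq, Real.cos_add_nat_mul_two_pi]
  have hm := Nat.mod_lt m (show 504 > 0 by norm_num)
  unfold foldAngle
  split_ifs
  · rfl
  · rw [Nat.cast_sub hm.le, ← Real.cos_two_pi_sub]
    congr 1
    push_cast
    ring

theorem cos_lt_cos_of_foldAngle_lt {m l : ℕ} (h : foldAngle m < foldAngle l) :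
    Real.cos (2 * Real.pi * l / 504) < Real.cos (2 * Real.pi * m / 504) := by
  rw [cos_foldAngle m, cos_foldAngle l]
  have hl : foldAngle l ≤ 252 := by unfold foldAngle; split_ifs <;> omega
  have hl' : (foldAngle l : ℝ) ≤ 252 := by exact_mod_cast hl
  have h' : (foldAngle m : ℝ) < foldAngle l := by exact_mod_cast h
  have hπ := Real.pi_pos
  apply Real.cos_lt_cos_of_nonneg_of_le_pi
  · positivity
  · nlinarith
  · rw [div_lt_div_iff_of_pos_right (by norm_num)]
    nlinarith

theorem sign_cos_sub (m l : ℕ) :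
    SignType.sign (Real.cos (2 * Real.pi * m / 504) - Real.cos (2 * Real.pi * l / 504)) =
      signCosSub m l := by
  unfold signCosSub
  split_ifs with h1 h2
  · rw [sign_eq_one_iff, sub_pos]
    exact cos_lt_cos_of_foldAngle_lt h1
  · rw [cos_foldAngle m, cos_foldAngle l, h2, sub_self, sign_zero]
  · rw [sign_eq_neg_one_iff, sub_neg]
    exact cos_lt_cos_of_foldAngle_lt (by omega)

theorem sign_crossReal (a k l : ℕ) : SignType.sign (crossReal a k l) = signCross a k l := by
  rw [crossReal, sign_mul, sign_mul, sign_sin, sign_sin, sign_cos_sub, signCross]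

theorem sinDiff_exp (m : ℕ) : sinDiff (Complex.exp (2 * Real.pi * Complex.I / 504)) m =
    2 * Complex.I * (Real.sin (2 * Real.pi * m / 504) : ℝ) := by
  have h1 : Complex.exp (2 * Real.pi * Complex.I / 504) ^ 504 = 1 := by
    rw [← Complex.exp_nat_mul, Complex.exp_eq_one_iff]
    exact ⟨1, by push_cast; ring⟩
  rw [sinDiff_eq h1, ← Complex.exp_nat_mul, ← Complex.exp_neg, Complex.ofReal_sin, Complex.sin]
  push_cast
  rw [show (m : ℂ) * (2 * Real.pi * Complex.I / 504) = 2 * Real.pi * m / 504 * Complex.I by ring,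
    show -(2 * Real.pi * m / 504 * Complex.I) = -(2 * Real.pi * m / 504 : ℂ) * Complex.I by ring]
  linear_combination (Complex.exp (2 * Real.pi * m / 504 * Complex.I) -
    Complex.exp (-(2 * Real.pi * m / 504 : ℂ) * Complex.I)) * Complex.I_mul_I

theorem crossDiff_exp (a k l : ℕ) :
    crossDiff (Complex.exp (2 * Real.pi * Complex.I / 504)) a k l =
      ((-8 * crossReal a k l : ℝ) : ℂ) := by
  have h2 : ∀ m : ℕ, Real.sin (2 * Real.pi * (2 * m : ℕ) / 504) =
      2 * Real.sin (2 * Real.pi * m / 504) * Real.cos (2 * Real.pi * m / 504) := fun m => by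
    rw [← Real.sin_two_mul]
    congr 1
    push_cast
    ring
  simp only [crossDiff, mul_assoc 2 a, sinDiff_exp]
  rw [h2, h2, crossReal]
  push_cast
  ring_nf
  simp only [Complex.I_sq]
  ring


/-! ### The finite search -/

/-- Relations are compared for the exponents `r * u ^ 3` with these `(r, u)`. -/
def relationExponents : List (ℕ × ℕ) :=
  [(1, 5), (1, 13), (2, 5), (1, 17), (1, 23), (1, 29), (1, 31), (1, 251),
    (2, 13), (2, 17), (2, 23), (2, 29), (2, 31), (2, 251)]

/-- The three roots of unity are, up to inversion, in one coset of the cube roots of unity. -/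
def familyTest (k₁ k₂ k₃ : ℕ) : Bool :=
  ((3 * k₁ + 3 * k₂) % 504 == 0 || (3 * k₁) % 504 == (3 * k₂) % 504) &&
    ((3 * k₁ + 3 * k₃) % 504 == 0 || (3 * k₁) % 504 == (3 * k₃) % 504)

/-- The relations have only the zero solution. -/
def detTest (k₁ k₂ k₃ : ℕ) : Bool :=
  relationExponents.any fun p => !(detMod (p.1 * p.2 ^ 3) k₁ k₂ k₃ == 0)

/-- The cross product is not proportional to its conjugate, and no nonzero diagonal form makes all
conjugate pairs orthogonal. -/
def orthTest (u k₁ k₂ k₃ : ℕ) : Bool :=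
  !(conjMinorMod u k₁ k₂ k₃ == 0) && !(orthDetMod u k₁ k₂ k₃ == 0)

/-- All terms of the orthogonality relation for the pair `ζ ^ a`, `ζ ^ (a * u)` have the same
sign. -/
def signTest (a u k₁ k₂ k₃ : ℕ) : Bool :=
  !(conjMinorMod u k₁ k₂ k₃ == 0) &&
    !(decide (signCross a k₂ k₃ * signCross (a * u) k₂ k₃ = 0)) &&
    decide (signCross a k₃ k₁ * signCross (a * u) k₃ k₁ =
      signCross a k₂ k₃ * signCross (a * u) k₂ k₃) &&
    decide (signCross a k₁ k₂ * signCross (a * u) k₁ k₂ =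
      signCross a k₂ k₃ * signCross (a * u) k₂ k₃)

/-- A reason why there is no solution with exponents `k₁`, `k₂`, `k₃`. -/
def obstruction (k₁ k₂ k₃ : ℕ) : Bool :=
  detTest k₁ k₂ k₃ || familyTest k₁ k₂ k₃ || orthTest 5 k₁ k₂ k₃ ||
    [(1, 5), (1, 11), (5, 5)].any fun p =>
      signTest p.1 p.2 k₁ k₂ k₃ || signTest p.1 p.2 k₂ k₃ k₁

/-- The order of the three roots of unity is `7`, `14` or `18`. -/
def orderTest (k₁ k₂ k₃ : ℕ) : Bool :=
  let d := Nat.gcd (Nat.gcd k₁ k₂) (Nat.gcd k₃ 504)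
  d == 72 || d == 36 || d == 28

/-- The slopes for the first exponents, relative to the slope for the exponent `2`. -/
def slopeKey (k₁ k : ℕ) : ℕ :=
  let i := slopeMod k₁ 2 k ^ 1007 % 1009
  ((relationExponents.map fun p => slopeMod k₁ (p.1 * p.2 ^ 3) k * i % 1009).take 4).foldl
    (fun r m => r * 1009 + m) 0

/-- Comparison of all pairs with equal keys, after sorting into `2 ^ d` buckets. -/
def bucketTest (R : ℕ → ℕ → Bool) : ℕ → List (ℕ × ℕ) → Bool
  | 0, l => decide (l.Pairwise fun p p' => (Nat.beq p.2 p'.2) = true → R p.1 p'.1 = true)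
  | d + 1, l => bucketTest R d (l.filter fun p => Nat.beq (p.2 / 2 ^ d % 2) 0) &&
      bucketTest R d (l.filter fun p => !Nat.beq (p.2 / 2 ^ d % 2) 0)

/-- No solution with first exponent `k₁` and increasing exponents `k₂`, `k₃` below `252`, except
for the orders `7`, `14`, `18`. -/
def searchTest (k₁ : ℕ) : Bool :=
  let l := List.range' 1 251
  (l.all fun k => Nat.beq k k₁ || !Nat.beq (slopeMod k₁ 2 k) 0) &&
  bucketTest (fun k₂ k₃ => Nat.beq k₂ k₁ || Nat.beq k₃ k₁ || orderTest k₁ k₂ k₃ ||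
      obstruction k₁ k₂ k₃) 7 (l.map fun k => (k, slopeKey k₁ k))


/-! ### Soundness of the search -/

namespace GaloisSolution

variable {L : Type*} [Field L] [Algebra ℚ L] {c x : Fin 3 → L} {q : Fin 3 → ℚ} {ζ : L}
  {k : Fin 3 → ℕ}

theorem perm (h : GaloisSolution c x q) (π : Equiv.Perm (Fin 3)) :
    GaloisSolution (c ∘ π) (x ∘ π) (q ∘ π) where
  relation_one := by
    rw [← h.relation_one]
    exact Equiv.sum_comp π fun j => c j * (x j - (x j)⁻¹)
  relation_two := by
    rw [← h.relation_two]
    exact Equiv.sum_comp π fun j => c j * (x j ^ 2 - (x j)⁻¹ ^ 2)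
  independent g hg j := by
    have := h.independent (g ∘ π.symm) (by
      rw [← hg, ← Equiv.sum_comp π]
      simp) (π j)
    simpa using this
  ne_zero j := h.ne_zero _
  sq_ne_one j := h.sq_ne_one _
  injective := h.injective.comp π.injective
  mul_ne_one i j hij := h.mul_ne_one _ _ (π.injective.ne hij)
  map_cube σ j := h.map_cube σ _
  pos j := h.pos _
  orthogonal σ hσ := by
    obtain ⟨j, hj⟩ := hσ
    rw [← h.orthogonal σ ⟨_, hj⟩]
    exact Equiv.sum_comp π fun j => (q j : L) * c j * σ (c j)

/-- Inverting some of the `x j` and changing the signs of the corresponding `c j`. -/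
theorem orient (h : GaloisSolution c x q) (b : Fin 3 → Bool) :
    GaloisSolution (fun j => orientSign (b j) (c j)) (fun j => orient (b j) (x j)) q where
  relation_one := by
    rw [← h.relation_one]
    refine Finset.sum_congr rfl fun j _ => ?_
    cases b j <;> simp [_root_.orient, orientSign, ← mul_neg]
  relation_two := by
    rw [← h.relation_two]
    refine Finset.sum_congr rfl fun j _ => ?_
    cases b j <;> simp [_root_.orient, orientSign, ← mul_neg]
  independent g hg j := by
    have := h.independent (fun j => if b j then g j else -g j) (by
      rw [← hg]
      refine Finset.sum_congr rfl fun j _ => ?_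
      cases b j <;> simp [orientSign]) j
    cases hb : b j <;> simpa [hb] using this
  ne_zero j := h.orient_ne_zero _ j
  sq_ne_one j := by
    have := h.sq_ne_one j
    cases b j <;> simpa [_root_.orient]
  injective := h.orient_injective b
  mul_ne_one i j hij := by
    have h1 := h.mul_ne_one i j hij
    have h2 := h.injective.ne hij
    have hi := h.ne_zero i
    have hj := h.ne_zero j
    cases b i <;> cases b j <;>
      simp only [_root_.orient, if_true, if_false, Bool.false_eq_true] <;> intro h0
    · apply h1
      rw [← mul_inv, inv_eq_one] at h0
      exact h0
    · exact h2 (inv_mul_eq_one₀ hi |>.1 h0)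
    · exact h2 (mul_inv_eq_one₀ hj |>.1 h0)
    · exact h1 h0
  map_cube σ j := by
    have := h.map_cube σ j
    cases b j <;> simpa [orientSign]
  pos := h.pos
  orthogonal σ hσ := by
    obtain ⟨j, hj⟩ := hσ
    rw [← h.orthogonal σ ⟨j, by cases hb : b j <;> simpa [orientSign, hb] using hj⟩]
    refine Finset.sum_congr rfl fun j _ => ?_
    cases b j <;> simp [orientSign]

theorem detTest_eq_false {N : ℕ} [NeZero N] [IsCyclotomicExtension {N} ℚ L]
    (h : GaloisSolution c x q) (hN : 504 ∣ N) (hζ : IsPrimitiveRoot ζ 504)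
    (hk : ∀ j, x j = ζ ^ k j) : detTest (k 0) (k 1) (k 2) = false := by
  have hcop : ∀ p ∈ relationExponents, p.2.Coprime 504 ∧ (p.1 = 1 ∨ p.1 = 2) := by decide
  rw [detTest, List.any_eq_false]
  intro p hp
  have h1 := h.detDiff_eq_zero hN hζ hk (hcop p hp).1 (hcop p hp).2
  rw [← cast_detMod] at h1
  have h2 : detMod (p.1 * p.2 ^ 3) (k 0) (k 1) (k 2) = 0 :=
    eq_zero_of_natCast_zmod (Nat.mod_lt _ (by norm_num)) h1
  simp [h2]

theorem familyTest_eq_false (h : GaloisSolution c x q) (hζ : ζ ^ 504 = 1)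
    (hk : ∀ j, x j = ζ ^ k j) : familyTest (k 0) (k 1) (k 2) = false := by
  rw [Bool.eq_false_iff]
  intro ht
  have key : ∀ j, ((3 * k 0 + 3 * k j) % 504 == 0 || (3 * k 0) % 504 == (3 * k j) % 504) = true →
      ∃ b : Bool, _root_.orient b (x j) ^ 3 = x 0 ^ 3 := by
    intro j hj
    simp only [Bool.or_eq_true, beq_iff_eq] at hj
    rcases hj with hj | hj
    · refine ⟨false, ?_⟩
      simp only [_root_.orient, Bool.false_eq_true, if_false, inv_pow]
      apply inv_eq_of_mul_eq_one_left
      rw [hk, hk, ← pow_mul, ← pow_mul, ← pow_add, mul_comm _ 3, mul_comm _ 3]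
      obtain ⟨d, hd⟩ := Nat.dvd_of_mod_eq_zero hj
      rw [hd, pow_mul, hζ, one_pow]
    · refine ⟨true, ?_⟩
      simp only [_root_.orient, if_true]
      rw [hk, hk, ← pow_mul, ← pow_mul, mul_comm _ 3, mul_comm _ 3]
      exact (pow_eq_pow_of_modEq hj hζ).symm
  simp only [familyTest, Bool.and_eq_true] at ht
  obtain ⟨b₁, hb₁⟩ := key 1 ht.1
  obtain ⟨b₂, hb₂⟩ := key 2 ht.2
  refine h.false_of_orient_cube_eq ![true, b₁, b₂] ?_
  have : ∀ j, _root_.orient (![true, b₁, b₂] j) (x j) ^ 3 = x 0 ^ 3 := by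
    intro j
    fin_cases j
    · simp [_root_.orient]
    · exact hb₁
    · exact hb₂
  intro i j
  rw [this, this]

theorem conjMinor_ne_zero_of_mod {u k₁ k₂ k₃ : ℕ} (h : conjMinorMod u k₁ k₂ k₃ ≠ 0) :
    conjMinor (2 : ZMod 1009) u k₁ k₂ k₃ ≠ 0 := by
  rw [← cast_conjMinorMod]
  exact fun h0 => h (eq_zero_of_natCast_zmod (subMod_lt _ _) h0)

theorem orthTest_eq_false {N : ℕ} [NeZero N] [IsCyclotomicExtension {N} ℚ L]
    (h : GaloisSolution c x q) (hN : 504 ∣ N) (hζ : IsPrimitiveRoot ζ 504)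
    (hk : ∀ j, x j = ζ ^ k j) {u : ℕ} (hu : u.Coprime 504) :
    orthTest u (k 0) (k 1) (k 2) = false := by
  rw [Bool.eq_false_iff]
  intro ht
  simp only [orthTest, Bool.and_eq_true, Bool.not_eq_true', beq_eq_false_iff_ne] at ht
  have h1 := h.orthDet_eq_zero hN hζ hk hu (conjMinor_ne_zero_of_mod ht.1)
  rw [← cast_orthDetMod] at h1
  exact ht.2 (eq_zero_of_natCast_zmod (Nat.mod_lt _ (by norm_num)) h1)

/-- Clearing denominators makes the orthogonality relations polynomial with integral coefficients. -/
theorem exists_pos_nat_mul_eq (h : GaloisSolution c x q) :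
    ∃ (m : ℚ) (Q : Fin 3 → ℕ), ∀ j, 0 < Q j ∧ m * q j = Q j := by
  have h1 : ∀ j, (q j : ℚ) * (q j).den = ((q j).num.toNat : ℚ) := fun j => by
    rw [Rat.mul_den_eq_num, ← Int.cast_natCast, Int.toNat_of_nonneg (Rat.num_pos.2 (h.pos j)).le]
  have h2 : ∀ j, 0 < (q j).num.toNat := fun j => by
    have := Rat.num_pos.2 (h.pos j)
    omega
  have h3 : ∀ j, 0 < (q j).den := fun j => (q j).den_pos
  refine ⟨(q 0).den * (q 1).den * (q 2).den, ![(q 0).num.toNat * ((q 1).den * (q 2).den),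
    (q 1).num.toNat * ((q 0).den * (q 2).den), (q 2).num.toNat * ((q 0).den * (q 1).den)], ?_⟩
  intro j
  match j with
  | 0 =>
    refine ⟨mul_pos (h2 0) (mul_pos (h3 1) (h3 2)), ?_⟩
    simp only [Matrix.cons_val, Nat.cast_mul, ← h1]
    ring
  | 1 =>
    refine ⟨mul_pos (h2 1) (mul_pos (h3 0) (h3 2)), ?_⟩
    simp only [Matrix.cons_val, Nat.cast_mul, ← h1]
    ring
  | 2 =>
    refine ⟨mul_pos (h2 2) (mul_pos (h3 0) (h3 1)), ?_⟩
    simp only [Matrix.cons_val, Nat.cast_mul, ← h1]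
    ring

/-- The orthogonality relations in terms of real sines and cosines. -/
theorem sum_mul_crossReal {N : ℕ} [NeZero N] [IsCyclotomicExtension {N} ℚ L]
    (h : GaloisSolution c x q) (hN : 504 ∣ N) (hζ : IsPrimitiveRoot ζ 504)
    (hk : ∀ j, x j = ζ ^ k j) {u a : ℕ} (hu : u.Coprime 504) (ha : a.Coprime 504)
    (hm : conjMinor (2 : ZMod 1009) u (k 0) (k 1) (k 2) ≠ 0) :
    ∃ Q : Fin 3 → ℝ, (∀ j, 0 < Q j) ∧
      Q 0 * (crossReal a (k 1) (k 2) * crossReal (a * u) (k 1) (k 2)) +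
      Q 1 * (crossReal a (k 2) (k 0) * crossReal (a * u) (k 2) (k 0)) +
      Q 2 * (crossReal a (k 0) (k 1) * crossReal (a * u) (k 0) (k 1)) = 0 := by
  have := algebraRat.charZero L
  obtain ⟨m, Q, hQ⟩ := h.exists_pos_nat_mul_eq
  refine ⟨fun j => Q j, fun j => Nat.cast_pos.2 (hQ j).1, ?_⟩
  have hQ' : ∀ j, (m : L) * q j = Q j := fun j => by exact_mod_cast (hQ j).2
  have h1 := h.sum_mul_crossMul hN hζ hk hu ha hm
  set P : Polynomial ℤ := (Q 0 : Polynomial ℤ) * crossMul Polynomial.X u a (k 1) (k 2) +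
    (Q 1 : Polynomial ℤ) * crossMul Polynomial.X u a (k 2) (k 0) +
    (Q 2 : Polynomial ℤ) * crossMul Polynomial.X u a (k 0) (k 1) with hP
  have h2 : Polynomial.aeval ζ P = 0 := by
    simp only [hP, map_add, map_mul, map_natCast, map_crossMul, Polynomial.aeval_X, ← hQ']
    linear_combination (m : L) * h1
  have h3 : Polynomial.aeval (Complex.exp (2 * Real.pi * Complex.I / 504)) P = 0 :=
    hζ.aeval_eq_zero_of_aeval_eq_zero (by norm_num)
      (by exact_mod_cast Complex.isPrimitiveRoot_exp 504 (by norm_num)) h2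
  simp only [hP, map_add, map_mul, map_natCast, map_crossMul, Polynomial.aeval_X] at h3
  simp only [crossMul, crossDiff_exp] at h3
  have h4 : (Q 0 : ℝ) * (-8 * crossReal a (k 1) (k 2) * (-8 * crossReal (a * u) (k 1) (k 2))) +
      Q 1 * (-8 * crossReal a (k 2) (k 0) * (-8 * crossReal (a * u) (k 2) (k 0))) +
      Q 2 * (-8 * crossReal a (k 0) (k 1) * (-8 * crossReal (a * u) (k 0) (k 1))) = 0 := by
    exact_mod_cast h3
  linear_combination h4 / 64

/-- A sum of three positive multiples of numbers of one sign is not zero. -/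
theorem signTest_eq_false {N : ℕ} [NeZero N] [IsCyclotomicExtension {N} ℚ L]
    (h : GaloisSolution c x q) (hN : 504 ∣ N) (hζ : IsPrimitiveRoot ζ 504)
    (hk : ∀ j, x j = ζ ^ k j) {u a : ℕ} (hu : u.Coprime 504) (ha : a.Coprime 504) :
    signTest a u (k 0) (k 1) (k 2) = false := by
  rw [Bool.eq_false_iff]
  intro ht
  simp only [signTest, Bool.and_eq_true, Bool.not_eq_true', beq_eq_false_iff_ne,
    decide_eq_true_eq, decide_eq_false_iff_not] at ht
  obtain ⟨⟨⟨hm, hs⟩, h1⟩, h2⟩ := ht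
  obtain ⟨Q, hQ, hsum⟩ := h.sum_mul_crossReal hN hζ hk hu ha (conjMinor_ne_zero_of_mod hm)
  simp only [← sign_crossReal, ← sign_mul] at hs h1 h2
  set A := crossReal a (k 1) (k 2) * crossReal (a * u) (k 1) (k 2)
  set B := crossReal a (k 2) (k 0) * crossReal (a * u) (k 2) (k 0)
  set C := crossReal a (k 0) (k 1) * crossReal (a * u) (k 0) (k 1)
  rcases lt_trichotomy A 0 with h3 | h3 | h3
  · rw [sign_neg h3, sign_eq_neg_one_iff] at h1 h2
    have := mul_neg_of_pos_of_neg (hQ 0) h3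
    have := mul_neg_of_pos_of_neg (hQ 1) h1
    have := mul_neg_of_pos_of_neg (hQ 2) h2
    linarith
  · exact hs (by rw [h3, sign_zero])
  · rw [sign_pos h3, sign_eq_one_iff] at h1 h2
    have := mul_pos (hQ 0) h3
    have := mul_pos (hQ 1) h1
    have := mul_pos (hQ 2) h2
    linarith

theorem obstruction_eq_false {N : ℕ} [NeZero N] [IsCyclotomicExtension {N} ℚ L]
    (h : GaloisSolution c x q) (hN : 504 ∣ N) (hζ : IsPrimitiveRoot ζ 504)
    (hk : ∀ j, x j = ζ ^ k j) : obstruction (k 0) (k 1) (k 2) = false := by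
  have hcop : ∀ p ∈ [(1, 5), (1, 11), (5, 5)],
      Nat.Coprime (p : ℕ × ℕ).1 504 ∧ Nat.Coprime p.2 504 := by decide
  have h' := h.perm (finRotate 3)
  have hk' : ∀ j, (x ∘ finRotate 3) j = ζ ^ (k ∘ finRotate 3) j := fun j => hk _
  simp only [obstruction, Bool.or_eq_false_iff, List.any_eq_false, Bool.or_eq_true, not_or,
    Bool.not_eq_true]
  exact ⟨⟨⟨h.detTest_eq_false hN hζ hk, h.familyTest_eq_false hζ.pow_eq_one hk⟩,
    h.orthTest_eq_false hN hζ hk (by norm_num)⟩, fun p hp =>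
    ⟨h.signTest_eq_false hN hζ hk (hcop p hp).2 (hcop p hp).1,
      h'.signTest_eq_false hN hζ hk' (hcop p hp).2 (hcop p hp).1⟩⟩

end GaloisSolution


theorem pairwise_of_bucketTest {R : ℕ → ℕ → Bool} {d : ℕ} {l : List (ℕ × ℕ)}
    (h : bucketTest R d l = true) :
    l.Pairwise fun p p' => p.2 = p'.2 → R p.1 p'.1 = true := by
  induction d generalizing l with
  | zero =>
    simpa [bucketTest] using h
  | succ d ih =>
    simp only [bucketTest, Bool.and_eq_true] at h
    have h1 := List.pairwise_filter.1 (ih h.1)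
    have h2 := List.pairwise_filter.1 (ih h.2)
    refine (h1.and h2).imp ?_
    rintro p p' ⟨h3, h4⟩ h5
    cases hp : Nat.beq (p.2 / 2 ^ d % 2) 0
    · exact h4 (by simp [hp]) (by simp [← h5, hp]) h5
    · exact h3 hp (by rw [← h5, hp]) h5

set_option maxRecDepth 10000 in
theorem searchTest_of_mem_divisors {k : ℕ} (hk : k ∈ (Nat.divisors 504).filter (· < 252)) :
    searchTest k = true := by
  have h : ∀ k ∈ [1, 2, 3, 4, 6, 7, 8, 9, 12, 14, 18, 21, 24, 28, 36, 42, 56, 63, 72, 84, 126, 168],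
      searchTest k = true := by decide +kernel
  apply h
  have h1 : (Nat.divisors 504).filter (· < 252) = List.toFinset
    [1, 2, 3, 4, 6, 7, 8, 9, 12, 14, 18, 21, 24, 28, 36, 42, 56, 63, 72, 84, 126, 168] := by
    decide +kernel
  rw [h1] at hk
  exact List.mem_toFinset.1 hk

/-- Slopes to one and the same ratio have equal keys. -/
theorem slopeKey_eq {k₁ k₂ k₃ : ℕ} (h₂ : slopeMod k₁ 2 k₂ ≠ 0) (h₃ : slopeMod k₁ 2 k₃ ≠ 0)
    (h : ∀ p ∈ relationExponents, slopeDiff (2 : ZMod 1009) k₁ 2 k₂ *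
        slopeDiff 2 k₁ (p.1 * p.2 ^ 3) k₃ = slopeDiff 2 k₁ (p.1 * p.2 ^ 3) k₂ *
        slopeDiff 2 k₁ 2 k₃) : slopeKey k₁ k₂ = slopeKey k₁ k₃ := by
  have hinv : ∀ k, slopeMod k₁ 2 k ≠ 0 → slopeDiff (2 : ZMod 1009) k₁ 2 k ^ 1007 *
      slopeDiff 2 k₁ 2 k = 1 := by
    intro k hk
    rw [← pow_succ]
    apply ZMod.pow_card_sub_one_eq_one (p := 1009)
    rw [← cast_slopeMod]
    exact fun h0 => hk (eq_zero_of_natCast_zmod (subMod_lt _ _) h0)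
  have h1 : (relationExponents.map fun p =>
      slopeMod k₁ (p.1 * p.2 ^ 3) k₂ * (slopeMod k₁ 2 k₂ ^ 1007 % 1009) % 1009) =
      relationExponents.map fun p =>
      slopeMod k₁ (p.1 * p.2 ^ 3) k₃ * (slopeMod k₁ 2 k₃ ^ 1007 % 1009) % 1009 := by
    refine List.map_congr_left fun p hp => ?_
    apply (ZMod.natCast_eq_natCast_iff _ _ 1009).1
    simp only [Nat.cast_mul, ZMod.natCast_mod, Nat.cast_pow, cast_slopeMod]
    have e₁ := hinv k₂ h₂
    have e₂ := hinv k₃ h₃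
    have e₃ := h p hp
    set a := slopeDiff (2 : ZMod 1009) k₁ 2 k₂
    set b := slopeDiff (2 : ZMod 1009) k₁ 2 k₃
    set i := a ^ 1007
    set j := b ^ 1007
    linear_combination slopeDiff 2 k₁ (p.1 * p.2 ^ 3) k₃ * j * e₁ - i * j * e₃ -
      i * slopeDiff 2 k₁ (p.1 * p.2 ^ 3) k₂ * e₂
  simp only [slopeKey, h1]

/-- Solutions with a given first exponent have equal slope keys at the other two, so they are among
the pairs that the search compares. -/
theorem orderTest_of_search {k₁ k₂ k₃ : ℕ} (hk₁ : k₁ ∣ 504) (hk₁' : k₁ < 252) (hk₂ : 0 < k₂)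
    (hlt : k₂ < k₃) (hk₃ : k₃ < 252) (h12 : k₂ ≠ k₁) (h13 : k₃ ≠ k₁)
    (h : ∀ p ∈ relationExponents, slopeDiff (2 : ZMod 1009) k₁ 2 k₂ *
        slopeDiff 2 k₁ (p.1 * p.2 ^ 3) k₃ = slopeDiff 2 k₁ (p.1 * p.2 ^ 3) k₂ *
        slopeDiff 2 k₁ 2 k₃) (ho : obstruction k₁ k₂ k₃ = false) :
    orderTest k₁ k₂ k₃ = true := by
  have hs := searchTest_of_mem_divisors (k := k₁) (by simp [hk₁, hk₁'])
  simp only [searchTest, Bool.and_eq_true, List.all_eq_true] at hs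
  obtain ⟨h1, h2⟩ := hs
  have h3 := pairwise_of_bucketTest h2
  rw [List.pairwise_map, List.pairwise_iff_getElem] at h3
  have h4 := h3 (k₂ - 1) (k₃ - 1) (by simp; omega) (by simp; omega) (by omega)
  have e₂ : 1 + 1 * (k₂ - 1) = k₂ := by omega
  have e₃ : 1 + 1 * (k₃ - 1) = k₃ := by omega
  simp only [List.getElem_range', e₂, e₃] at h4
  have hne : ∀ k, 0 < k → k < 252 → k ≠ k₁ → slopeMod k₁ 2 k ≠ 0 := by
    intro k hk hk' hne
    have := h1 k (by simp [List.mem_range']; exact ⟨k - 1, by omega, by omega⟩)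
    intro h0
    simp [hne, h0] at this
  have h5 := h4 (slopeKey_eq (hne k₂ hk₂ (by omega) h12) (hne k₃ (by omega) hk₃ h13) h)
  simpa [h12, h13, ho] using h5

/-- For a suitable primitive root `ζ'`, the exponent of a root of unity is a divisor of `N`. -/
theorem exists_primitiveRoot_pow_eq {L : Type*} [Field L] {N : ℕ} [NeZero N] {ζ : L}
    (hζ : IsPrimitiveRoot ζ N) {x : L} (hx : x ^ N = 1) :
    ∃ (ζ' : L) (k : ℕ), IsPrimitiveRoot ζ' N ∧ k ∣ N ∧ x = ζ' ^ k := by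
  have hN : N ≠ 0 := NeZero.ne N
  have hm : orderOf x ∣ N := orderOf_dvd_of_pow_eq_one hx
  obtain ⟨d, hd⟩ := hm
  have hm0 : orderOf x ≠ 0 := by rintro h0; rw [h0, zero_mul] at hd; exact hN hd
  have : NeZero (orderOf x) := ⟨hm0⟩
  have hy : IsPrimitiveRoot (ζ ^ d) (orderOf x) :=
    hζ.pow (Nat.pos_of_ne_zero hN) (hd.trans (mul_comm _ _))
  obtain ⟨i, -, hi, hix⟩ := (hy.isPrimitiveRoot_iff).1 (IsPrimitiveRoot.orderOf x)
  obtain ⟨v, hv⟩ := ZMod.unitsMap_surjective (Dvd.intro d hd.symm) (ZMod.unitOfCoprime i hi)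
  refine ⟨ζ ^ (v : ZMod N).val, d, hζ.pow_of_coprime _ (ZMod.val_coe_unit_coprime v),
    Dvd.intro_left _ hd.symm, ?_⟩
  rw [← hix, ← pow_mul, ← pow_mul, mul_comm _ d, pow_mul, pow_mul]
  apply pow_eq_pow_of_modEq _ hy.pow_eq_one
  rw [← ZMod.natCast_eq_natCast_iff]
  have := congrArg Units.val hv
  rw [ZMod.unitsMap_val, ZMod.coe_unitOfCoprime] at this
  rw [← this, ZMod.natCast_val]

theorem exists_orient_eq_pow {L : Type*} [Field L] {ζ : L} (hζ : IsPrimitiveRoot ζ 504) {x : L}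
    (hx : x ^ 504 = 1) (hx2 : x ^ 2 ≠ 1) :
    ∃ (b : Bool) (k : ℕ), 0 < k ∧ k < 252 ∧ orient b x = ζ ^ k := by
  obtain ⟨i, hi, rfl⟩ := hζ.eq_pow_of_pow_eq_one hx
  have h0 : i ≠ 0 := by rintro rfl; simp at hx2
  have h1 : i ≠ 252 := by
    rintro rfl
    rw [← pow_mul, hζ.pow_eq_one] at hx2
    exact hx2 rfl
  rcases lt_or_ge i 252 with h2 | h2
  · exact ⟨true, i, by omega, h2, by simp [orient]⟩
  · refine ⟨false, 504 - i, by omega, by omega, ?_⟩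
    simp only [orient, Bool.false_eq_true, if_false]
    apply inv_eq_of_mul_eq_one_left
    rw [← pow_add, Nat.sub_add_cancel hi.le, hζ.pow_eq_one]

theorem orient_pow_eq_one {L : Type*} [Field L] (b : Bool) (x : L) (k : ℕ) :
    orient b x ^ k = 1 ↔ x ^ k = 1 := by
  cases b <;> simp [orient]

namespace GaloisSolution

variable {L : Type*} [Field L] [Algebra ℚ L] {c x : Fin 3 → L} {q : Fin 3 → ℚ} {ζ : L}
  {k : Fin 3 → ℕ}

theorem orderTest_of_lt {N : ℕ} [NeZero N] [IsCyclotomicExtension {N} ℚ L]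
    (h : GaloisSolution c x q) (hN : 504 ∣ N) (hζ : IsPrimitiveRoot ζ 504)
    (hk : ∀ j, x j = ζ ^ k j) (hk₀ : k 0 ∣ 504) (hk' : ∀ j, 0 < k j ∧ k j < 252)
    (hlt : k 1 < k 2) : orderTest (k 0) (k 1) (k 2) = true := by
  have hinj : ∀ i j, i ≠ j → k i ≠ k j := fun i j hij he =>
    h.injective.ne hij (by rw [hk, hk, he])
  have hcop : ∀ p ∈ relationExponents, p.2.Coprime 504 ∧ (p.1 = 1 ∨ p.1 = 2) := by decide
  exact orderTest_of_search hk₀ (hk' 0).2 (hk' 1).1 hlt (hk' 2).2 (hinj 1 0 (by decide))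
    (hinj 2 0 (by decide)) (fun p hp => h.slopeDiff_mul_eq hN hζ hk (hcop p hp).1 (hcop p hp).2)
    (h.obstruction_eq_false hN hζ hk)

/-- Up to a change of the primitive root and inversion of the `x j`, the first exponent divides `504`
and all exponents are below `252`, which is the range of the search. -/
theorem order_eq {N : ℕ} [NeZero N] [IsCyclotomicExtension {N} ℚ L]
    (h : GaloisSolution c x q) (hN : 504 ∣ N) {n : ℕ} (hn : n ∣ N)
    (hx : ∀ k, (∀ j, x j ^ k = 1) ↔ n ∣ k) : n = 7 ∨ n = 14 ∨ n = 18 := by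
  have hx504 := (hx 504).2 (h.dvd_504 hn hx)
  obtain ⟨ζ₀, hζ₀⟩ : ∃ ζ₀ : L, IsPrimitiveRoot ζ₀ 504 := by
    obtain ⟨b, hb⟩ := hN
    exact ⟨_, (IsCyclotomicExtension.zeta_spec N ℚ L).pow (NeZero.pos N)
      (hb.trans (mul_comm _ _))⟩
  obtain ⟨ζ, k₀, hζ, hk₀, hxk₀⟩ := exists_primitiveRoot_pow_eq hζ₀ (hx504 0)
  have hk₀0 : 0 < k₀ := Nat.pos_of_dvd_of_pos hk₀ (by norm_num)
  have hk₀' : k₀ < 252 := by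
    obtain ⟨d, hd⟩ := hk₀
    have h2 := h.sq_ne_one 0
    rw [hxk₀, ← pow_mul] at h2
    by_contra! h3
    have : d = 1 ∨ d = 2 := by
      have : d ≠ 0 := by rintro rfl; omega
      have : d < 3 := by by_contra! h4; nlinarith
      omega
    apply h2
    rcases this with rfl | rfl
    · rw [hζ.pow_eq_one_iff_dvd]
      omega
    · rw [← hd, hζ.pow_eq_one]
  obtain ⟨b₁, k₁, hk₁, hk₁', h1⟩ := exists_orient_eq_pow hζ (hx504 1) (h.sq_ne_one 1)
  obtain ⟨b₂, k₂, hk₂, hk₂', h2⟩ := exists_orient_eq_pow hζ (hx504 2) (h.sq_ne_one 2)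
  set b : Fin 3 → Bool := ![true, b₁, b₂]
  set k : Fin 3 → ℕ := ![k₀, k₁, k₂]
  have h' := h.orient b
  have hk : ∀ j, _root_.orient (b j) (x j) = ζ ^ k j := by
    intro j
    fin_cases j
    · simpa [_root_.orient, b, k] using hxk₀
    · exact h1
    · exact h2
  have hkb : ∀ j, 0 < k j ∧ k j < 252 := by
    intro j
    fin_cases j
    · exact ⟨hk₀0, hk₀'⟩
    · exact ⟨hk₁, hk₁'⟩
    · exact ⟨hk₂, hk₂'⟩
  -- In both orders of the last two exponents, the search leaves three possible orders.
  have hord : orderTest k₀ k₁ k₂ = true ∨ orderTest k₀ k₂ k₁ = true := by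
    rcases lt_trichotomy k₁ k₂ with h3 | h3 | h3
    · exact Or.inl (h'.orderTest_of_lt hN hζ hk hk₀ hkb h3)
    · exact absurd (h'.injective (show _root_.orient (b 1) (x 1) = _root_.orient (b 2) (x 2) by
        rw [hk, hk]; exact congrArg _ h3)) (by decide)
    · have h4 := (h'.perm (Equiv.swap 1 2)).orderTest_of_lt hN hζ (k := k ∘ Equiv.swap 1 2)
        (fun j => hk _) (by simpa [k, Equiv.swap_apply_def] using hk₀) (fun j => hkb _)
        (by simpa [k] using h3)
      exact Or.inr (by simpa [k, Equiv.swap_apply_def] using h4)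
  have hgcd : ∀ m, n ∣ m ↔ 504 ∣ Nat.gcd (Nat.gcd k₀ k₁) (Nat.gcd k₂ 504) * m := by
    intro m
    rw [← hx]
    have : (∀ j, x j ^ m = 1) ↔ ∀ j, 504 ∣ k j * m := by
      refine forall_congr' fun j => ?_
      rw [← orient_pow_eq_one (b j), hk, ← pow_mul, hζ.pow_eq_one_iff_dvd]
    rw [this, ← Nat.gcd_mul_right, ← Nat.gcd_mul_right, ← Nat.gcd_mul_right, Nat.dvd_gcd_iff,
      Nat.dvd_gcd_iff, Nat.dvd_gcd_iff]
    simp only [Fin.forall_fin_succ, IsEmpty.forall_iff, and_true]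
    have h504 : 504 ∣ 504 * m := dvd_mul_right _ _
    constructor
    · rintro ⟨h3, h4, h5⟩
      exact ⟨⟨h3, h4⟩, h5, h504⟩
    · rintro ⟨⟨h3, h4⟩, h5, -⟩
      exact ⟨h3, h4, h5⟩
  set d := Nat.gcd (Nat.gcd k₀ k₁) (Nat.gcd k₂ 504) with hd
  have hd' : d = 72 ∨ d = 36 ∨ d = 28 := by
    rcases hord with h3 | h3
    · simpa [orderTest, ← hd, or_assoc] using h3
    · rw [orderTest, show Nat.gcd (Nat.gcd k₀ k₂) (Nat.gcd k₁ 504) = d by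
        rw [hd, Nat.gcd_assoc, Nat.gcd_assoc, Nat.gcd_left_comm k₂]] at h3
      simpa [or_assoc] using h3
  rcases hd' with h3 | h3 | h3 <;> rw [h3] at hgcd
  · have h4 := (hgcd 7).2 (by norm_num)
    have h5 := (hgcd n).1 dvd_rfl
    refine Or.inl (Nat.dvd_antisymm h4 (by omega))
  · have h4 := (hgcd 14).2 (by norm_num)
    have h5 := (hgcd n).1 dvd_rfl
    exact Or.inr (Or.inl (Nat.dvd_antisymm h4 (by omega)))
  · have h4 := (hgcd 18).2 (by norm_num)
    have h5 := (hgcd n).1 dvd_rfl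
    exact Or.inr (Or.inr (Nat.dvd_antisymm h4 (by omega)))

end GaloisSolution


/-! ### From admissible solutions to solutions over a cyclotomic field -/

/-- Dual bases of a Galois extension: a basis is orthogonal to the conjugates of its dual. -/
theorem sum_mul_algEquiv_eq_zero_of_trace_eq {K ι : Type*} [Field K] [Algebra ℚ K]
    [FiniteDimensional ℚ K] [IsGalois ℚ K] [Fintype ι] [DecidableEq ι] (b b' : ι → K)
    (hcard : Fintype.card ι = Module.finrank ℚ K)
    (htr : ∀ j k, Algebra.trace ℚ K (b j * b' k) = if j = k then 1 else 0) {g : K ≃ₐ[ℚ] K}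
    (hg : g ≠ 1) : ∑ j, b' j * g (b j) = 0 := by
  classical
  let C : Matrix ι (K ≃ₐ[ℚ] K) K := fun j g => g (b j)
  let H : Matrix (K ≃ₐ[ℚ] K) ι K := fun g j => g (b' j)
  have h1 : C * H = 1 := by
    ext j k
    have h2 := congrArg (algebraMap ℚ K) (htr j k)
    rw [trace_eq_sum_automorphisms] at h2
    simp only [map_mul] at h2
    rw [Matrix.mul_apply, h2, Matrix.one_apply]
    split_ifs <;> simp
  have h2 : H * C = 1 := (Matrix.mul_eq_one_comm_of_card_eq _ _ _ (by
    rw [hcard, ← Nat.card_eq_fintype_card, IsGalois.card_aut_eq_finrank])).1 h1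
  have h3 := congrFun (congrFun h2 1) g
  rw [Matrix.mul_apply, Matrix.one_apply_ne hg.symm] at h3
  exact h3

namespace IsAdmissible

variable {c : Fin 3 → ℝ} {x : Fin 3 → ℂ}

theorem ne_zero (h : IsAdmissible c x) (j : Fin 3) : x j ≠ 0 := by
  obtain ⟨m, hm, h1⟩ := h.rootOfUnity j
  rintro h0
  rw [h0, zero_pow hm.ne'] at h1
  exact zero_ne_one h1

theorem injective (h : IsAdmissible c x) : Function.Injective x := by
  have hd := h.distinct
  simp only [List.nodup_cons, List.mem_cons, not_or] at hd
  intro i j hij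
  fin_cases i <;> fin_cases j <;> simp at hij <;> simp_all

theorem mul_ne_one (h : IsAdmissible c x) {i j : Fin 3} (hij : i ≠ j) : x i * x j ≠ 1 := by
  have hd := h.distinct
  simp only [List.nodup_cons, List.mem_cons, not_or] at hd
  have key : ∀ i j : Fin 3, i < j → x i ≠ (x j)⁻¹ := by
    intro i j hij
    fin_cases i <;> fin_cases j <;> simp at hij <;> simp_all
  intro h0
  rcases lt_or_gt_of_ne hij with h1 | h1
  · exact key i j h1 (eq_inv_of_mul_eq_one_left h0)
  · exact key j i h1 (eq_inv_of_mul_eq_one_right h0)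

theorem sq_ne_one (h : IsAdmissible c x) (j : Fin 3) : x j ^ 2 ≠ 1 := by
  have hd := h.distinct
  simp only [List.nodup_cons, List.mem_cons, not_or] at hd
  intro h0
  rcases sq_eq_one_iff.1 h0 with h1 | h1 <;> fin_cases j <;> simp at h1 <;> simp_all

/-- The field generated by the roots of unity lies in a cyclotomic field; there the Galois group
permutes everything. -/
theorem exists_galoisSolution (h : IsAdmissible c x) :
    ∃ (N : ℕ) (_ : NeZero N) (L : IntermediateField ℚ ℂ) (_ : IsCyclotomicExtension {N} ℚ L)
      (c' x' : Fin 3 → L) (q : Fin 3 → ℚ), 504 ∣ N ∧ (∀ j, (c' j : ℂ) = c j) ∧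
      (∀ j, (x' j : ℂ) = x j) ∧ (∀ j, x j ^ N = 1) ∧ GaloisSolution c' x' q := by
  obtain ⟨hh, hpos, ⟨K, b, b', hb, hb', htr, hK⟩, hq⟩ := h.exists_heights
  choose m hm hxm using h.rootOfUnity
  set N := 504 * (m 0 * m 1 * m 2) with hN
  have hN0 : N ≠ 0 := by
    have := (hm 0).ne'; have := (hm 1).ne'; have := (hm 2).ne'
    positivity
  have hNZ : NeZero N := ⟨hN0⟩
  have hxN : ∀ j, x j ^ N = 1 := by
    intro j
    have : m j ∣ N := by
      fin_cases j
      · exact ⟨504 * (m 1 * m 2), by simp [hN]; ring⟩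
      · exact ⟨504 * (m 0 * m 2), by simp [hN]; ring⟩
      · exact ⟨504 * (m 0 * m 1), by simp [hN]; ring⟩
    obtain ⟨d, hd⟩ := this
    rw [hd, pow_mul, hxm, one_pow]
  have hζ := Complex.isPrimitiveRoot_exp N hN0
  set ζ := Complex.exp (2 * Real.pi * Complex.I / N)
  set L := IntermediateField.adjoin ℚ {ζ} with hL
  have hcyc : IsCyclotomicExtension {N} ℚ L := by
    change IsCyclotomicExtension {N} ℚ (IntermediateField.adjoin ℚ {ζ}).toSubalgebra
    rw [IntermediateField.adjoin_simple_toSubalgebra_of_isAlgebraic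
      ((hζ.isIntegral (Nat.pos_of_ne_zero hN0)).tower_top (A := ℚ)).isAlgebraic]
    exact hζ.adjoin_isCyclotomicExtension ℚ
  have hxL : ∀ j, x j ∈ L := by
    intro j
    obtain ⟨i, -, hi⟩ := hζ.eq_pow_of_pow_eq_one (hxN j)
    rw [← hi]
    exact pow_mem (IntermediateField.mem_adjoin_simple_self ℚ ζ) i
  have hKL : ∀ a ∈ K, (a : ℂ) ∈ L := fun a ha => by
    have : IntermediateField.adjoin ℚ (Set.range x) ≤ L := by
      rw [IntermediateField.adjoin_le_iff]
      rintro _ ⟨j, rfl⟩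
      exact hxL j
    exact this (hK a ha)
  let ψ : K →ₐ[ℚ] L := AlgHom.codRestrict ((IsScalarTower.toAlgHom ℚ ℝ ℂ).comp K.val)
    L.toSubalgebra fun a => hKL a a.2
  have hψ : ∀ a, ((ψ a : L) : ℂ) = ((a : ℝ) : ℂ) := fun a => rfl
  let _ : Algebra K L := ψ.toRingHom.toAlgebra
  have hmap : ∀ a, algebraMap K L a = ψ a := fun a => rfl
  have : IsScalarTower ℚ K L := IsScalarTower.of_algebraMap_eq' ψ.comp_algebraMap.symm
  have : FiniteDimensional ℚ K := b.finiteDimensional_of_finite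
  have hfin : Module.finrank ℚ K = 3 := by rw [Module.finrank_eq_card_basis b, Fintype.card_fin]
  have : IsAbelianGalois ℚ L := IsCyclotomicExtension.isAbelianGalois {N} ℚ L
  have : IsAbelianGalois ℚ K := IsAbelianGalois.tower_bot ℚ K L
  have hrestr : ∀ (σ : L ≃ₐ[ℚ] L) a, σ (ψ a) = ψ (σ.restrictNormal K a) := fun σ a =>
    (σ.restrictNormal_commutes K a).symm
  have hψc : ∀ j, ((ψ (b j) : L) : ℂ) = c j := fun j => by rw [hψ, hb]
  -- The rational numbers `q j` are the ratios of moduli.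
  choose r hr using fun j => hq j 0
  have hcpos := h.circumference_pos
  have hr0 : ∀ j, 0 < r j := fun j => by
    have : (0 : ℝ) < r j := by
      rw [← hr]
      exact div_pos (div_pos (hpos j) (hcpos j)) (div_pos (hpos 0) (hcpos 0))
    exact_mod_cast this
  have hhr : ∀ j, hh j = hh 0 / c 0 * (r j * c j) := fun j => by
    rw [← hr]
    have := (hcpos j).ne'
    have := (hcpos 0).ne'
    have := (hpos 0).ne'
    field_simp
  refine ⟨N, hNZ, L, hcyc, fun j => ψ (b j), fun j => ⟨x j, hxL j⟩, r, dvd_mul_right _ _, hψc,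
    fun j => rfl, hxN, ?_⟩
  constructor
  · apply Subtype.ext
    have := h.relation_one
    push_cast
    simpa only [hψc] using this
  · apply Subtype.ext
    have := h.relation_two
    push_cast
    simpa only [hψc] using this
  · intro g hg j
    have h1 : ψ (∑ j, g j • b j) = 0 := by
      rw [← hg, map_sum]
      refine Finset.sum_congr rfl fun j _ => ?_
      rw [Algebra.smul_def, map_mul, eq_ratCast, map_ratCast]
    rw [map_eq_zero] at h1
    exact Fintype.linearIndependent_iff.1 b.linearIndependent g h1 j
  · exact fun j h0 => h.ne_zero j (congrArg Subtype.val h0)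
  · exact fun j h0 => h.sq_ne_one j (congrArg Subtype.val h0)
  · exact fun i j h0 => h.injective (congrArg Subtype.val h0)
  · exact fun i j hij h0 => h.mul_ne_one hij (congrArg Subtype.val h0)
  · intro σ j
    rw [hrestr, hrestr, hrestr]
    set g := σ.restrictNormal K
    have h1 : g ^ 3 = 1 := by
      rw [← hfin, ← IsGalois.card_aut_eq_finrank ℚ K]
      exact pow_card_eq_one'
    have h2 : (g ^ 3) (b j) = b j := by rw [h1]; rfl
    exact congrArg ψ h2
  · exact hr0
  · rintro σ ⟨j, hj⟩
    have hg : σ.restrictNormal K ≠ 1 := by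
      rintro h1
      apply hj
      rw [hrestr, h1]
      rfl
    have h1 := sum_mul_algEquiv_eq_zero_of_trace_eq b b' (by rw [hfin, Fintype.card_fin]) htr hg
    have h2 := congrArg (fun a => ((ψ a : L) : ℂ)) h1
    simp only [map_sum, map_mul, ← hrestr, map_zero] at h2
    apply Subtype.ext
    push_cast at h2 ⊢
    have hne : ((hh 0 / c 0 : ℝ) : ℂ) ≠ 0 := by
      exact_mod_cast (div_pos (hpos 0) (hcpos 0)).ne'
    apply mul_left_cancel₀ hne
    rw [mul_zero, ← h2, Finset.mul_sum]
    refine Finset.sum_congr rfl fun j _ => ?_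
    rw [hψ (b' j), hb', hhr j, hψc]
    push_cast
    ring

end IsAdmissible


/-! ### Arithmetic in the three cubic fields -/

/-- The real number `2 cos (2 π / n)`. -/
noncomputable def cosGen (n : ℕ) : ℝ := 2 * Real.cos (2 * Real.pi / n)

/-- The coefficients of `t ^ 3` in terms of `1`, `t`, `t ^ 2`, for `t = cosGen n`, where `n` is `7`,
`14` or `18`. -/
def cubicRel (n : ℕ) : ℤ × ℤ × ℤ :=
  if n = 7 then (1, 2, -1) else if n = 14 then (-1, 2, 1) else (1, 3, 0)

/-- The integral part of `10 ^ 6 * cosGen n`. -/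
def cosGenBound (n : ℕ) : ℤ :=
  if n = 7 then 1246979 else if n = 14 then 1801937 else 1879385

theorem cosGen_gt_one {n : ℕ} (hn : 6 < n) : 1 < cosGen n := by
  have h : Real.cos (Real.pi / 3) < Real.cos (2 * Real.pi / n) := by
    have hπ := Real.pi_pos
    have hn' : (6 : ℝ) < n := by exact_mod_cast hn
    apply Real.cos_lt_cos_of_nonneg_of_le_pi
    · positivity
    · linarith
    · rw [div_lt_div_iff₀ (by linarith) (by norm_num)]
      nlinarith
  rw [Real.cos_pi_div_three] at h
  unfold cosGen
  linarith

theorem two_mul_cos_add_two_mul (θ : ℝ) (m : ℕ) : 2 * Real.cos ((m + 2 : ℕ) * θ) =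
    2 * Real.cos θ * (2 * Real.cos ((m + 1 : ℕ) * θ)) - 2 * Real.cos (m * θ) := by
  have h := Real.cos_add_cos (((m + 2 : ℕ) : ℝ) * θ) (m * θ)
  rw [show (((m + 2 : ℕ) : ℝ) * θ + m * θ) / 2 = (m + 1 : ℕ) * θ by push_cast; ring,
    show (((m + 2 : ℕ) : ℝ) * θ - m * θ) / 2 = θ by push_cast; ring] at h
  linarith

theorem cosGen_cube {n : ℕ} (hn : n = 7 ∨ n = 14 ∨ n = 18) : cosGen n ^ 3 =
    (cubicRel n).1 + (cubicRel n).2.1 * cosGen n + (cubicRel n).2.2 * cosGen n ^ 2 := by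
  have hgt : 1 < cosGen n := cosGen_gt_one (by omega)
  have r0 := two_mul_cos_add_two_mul (2 * Real.pi / n) 0
  have r1 := two_mul_cos_add_two_mul (2 * Real.pi / n) 1
  have r2 := two_mul_cos_add_two_mul (2 * Real.pi / n) 2
  simp only [zero_add, Nat.cast_zero, zero_mul, Real.cos_zero, Nat.cast_one, one_mul,
    Nat.reduceAdd] at r0 r1 r2
  unfold cosGen at hgt ⊢
  set t := 2 * Real.cos (2 * Real.pi / n) with ht
  rcases hn with rfl | rfl | rfl
  · have h : Real.cos ((4 : ℕ) * (2 * Real.pi / (7 : ℕ))) =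
        Real.cos ((3 : ℕ) * (2 * Real.pi / (7 : ℕ))) := by
      rw [← Real.cos_two_pi_sub]
      congr 1
      push_cast
      ring
    have h1 : (t - 2) * (t ^ 3 - (1 + 2 * t - t ^ 2)) = 0 := by
      linear_combination 2 * h - r2 - (t - 1) * r1 - (t ^ 2 - t - 1) * r0
    have h2 : t ≠ 2 := by
      intro h0
      have : Real.cos (2 * Real.pi / (7 : ℕ)) < 1 := by
        rw [← Real.cos_zero]
        have hπ := Real.pi_pos
        apply Real.cos_lt_cos_of_nonneg_of_le_pi le_rfl
        · push_cast; linarith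
        · positivity
      linarith
    have := (mul_eq_zero.1 h1).resolve_left (sub_ne_zero.2 h2)
    simp only [cubicRel, if_true]
    push_cast
    linarith
  · have h : Real.cos ((4 : ℕ) * (2 * Real.pi / (14 : ℕ))) =
        -Real.cos ((3 : ℕ) * (2 * Real.pi / (14 : ℕ))) := by
      rw [← Real.cos_pi_sub]
      congr 1
      push_cast
      ring
    have h1 : (t + 2) * (t ^ 3 - (-1 + 2 * t + t ^ 2)) = 0 := by
      linear_combination 2 * h - r2 - (t + 1) * r1 - (t ^ 2 + t - 1) * r0
    have := (mul_eq_zero.1 h1).resolve_left (by positivity)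
    simp [cubicRel]
    linarith
  · have h : Real.cos ((3 : ℕ) * (2 * Real.pi / (18 : ℕ))) = 1 / 2 := by
      rw [← Real.cos_pi_div_three]
      congr 1
      push_cast
      ring
    simp [cubicRel]
    linear_combination 2 * h - r1 - t * r0

theorem cosGen_bounds {n : ℕ} (hn : n = 7 ∨ n = 14 ∨ n = 18) :
    (cosGenBound n : ℝ) < 10 ^ 6 * cosGen n ∧ 10 ^ 6 * cosGen n < cosGenBound n + 1 := by
  have hgt : 1 < cosGen n := cosGen_gt_one (by omega)
  have h := cosGen_cube hn
  set t := cosGen n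
  rcases hn with rfl | rfl | rfl
  · simp only [cubicRel, cosGenBound, if_true] at h ⊢
    push_cast at h ⊢
    constructor
    · by_contra! h0
      nlinarith [mul_nonneg (sub_nonneg.2 h0) (sub_nonneg.2 hgt.le)]
    · by_contra! h0
      nlinarith [mul_nonneg (sub_nonneg.2 h0) (sub_nonneg.2 hgt.le)]
  · simp [cubicRel, cosGenBound] at h ⊢
    constructor
    · by_contra! h0
      nlinarith [mul_nonneg (sub_nonneg.2 h0) (sub_nonneg.2 hgt.le)]
    · by_contra! h0
      nlinarith [mul_nonneg (sub_nonneg.2 h0) (sub_nonneg.2 hgt.le)]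
  · simp [cubicRel, cosGenBound] at h ⊢
    constructor
    · by_contra! h0
      nlinarith [mul_nonneg (sub_nonneg.2 h0) (sub_nonneg.2 hgt.le)]
    · by_contra! h0
      nlinarith [mul_nonneg (sub_nonneg.2 h0) (sub_nonneg.2 hgt.le)]

/-- The number with coordinates `v` with respect to `1`, `t`, `t ^ 2`. -/
def cubicVal {R : Type*} [CommRing R] (t : R) (v : ℤ × ℤ × ℤ) : R :=
  v.1 + v.2.1 * t + v.2.2 * t ^ 2

/-- Multiplication of a coordinate vector by an integer. -/
def tripleSMul (m : ℤ) (v : ℤ × ℤ × ℤ) : ℤ × ℤ × ℤ := (m * v.1, m * v.2.1, m * v.2.2)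

/-- Multiplication of a coordinate vector by `t`, where `e` is the vector of `t ^ 3`. -/
def tripleMulGen (e v : ℤ × ℤ × ℤ) : ℤ × ℤ × ℤ :=
  (v.2.2 * e.1, v.1 + v.2.2 * e.2.1, v.2.1 + v.2.2 * e.2.2)

/-- Multiplication of coordinate vectors, where `e` is the vector of `t ^ 3`. -/
def tripleMul (e v w : ℤ × ℤ × ℤ) : ℤ × ℤ × ℤ :=
  tripleSMul v.1 w + tripleSMul v.2.1 (tripleMulGen e w) +
    tripleSMul v.2.2 (tripleMulGen e (tripleMulGen e w))

/-- The coordinates of `2 cos (2 π m / n)` and of its successor. -/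
def cosTriplePair (e : ℤ × ℤ × ℤ) : ℕ → (ℤ × ℤ × ℤ) × (ℤ × ℤ × ℤ)
  | 0 => ((2, 0, 0), (0, 1, 0))
  | m + 1 =>
    let p := cosTriplePair e m
    (p.2, tripleMulGen e p.2 - p.1)

/-- The coordinates of `2 cos (2 π m / n)`. -/
def cosTriple (n m : ℕ) : ℤ × ℤ × ℤ := (cosTriplePair (cubicRel n) (m % n)).1

/-- The coordinates of `8 sin θₖ sin θₗ (cos θₗ - cos θₖ)`, where `θₖ = 2 π k / n`. -/
def crossTriple (n k l : ℕ) : ℤ × ℤ × ℤ :=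
  tripleMul (cubicRel n) (cosTriple n (k + (n - 1) * l) - cosTriple n (k + l))
    (cosTriple n l - cosTriple n k)

section Val

variable {R : Type*} [CommRing R] (t : R)

theorem cubicVal_add (v w : ℤ × ℤ × ℤ) : cubicVal t (v + w) = cubicVal t v + cubicVal t w := by
  simp only [cubicVal, Prod.fst_add, Prod.snd_add]
  push_cast
  ring

theorem cubicVal_sub (v w : ℤ × ℤ × ℤ) : cubicVal t (v - w) = cubicVal t v - cubicVal t w := by
  simp only [cubicVal, Prod.fst_sub, Prod.snd_sub]
  push_cast
  ring

theorem cubicVal_smul (m : ℤ) (v : ℤ × ℤ × ℤ) :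
    cubicVal t (tripleSMul m v) = m * cubicVal t v := by
  simp only [cubicVal, tripleSMul]
  push_cast
  ring

variable {t} {e : ℤ × ℤ × ℤ}

theorem cubicVal_mulGen (he : t ^ 3 = cubicVal t e) (v : ℤ × ℤ × ℤ) :
    cubicVal t (tripleMulGen e v) = t * cubicVal t v := by
  simp only [cubicVal, tripleMulGen] at he ⊢
  push_cast
  linear_combination -(v.2.2 : R) * he

theorem cubicVal_mul (he : t ^ 3 = cubicVal t e) (v w : ℤ × ℤ × ℤ) :
    cubicVal t (tripleMul e v w) = cubicVal t v * cubicVal t w := by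
  rw [tripleMul, cubicVal_add, cubicVal_add, cubicVal_smul, cubicVal_smul, cubicVal_smul,
    cubicVal_mulGen he, cubicVal_mulGen he, cubicVal_mulGen he]
  conv_rhs => rw [cubicVal]
  ring

end Val

theorem cosGen_cube_eq_cubicVal {n : ℕ} (hn : n = 7 ∨ n = 14 ∨ n = 18) :
    cosGen n ^ 3 = cubicVal (cosGen n) (cubicRel n) := cosGen_cube hn

theorem cubicVal_cosTriple {n : ℕ} (hn : n = 7 ∨ n = 14 ∨ n = 18) (m : ℕ) :
    cubicVal (cosGen n) (cosTriple n m) = 2 * Real.cos (2 * Real.pi * m / n) := by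
  have hn0 : (n : ℝ) ≠ 0 := by
    have : n ≠ 0 := by omega
    exact_mod_cast this
  have key : ∀ m : ℕ, cubicVal (cosGen n) (cosTriplePair (cubicRel n) m).1 =
      2 * Real.cos (m * (2 * Real.pi / n)) ∧
      cubicVal (cosGen n) (cosTriplePair (cubicRel n) m).2 =
      2 * Real.cos ((m + 1 : ℕ) * (2 * Real.pi / n)) := by
    intro m
    induction m with
    | zero => simp [cosTriplePair, cubicVal, cosGen]
    | succ m ih =>
      refine ⟨ih.2, ?_⟩
      simp only [cosTriplePair]
      rw [cubicVal_sub, cubicVal_mulGen (cosGen_cube_eq_cubicVal hn), ih.1, ih.2,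
        two_mul_cos_add_two_mul, cosGen]
  rw [cosTriple, (key _).1]
  conv_rhs => rw [← Nat.mod_add_div m n]
  congr 1
  rw [← Real.cos_add_nat_mul_two_pi _ (m / n)]
  congr 1
  push_cast
  field_simp

theorem cubicVal_crossTriple {n : ℕ} (hn : n = 7 ∨ n = 14 ∨ n = 18) (k l : ℕ) :
    cubicVal (cosGen n) (crossTriple n k l) =
      8 * (Real.sin (2 * Real.pi * k / n) * Real.sin (2 * Real.pi * l / n) *
        (Real.cos (2 * Real.pi * l / n) - Real.cos (2 * Real.pi * k / n))) := by
  have hn1 : 1 ≤ n := by omega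
  have hn0 : (n : ℝ) ≠ 0 := by
    have : n ≠ 0 := by omega
    exact_mod_cast this
  rw [crossTriple, cubicVal_mul (cosGen_cube_eq_cubicVal hn), cubicVal_sub, cubicVal_sub,
    cubicVal_cosTriple hn, cubicVal_cosTriple hn, cubicVal_cosTriple hn, cubicVal_cosTriple hn]
  have h1 : Real.cos (2 * Real.pi * (k + (n - 1) * l : ℕ) / n) =
      Real.cos (2 * Real.pi * k / n - 2 * Real.pi * l / n) := by
    rw [← Real.cos_add_nat_mul_two_pi (2 * Real.pi * k / n - 2 * Real.pi * l / n) l]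
    congr 1
    push_cast [Nat.cast_sub hn1]
    field_simp
    ring
  have h2 : Real.cos (2 * Real.pi * (k + l : ℕ) / n) =
      Real.cos (2 * Real.pi * k / n + 2 * Real.pi * l / n) := by
    congr 1
    push_cast
    ring
  rw [h1, h2, Real.cos_sub, Real.cos_add]
  ring

theorem crossReal_eq {n : ℕ} (hn : n = 7 ∨ n = 14 ∨ n = 18) (k l : ℕ) :
    8 * crossReal 1 (k * (504 / n)) (l * (504 / n)) =
      cubicVal (cosGen n) (crossTriple n k l) := by
  have h : ∀ m : ℕ, 2 * Real.pi * (1 * (m * (504 / n)) : ℕ) / 504 = 2 * Real.pi * m / n := by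
    intro m
    rcases hn with rfl | rfl | rfl <;> push_cast <;> ring
  rw [crossReal, h, h, cubicVal_crossTriple hn]

/-- A lower bound for `10 ^ 12` times the number with coordinates `v`. -/
def tripleLower (n : ℕ) (v : ℤ × ℤ × ℤ) : ℤ :=
  v.1 * 10 ^ 12 +
    v.2.1 * (10 ^ 6 * if 0 ≤ v.2.1 then cosGenBound n else cosGenBound n + 1) +
    v.2.2 * (if 0 ≤ v.2.2 then cosGenBound n else cosGenBound n + 1) ^ 2

theorem tripleLower_le {n : ℕ} (hn : n = 7 ∨ n = 14 ∨ n = 18) (v : ℤ × ℤ × ℤ) :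
    (tripleLower n v : ℝ) ≤ 10 ^ 12 * cubicVal (cosGen n) v := by
  obtain ⟨h1, h2⟩ := cosGen_bounds hn
  have hgt : 1 < cosGen n := cosGen_gt_one (by omega)
  have hb : (0 : ℝ) ≤ cosGenBound n := by
    rcases hn with rfl | rfl | rfl <;> simp [cosGenBound]
  have e1 : (v.2.1 : ℝ) * ((if 0 ≤ v.2.1 then cosGenBound n else cosGenBound n + 1 : ℤ) : ℝ) ≤
      v.2.1 * (10 ^ 6 * cosGen n) := by
    split_ifs with h
    · exact mul_le_mul_of_nonneg_left h1.le (by exact_mod_cast h)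
    · push_cast
      exact mul_le_mul_of_nonpos_left h2.le (by exact_mod_cast (not_le.1 h).le)
  have e2 : (v.2.2 : ℝ) * ((if 0 ≤ v.2.2 then cosGenBound n else cosGenBound n + 1 : ℤ) : ℝ) ^ 2 ≤
      v.2.2 * (10 ^ 6 * cosGen n) ^ 2 := by
    split_ifs with h
    · exact mul_le_mul_of_nonneg_left (pow_le_pow_left₀ hb h1.le 2) (by exact_mod_cast h)
    · push_cast
      exact mul_le_mul_of_nonpos_left (pow_le_pow_left₀ (by positivity) h2.le 2)
        (by exact_mod_cast (not_le.1 h).le)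
  simp only [tripleLower, cubicVal]
  push_cast at e1 e2 ⊢
  linarith

/-- The coordinates of `n` times the four lengths, for circumferences with coordinates `v`. -/
def lengthTriples (n : ℕ) (m : Fin 3 → ℕ) (v : Fin 3 → ℤ × ℤ × ℤ) : Fin 4 → ℤ × ℤ × ℤ :=
  let s := tripleSMul (n - 2 * m 0) (v 0) + tripleSMul (n - 2 * m 1) (v 1) +
    tripleSMul (n - 2 * m 2) (v 2)
  ![s, tripleSMul n (v 0) - s, tripleSMul n (v 1 - v 0) + s, tripleSMul n (v 2 - v 1 + v 0) - s]

/-- The coordinates of the cross product that spans the solutions `c` of the two relations. -/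
def crossTriples (n : ℕ) (m : Fin 3 → ℕ) : Fin 3 → ℤ × ℤ × ℤ :=
  fun j => crossTriple n (m (j + 1)) (m (j + 2))


/-! ### Lengths of saddle connections -/

/-- One of the circumferences or lengths is not positive, if the circumferences are a multiple of
the cross product by a number of sign `ε`. -/
def lengthRefuted (n : ℕ) (m : Fin 3 → ℕ) (ε : ℤ) : Bool :=
  let v := crossTriples n m
  [v 0, v 1, v 2, lengthTriples n m v 0, lengthTriples n m v 1, lengthTriples n m v 2,
    lengthTriples n m v 3].any fun w => decide (0 ≤ tripleLower n (tripleSMul (-ε) w))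

/-- The coordinates of the cross product are not all of the same sign. -/
def signsDiffer (k₁ k₂ k₃ : ℕ) : Bool :=
  !(decide (signCross 1 k₂ k₃ = signCross 1 k₃ k₁) &&
    decide (signCross 1 k₂ k₃ = signCross 1 k₁ k₂) && decide (signCross 1 k₂ k₃ ≠ 0))

/-- Either the exponents do not define an admissible solution, or they are in the list. -/
def tripleTest (n m₁ m₂ m₃ : ℕ) : Bool :=
  !(Nat.gcd (Nat.gcd m₁ m₂) (Nat.gcd m₃ n) == 1) ||
    signsDiffer (m₁ * (504 / n)) (m₂ * (504 / n)) (m₃ * (504 / n)) ||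
    obstruction (m₁ * (504 / n)) (m₂ * (504 / n)) (m₃ * (504 / n)) ||
    (lengthRefuted n ![m₁, m₂, m₃] 1 && lengthRefuted n ![m₁, m₂, m₃] (-1)) ||
    decide ((m₁, m₂, m₃) ∈ exponentTriples n)

set_option maxRecDepth 10000 in
theorem tripleTest_eq_true {n : ℕ} (hn : n = 7 ∨ n = 14 ∨ n = 18) {m₁ m₂ m₃ : ℕ} (h₁ : m₁ < n)
    (h₂ : m₂ < n) (h₃ : m₃ < n) : tripleTest n m₁ m₂ m₃ = true := by
  have h : ∀ n ∈ [7, 14, 18], ((List.range n).all fun m₁ => (List.range n).all fun m₂ =>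
      (List.range n).all fun m₃ => tripleTest n m₁ m₂ m₃) = true := by decide +kernel
  have h' := h n (by simpa using hn)
  simp only [List.all_eq_true, List.mem_range] at h'
  exact h' m₁ h₁ m₂ h₂ m₃ h₃

/-- The contribution of one root of unity to the length `s`. -/
theorem sign_sub_div_eq {a : ℤ} {N n m : ℕ} (hN : 0 < N) (ha : -(N : ℤ) < a) (ha' : a < N)
    (hm : 0 < m) (hmn : m < n)
    (h : Complex.exp (2 * Real.pi * Complex.I * m / n) =
      Complex.exp (Real.pi * Complex.I * a / N)) :
    (a.sign : ℝ) - a / N = (n - 2 * m) / n := by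
  have hn0 : (0 : ℝ) < n := by exact_mod_cast hm.trans hmn
  have hN0 : (0 : ℝ) < N := by exact_mod_cast hN
  obtain ⟨k, hk⟩ := Complex.exp_eq_exp_iff_exists_int.1 h
  have hnC : (n : ℂ) ≠ 0 := by exact_mod_cast hn0.ne'
  have hNC : (N : ℂ) ≠ 0 := by exact_mod_cast hN0.ne'
  have h1 : (2 * m / n : ℝ) = a / N + 2 * k := by
    have h2 : (Real.pi * Complex.I : ℂ) * (2 * m / n) = (Real.pi * Complex.I) * (a / N + 2 * k) := by
      linear_combination hk
    have h3 := mul_left_cancel₀ (mul_ne_zero (by exact_mod_cast Real.pi_ne_zero) Complex.I_ne_zero) h2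
    apply Complex.ofReal_injective
    push_cast
    exact h3
  have b1 : (0 : ℝ) < 2 * m / n := by positivity
  have b2 : (2 * m / n : ℝ) < 2 := by
    rw [div_lt_iff₀ hn0]
    have : (m : ℝ) < n := by exact_mod_cast hmn
    linarith
  have b3 : (a / N : ℝ) < 1 := by rw [div_lt_one hN0]; exact_mod_cast ha'
  have b4 : (-1 : ℝ) < a / N := by rw [lt_div_iff₀ hN0, neg_one_mul]; exact_mod_cast ha
  have hk1 : -1 < k := by
    have : (-1 : ℝ) < 2 * k := by linarith
    have : (-1 : ℤ) < 2 * k := by exact_mod_cast this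
    omega
  have hk2 : k < 2 := by
    have : (2 * k : ℝ) < 3 := by linarith
    have : 2 * k < 3 := by exact_mod_cast this
    omega
  have h4 : ((n - 2 * m) / n : ℝ) = 1 - 2 * m / n := by field_simp
  rw [h4, h1]
  obtain rfl | rfl : k = 0 ∨ k = 1 := by omega
  · have : 0 < a := by
      have : (0 : ℝ) < a / N := by rw [h1] at b1; simpa using b1
      have := (div_pos_iff_of_pos_right hN0).1 this
      exact_mod_cast this
    rw [Int.sign_eq_one_of_pos this]
    push_cast
    ring
  · have : a < 0 := by
      by_contra! h0
      have : (0 : ℝ) ≤ a / N := div_nonneg (by exact_mod_cast h0) hN0.le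
      push_cast at h1
      linarith
    rw [Int.sign_eq_neg_one_of_neg this]
    push_cast
    ring

/-- `n` times the four lengths. -/
def scaledLength (n : ℕ) (m : Fin 3 → ℕ) (c : Fin 3 → ℝ) : Fin 4 → ℝ :=
  let s := (n - 2 * m 0) * c 0 + (n - 2 * m 1) * c 1 + (n - 2 * m 2) * c 2
  ![s, n * c 0 - s, n * (c 1 - c 0) + s, n * (c 2 - c 1 + c 0) - s]

/-- The lengths do not depend on how the `x j` are written as exponentials. -/
theorem hasPositiveLengths_iff {c : Fin 3 → ℝ} {n : ℕ} {m : Fin 3 → ℕ} (hm : ∀ j, 0 < m j)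
    (hmn : ∀ j, m j < n) (hm2 : ∀ j, 2 * m j ≠ n) :
    HasPositiveLengths c (fun j => Complex.exp (2 * Real.pi * Complex.I * m j / n)) ↔
      ∀ i, 0 < scaledLength n m c i := by
  have hn0 : (0 : ℝ) < n := by exact_mod_cast (hm 0).trans (hmn 0)
  have key : ∀ {N : ℕ} {a : Fin 3 → ℤ}, 0 < N → (∀ j, -(N : ℤ) < a j ∧ a j < (N : ℤ)) →
      (∀ j, Complex.exp (2 * Real.pi * Complex.I * m j / n) =
        Complex.exp (Real.pi * Complex.I * a j / N)) →
      n * saddleLength c N a =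
        (n - 2 * m 0) * c 0 + (n - 2 * m 1) * c 1 + (n - 2 * m 2) * c 2 := by
    intro N a hN ha hx
    simp only [saddleLength, Fin.sum_univ_three,
      sign_sub_div_eq hN (ha _).1 (ha _).2 (hm _) (hmn _) (hx _)]
    field_simp
  have hiff : ∀ {S : ℝ}, n * S = (n - 2 * m 0) * c 0 + (n - 2 * m 1) * c 1 + (n - 2 * m 2) * c 2 →
      ((0 < S ∧ 0 < c 0 - S ∧ 0 < c 1 - c 0 + S ∧ 0 < c 2 - c 1 + c 0 - S) ↔
        ∀ i, 0 < scaledLength n m c i) := by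
    intro S hS
    simp only [scaledLength, ← hS, Fin.forall_fin_succ, IsEmpty.forall_iff, and_true]
    refine and_congr ?_ (and_congr ?_ (and_congr ?_ ?_))
    · exact (mul_pos_iff_of_pos_left hn0).symm
    · change _ ↔ 0 < n * c 0 - n * S
      rw [← mul_sub, mul_pos_iff_of_pos_left hn0]
    · change _ ↔ 0 < n * (c 1 - c 0) + n * S
      rw [← mul_add, mul_pos_iff_of_pos_left hn0]
    · change _ ↔ 0 < n * (c 2 - c 1 + c 0) - n * S
      rw [← mul_sub, mul_pos_iff_of_pos_left hn0]
  constructor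
  · rintro ⟨N, a, hN, ha, hx, hpos⟩
    exact (hiff (key hN ha hx)).1 hpos
  · intro h
    have hN : 0 < n := (hm 0).trans (hmn 0)
    set a : Fin 3 → ℤ := fun j => if 2 * m j < n then 2 * m j else 2 * m j - 2 * n with ha
    have ha' : ∀ j, -(n : ℤ) < a j ∧ a j < (n : ℤ) := fun j => by
      have := hm j
      have := hmn j
      have := hm2 j
      simp only [ha]
      split_ifs <;> omega
    have hx : ∀ j, Complex.exp (2 * Real.pi * Complex.I * m j / n) =
        Complex.exp (Real.pi * Complex.I * a j / n) := fun j => by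
      have hnC : (n : ℂ) ≠ 0 := by exact_mod_cast hN.ne'
      simp only [ha]
      split_ifs
      · congr 1
        push_cast
        ring
      · rw [Complex.exp_eq_exp_iff_exists_int]
        refine ⟨1, ?_⟩
        push_cast
        field_simp
        ring
    exact ⟨n, a, hN, ha', hx, (hiff (key hN ha' hx)).2 h⟩

theorem scaledLength_cubicVal {n : ℕ} (m : Fin 3 → ℕ) (v : Fin 3 → ℤ × ℤ × ℤ) (l t : ℝ)
    (i : Fin 4) : scaledLength n m (fun j => l * cubicVal t (v j)) i =
      l * cubicVal t (lengthTriples n m v i) := by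
  fin_cases i <;>
    simp [scaledLength, lengthTriples, cubicVal_add, cubicVal_sub, cubicVal_smul] <;> ring

theorem not_pos_of_tripleLower {n : ℕ} (hn : n = 7 ∨ n = 14 ∨ n = 18) {ε : ℤ} {l : ℝ}
    (hl : 0 < ε * l) {v : ℤ × ℤ × ℤ} (h : 0 ≤ tripleLower n (tripleSMul (-ε) v)) :
    ¬ 0 < l * cubicVal (cosGen n) v := by
  intro h0
  have h1 := tripleLower_le hn (tripleSMul (-ε) v)
  rw [cubicVal_smul] at h1
  have h2 : (0 : ℝ) ≤ tripleLower n (tripleSMul (-ε) v) := by exact_mod_cast h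
  have h3 := mul_pos hl h0
  push_cast at h1
  have h4 : (ε : ℝ) * cubicVal (cosGen n) v ≤ 0 := by linarith
  nlinarith [mul_nonneg_of_nonpos_of_nonpos h4 (neg_nonpos.2 (sq_nonneg l))]

namespace IsAdmissible

variable {c : Fin 3 → ℝ} {x : Fin 3 → ℂ}

/-- The circumferences are a real multiple of the cross product. -/
theorem exists_eq_mul_crossTriples (h : IsAdmissible c x) {n : ℕ} (hn : n = 7 ∨ n = 14 ∨ n = 18)
    {m : Fin 3 → ℕ} (hx : ∀ j, x j = Complex.exp (2 * Real.pi * Complex.I * m j / n)) :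
    obstruction (m 0 * (504 / n)) (m 1 * (504 / n)) (m 2 * (504 / n)) = false ∧
      ∃ l : ℝ, ∀ j, c j = l * cubicVal (cosGen n) (crossTriples n m j) := by
  obtain ⟨N, hN0, L, hL, c', x', q, hN, hc', hx', -, hs⟩ := h.exists_galoisSolution
  set z := Complex.exp (2 * Real.pi * Complex.I / 504) with hz
  have hzp : IsPrimitiveRoot z 504 := by
    simpa only [Nat.cast_ofNat] using Complex.isPrimitiveRoot_exp 504 (by norm_num)
  have hzL : z ∈ L := by
    have h1 : IsPrimitiveRoot ((IsCyclotomicExtension.zeta N ℚ L : L) : ℂ) N :=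
      (IsCyclotomicExtension.zeta_spec N ℚ L).map_of_injective (f := L.val) L.val.injective
    obtain ⟨d, hd⟩ := hN
    obtain ⟨i, -, hi⟩ := h1.eq_pow_of_pow_eq_one (ξ := z) (by
      rw [hd, pow_mul, hzp.pow_eq_one, one_pow])
    rw [← hi]
    exact pow_mem (SetLike.coe_mem _) i
  set ζ : L := ⟨z, hzL⟩
  have hζz : (ζ : ℂ) = z := rfl
  have hζ : IsPrimitiveRoot ζ 504 :=
    IsPrimitiveRoot.of_map_of_injective (f := L.val) (by exact hzp) L.val.injective
  have hk : ∀ j, x' j = ζ ^ (m j * (504 / n)) := fun j => by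
    apply Subtype.ext
    rw [hx', hx]
    push_cast
    rw [hζz, hz, ← Complex.exp_nat_mul]
    congr 1
    rcases hn with rfl | rfl | rfl <;> push_cast <;> ring
  refine ⟨hs.obstruction_eq_false hN hζ (k := fun j => m j * (504 / n)) hk, ?_⟩
  obtain ⟨l, -, h0, h1, h2⟩ := hs.exists_eq_mul_crossDiff hζ.pow_eq_one
    (k := fun j => m j * (504 / n)) hk
  have hcr : ∀ i j : ℕ, ((crossDiff ζ 1 (i * (504 / n)) (j * (504 / n)) : L) : ℂ) =
      ((-cubicVal (cosGen n) (crossTriple n i j) : ℝ) : ℂ) := fun i j => by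
    have := map_crossDiff L.val ζ 1 (i * (504 / n)) (j * (504 / n))
    rw [IntermediateField.coe_val] at this
    rw [this, hζz, hz, crossDiff_exp, ← crossReal_eq hn]
    push_cast
    ring
  have key : ∀ {j : Fin 3} {i i' : ℕ}, c' j = l * crossDiff ζ 1 (i * (504 / n)) (i' * (504 / n)) →
      c j = -(l : ℂ).re * cubicVal (cosGen n) (crossTriple n i i') := by
    intro j i i' hj
    have h3 := congrArg (fun a : L => ((a : ℂ)).re) hj
    simp only [hc', MulMemClass.coe_mul, hcr, Complex.re_mul_ofReal, Complex.ofReal_re] at h3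
    linarith
  refine ⟨-(l : ℂ).re, fun j => ?_⟩
  fin_cases j
  · exact key h0
  · exact key h1
  · exact key h2

/-- The exponents of an admissible solution are in the list. -/
theorem mem_exponentTriples (h : IsAdmissible c x) {n : ℕ} (hn : n = 7 ∨ n = 14 ∨ n = 18)
    {m : Fin 3 → ℕ} (hmn : ∀ j, m j < n)
    (hx : ∀ j, x j = Complex.exp (2 * Real.pi * Complex.I * m j / n))
    (hgcd : Nat.gcd (Nat.gcd (m 0) (m 1)) (Nat.gcd (m 2) n) = 1) :
    (m 0, m 1, m 2) ∈ exponentTriples n := by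
  obtain ⟨hob, l, hl⟩ := h.exists_eq_mul_crossTriples hn hx
  have hn0 : (n : ℂ) ≠ 0 := by
    have : n ≠ 0 := by omega
    exact_mod_cast this
  have hm : ∀ j, 0 < m j := fun j => by
    apply Nat.pos_of_ne_zero
    intro h0
    apply h.sq_ne_one j
    rw [hx, h0]
    simp
  have hm2 : ∀ j, 2 * m j ≠ n := fun j h0 => by
    apply h.sq_ne_one j
    rw [hx, ← Complex.exp_nat_mul, Complex.exp_eq_one_iff]
    refine ⟨1, ?_⟩
    rw [← h0] at hn0 ⊢
    push_cast at hn0 ⊢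
    have := right_ne_zero_of_mul hn0
    field_simp
  have hcpos := h.circumference_pos
  have hlen := h.positiveLengths
  rw [show x = fun j => Complex.exp (2 * Real.pi * Complex.I * m j / n) from funext hx,
    hasPositiveLengths_iff hm hmn hm2, funext hl] at hlen
  simp only [scaledLength_cubicVal] at hlen
  simp only [hl] at hcpos
  have hnot : ∀ ε : ℤ, 0 < ε * l → lengthRefuted n m ε = false := by
    intro ε hε
    simp only [lengthRefuted, List.any_eq_false, decide_eq_true_eq]
    intro v hv h0
    apply not_pos_of_tripleLower hn hε h0
    simp only [List.mem_cons, List.not_mem_nil, or_false] at hv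
    rcases hv with rfl | rfl | rfl | rfl | rfl | rfl | rfl
    · exact hcpos 0
    · exact hcpos 1
    · exact hcpos 2
    · exact hlen 0
    · exact hlen 1
    · exact hlen 2
    · exact hlen 3
  have hl0 : l ≠ 0 := by
    rintro rfl
    have := hcpos 0
    simp at this
  have hnot' : (lengthRefuted n m 1 && lengthRefuted n m (-1)) = false := by
    rw [Bool.and_eq_false_iff]
    rcases lt_or_gt_of_ne hl0 with h1 | h1
    · exact Or.inr (hnot _ (by push_cast; linarith))
    · exact Or.inl (hnot _ (by push_cast; linarith))
  have hsign : ∀ j, SignType.sign (cubicVal (cosGen n) (crossTriples n m j)) = SignType.sign l := by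
    intro j
    rcases lt_or_gt_of_ne hl0 with h1 | h1
    · rw [sign_neg h1, sign_neg]
      by_contra! h2
      exact absurd (hcpos j) (not_lt.2 (mul_nonpos_of_nonpos_of_nonneg h1.le h2))
    · rw [sign_pos h1, sign_pos ((mul_pos_iff_of_pos_left h1).1 (hcpos j))]
  have hsign' : ∀ i j : ℕ, signCross 1 (i * (504 / n)) (j * (504 / n)) =
      SignType.sign (cubicVal (cosGen n) (crossTriple n i j)) := fun i j => by
    rw [← sign_crossReal, ← crossReal_eq hn, sign_mul, sign_pos (by norm_num : (0 : ℝ) < 8), one_mul]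
  have hsd : signsDiffer (m 0 * (504 / n)) (m 1 * (504 / n)) (m 2 * (504 / n)) = false := by
    have e0 := hsign 0
    have e1 := hsign 1
    have e2 := hsign 2
    change SignType.sign (cubicVal (cosGen n) (crossTriple n (m 1) (m 2))) = _ at e0
    change SignType.sign (cubicVal (cosGen n) (crossTriple n (m 2) (m 0))) = _ at e1
    change SignType.sign (cubicVal (cosGen n) (crossTriple n (m 0) (m 1))) = _ at e2
    have e3 : SignType.sign l ≠ 0 := by simpa using hl0
    simp [signsDiffer, hsign', e0, e1, e2, e3]
  have ht := tripleTest_eq_true hn (hmn 0) (hmn 1) (hmn 2)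
  have hm3 : ![m 0, m 1, m 2] = m := by
    ext j
    fin_cases j <;> rfl
  simpa [tripleTest, hm3, hob, hsd, hgcd, hnot'] using ht

end IsAdmissible


/-! ### The number field generated by the circumferences -/

section Cubic

open Polynomial

/-- The monic cubic polynomial with coefficients `1`, `a`, `b`, `c`. -/
noncomputable def monicCubic {R : Type*} [Semiring R] (a b c : R) : R[X] :=
  C 1 * X ^ 3 + C a * X ^ 2 + C b * X + C c

theorem monicCubic_monic {R : Type*} [Semiring R] [Nontrivial R] (a b c : R) :
    (monicCubic a b c).Monic := leadingCoeff_cubic one_ne_zero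

theorem natDegree_monicCubic {R : Type*} [Semiring R] [Nontrivial R] (a b c : R) :
    (monicCubic a b c).natDegree = 3 := natDegree_cubic one_ne_zero

theorem coeff_two_monicCubic {R : Type*} [Semiring R] (a b c : R) :
    (monicCubic a b c).coeff 2 = a := by simp [monicCubic]

/-- Reduction modulo `2` shows irreducibility. -/
theorem irreducible_monicCubic {a b c : ℤ} (hab : Odd (a + b)) (hc : Odd c) :
    Irreducible (monicCubic (a : ℚ) b c) := by
  have h2 : Irreducible ((monicCubic a b c).map (Int.castRingHom (ZMod 2))) := by
    have hm : (monicCubic a b c).map (Int.castRingHom (ZMod 2)) =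
        monicCubic (a : ZMod 2) (b : ZMod 2) (c : ZMod 2) := by simp [monicCubic]
    have ha' : (a : ZMod 2) + b = 1 := by
      have := ZMod.intCast_eq_one_iff_odd.2 hab
      push_cast at this
      exact this
    have hc' : (c : ZMod 2) = 1 := ZMod.intCast_eq_one_iff_odd.2 hc
    rw [hm, (monicCubic_monic _ _ _).irreducible_iff_roots_eq_zero_of_degree_le_three
      (by rw [natDegree_monicCubic]; norm_num) (by rw [natDegree_monicCubic])]
    apply Multiset.eq_zero_of_forall_notMem
    intro y hy
    have hy' := (mem_roots'.1 hy).2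
    simp only [monicCubic, IsRoot.def, eval_add, eval_mul, eval_C, eval_pow, eval_X, hc'] at hy'
    have h01 : ∀ y : ZMod 2, y = 0 ∨ y = 1 := by decide
    rcases h01 y with rfl | rfl
    · simp at hy'
    · have h3 : (1 : ZMod 2) = 0 := by
        rw [← hy']
        have h4 : (1 + 1 : ZMod 2) = 0 := by decide
        linear_combination -ha' - h4
      exact one_ne_zero h3
  have h3 := (monicCubic_monic a b c).irreducible_of_irreducible_map _ _ h2
  have h4 := (IsPrimitive.Int.irreducible_iff_irreducible_map_cast
    (monicCubic_monic a b c).isPrimitive).1 h3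
  simpa [monicCubic] using h4

variable {K : Type*} [Field K] [Algebra ℚ K] {a b c : ℤ} {y : K}

theorem minpoly_eq_monicCubic (hab : Odd (a + b)) (hc : Odd c)
    (h : y ^ 3 + a * y ^ 2 + b * y + c = 0) : minpoly ℚ y = monicCubic (a : ℚ) b c := by
  symm
  apply minpoly.eq_of_irreducible_of_monic (irreducible_monicCubic hab hc) _ (monicCubic_monic _ _ _)
  simpa [monicCubic] using h

theorem finrank_adjoin_of_cubic (hab : Odd (a + b)) (hc : Odd c)
    (h : y ^ 3 + a * y ^ 2 + b * y + c = 0) :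
    Module.finrank ℚ (IntermediateField.adjoin ℚ {y}) = 3 := by
  have h1 := minpoly_eq_monicCubic hab hc h
  have h2 : IsIntegral ℚ y := by
    by_contra h3
    rw [minpoly.eq_zero h3] at h1
    exact (monicCubic_monic (a : ℚ) b c).ne_zero h1.symm
  rw [IntermediateField.adjoin.finrank h2, h1, natDegree_monicCubic]

theorem trace_of_cubic [FiniteDimensional ℚ K] (hK : Module.finrank ℚ K = 3) (hab : Odd (a + b))
    (hc : Odd c) (h : y ^ 3 + a * y ^ 2 + b * y + c = 0) : Algebra.trace ℚ K y = -a := by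
  have h1 := Module.finrank_mul_finrank ℚ (IntermediateField.adjoin ℚ {y}) K
  rw [finrank_adjoin_of_cubic hab hc h, hK] at h1
  rw [trace_eq_finrank_mul_minpoly_nextCoeff, minpoly_eq_monicCubic hab hc h,
    nextCoeff_of_natDegree_pos (by rw [natDegree_monicCubic]; norm_num), natDegree_monicCubic,
    show Module.finrank (IntermediateField.adjoin ℚ {y}) K = 1 by omega]
  simp [coeff_two_monicCubic]

end Cubic

theorem cosGen_cubic {n : ℕ} (hn : n = 7 ∨ n = 14 ∨ n = 18) :
    Odd (-(cubicRel n).2.2 + -(cubicRel n).2.1) ∧ Odd (-(cubicRel n).1) ∧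
    cosGen n ^ 3 + (-(cubicRel n).2.2 : ℤ) * cosGen n ^ 2 + (-(cubicRel n).2.1 : ℤ) * cosGen n +
      (-(cubicRel n).1 : ℤ) = 0 := by
  refine ⟨?_, ?_, ?_⟩
  · rcases hn with rfl | rfl | rfl <;> decide
  · rcases hn with rfl | rfl | rfl <;> decide
  · push_cast
    linear_combination cosGen_cube hn

theorem finrank_adjoin_cosGen {n : ℕ} (hn : n = 7 ∨ n = 14 ∨ n = 18) :
    Module.finrank ℚ (IntermediateField.adjoin ℚ {cosGen n}) = 3 :=
  finrank_adjoin_of_cubic (cosGen_cubic hn).1 (cosGen_cubic hn).2.1 (cosGen_cubic hn).2.2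

theorem cubicVal_mem_adjoin (t : ℝ) (v : ℤ × ℤ × ℤ) :
    cubicVal t v ∈ IntermediateField.adjoin ℚ {t} := by
  have h := IntermediateField.mem_adjoin_simple_self ℚ t
  exact add_mem (add_mem (intCast_mem _ _) (mul_mem (intCast_mem _ _) h))
    (mul_mem (intCast_mem _ _) (pow_mem h 2))

theorem adjoin_two_mul (t : ℝ) :
    IntermediateField.adjoin ℚ {2 * t} = IntermediateField.adjoin ℚ {t} := by
  apply le_antisymm <;> rw [IntermediateField.adjoin_simple_le_iff]
  · have h2 : (2 : ℝ) ∈ IntermediateField.adjoin ℚ {t} := by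
      exact_mod_cast natCast_mem (IntermediateField.adjoin ℚ {t}) 2
    exact mul_mem h2 (IntermediateField.mem_adjoin_simple_self ℚ t)
  · have h := mul_mem (IntermediateField.mem_adjoin_simple_self ℚ (2 * t))
      (inv_mem (natCast_mem (IntermediateField.adjoin ℚ {2 * t}) 2))
    convert h using 1
    push_cast
    ring

theorem adjoin_cosGen_fourteen : IntermediateField.adjoin ℚ {cosGen 14} =
    IntermediateField.adjoin ℚ {Real.cos (Real.pi / 7)} := by
  rw [cosGen, adjoin_two_mul]
  congr 3
  push_cast
  ring

theorem adjoin_cosGen_eighteen : IntermediateField.adjoin ℚ {cosGen 18} =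
    IntermediateField.adjoin ℚ {Real.cos (Real.pi / 9)} := by
  rw [cosGen, adjoin_two_mul]
  congr 3
  push_cast
  ring

theorem adjoin_cosGen_seven : IntermediateField.adjoin ℚ {cosGen 7} =
    IntermediateField.adjoin ℚ {Real.cos (Real.pi / 7)} := by
  rw [← adjoin_cosGen_fourteen]
  have := finrank_adjoin_cosGen (n := 14) (by norm_num)
  have hfd : FiniteDimensional ℚ (IntermediateField.adjoin ℚ {cosGen 14}) :=
    Module.finite_of_finrank_pos (by omega)
  apply IntermediateField.eq_of_le_of_finrank_eq
  · rw [IntermediateField.adjoin_simple_le_iff]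
    have h : cosGen 7 = cubicVal (cosGen 14) (-2, 0, 1) := by
      simp only [cosGen, cubicVal]
      rw [show (2 * Real.pi / (7 : ℕ) : ℝ) = 2 * (2 * Real.pi / (14 : ℕ)) by push_cast; ring,
        Real.cos_two_mul]
      push_cast
      ring
    rw [h]
    exact cubicVal_mem_adjoin _ _
  · rw [this, finrank_adjoin_cosGen (by norm_num)]

/-- A cubic subfield is generated by any of its irrational elements. -/
theorem adjoin_eq_of_finrank_eq_three {F : IntermediateField ℚ ℝ} (hF : Module.finrank ℚ F = 3)
    {y : ℝ} (hy : y ∈ F) (hirr : ∀ r : ℚ, y ≠ r) : IntermediateField.adjoin ℚ {y} = F := by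
  have hfd : FiniteDimensional ℚ F := Module.finite_of_finrank_pos (by omega)
  have hle : IntermediateField.adjoin ℚ {y} ≤ F := by
    rwa [IntermediateField.adjoin_simple_le_iff]
  have h1 : Module.finrank ℚ (IntermediateField.adjoin ℚ {y}) ∣ 3 := by
    rw [← hF]
    exact IntermediateField.finrank_dvd_of_le_right hle
  rcases (Nat.dvd_prime Nat.prime_three).1 h1 with h2 | h2
  · rw [IntermediateField.finrank_adjoin_simple_eq_one_iff, IntermediateField.mem_bot] at h2
    obtain ⟨r, hr⟩ := h2
    exact absurd hr.symm (hirr r)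
  · exact IntermediateField.eq_of_le_of_finrank_eq hle (by rw [h2, hF])

namespace IsAdmissible

variable {c : Fin 3 → ℝ} {x : Fin 3 → ℂ}

/-- The field generated by the circumferences is the field of which they are a basis. -/
theorem finrank_adjoin_range (h : IsAdmissible c x) :
    Module.finrank ℚ (IntermediateField.adjoin ℚ (Set.range c)) = 3 := by
  obtain ⟨_, _, ⟨K, b, b', hb, -, -, -⟩, -⟩ := h.exists_heights
  have : IntermediateField.adjoin ℚ (Set.range c) = K := by
    apply le_antisymm
    · rw [IntermediateField.adjoin_le_iff]
      rintro _ ⟨j, rfl⟩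
      rw [← hb]
      exact (b j).2
    · intro a ha
      have h1 := congrArg (fun y : K => (y : ℝ)) (b.sum_repr ⟨a, ha⟩)
      simp only [AddSubmonoidClass.coe_finsetSum] at h1
      rw [← h1]
      refine sum_mem fun j _ => ?_
      rw [IntermediateField.coe_smul, hb]
      exact IntermediateField.smul_mem _ (IntermediateField.subset_adjoin ℚ (Set.range c) ⟨j, rfl⟩)
  rw [this, Module.finrank_eq_card_basis b, Fintype.card_fin]

theorem ne_ratCast_mul (h : IsAdmissible c x) (r : ℚ) : c 1 ≠ r * c 0 := by
  obtain ⟨_, _, L, _, c', x', q, -, hc', -, -, hs⟩ := h.exists_galoisSolution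
  intro h0
  apply hs.coeff_ne (i := 1) (j := 0) (by decide) r
  apply Subtype.ext
  push_cast
  rw [hc', hc', h0]
  push_cast
  rfl

theorem order_eq (h : IsAdmissible c x) {n : ℕ} (hx : ∀ k, (∀ j, x j ^ k = 1) ↔ n ∣ k) :
    n = 7 ∨ n = 14 ∨ n = 18 := by
  obtain ⟨N, _, L, _, c', x', q, hN, -, hx', hxN, hs⟩ := h.exists_galoisSolution
  refine hs.order_eq hN ((hx N).1 hxN) fun k => ?_
  rw [← hx]
  refine forall_congr' fun j => ?_
  rw [← hx', Subtype.ext_iff]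
  push_cast
  rfl

theorem adjoin_range_eq (h : IsAdmissible c x) {n : ℕ} (hn : n = 7 ∨ n = 14 ∨ n = 18)
    (hx : ∀ j, x j ^ n = 1) :
    IntermediateField.adjoin ℚ (Set.range c) = IntermediateField.adjoin ℚ {cosGen n} := by
  have hn0 : n ≠ 0 := by omega
  have hζ := Complex.isPrimitiveRoot_exp n hn0
  have hex : ∀ j, ∃ m : ℕ, x j = Complex.exp (2 * Real.pi * Complex.I * m / n) := fun j => by
    have : NeZero n := ⟨hn0⟩
    obtain ⟨m, -, hm⟩ := hζ.eq_pow_of_pow_eq_one (hx j)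
    refine ⟨m, ?_⟩
    rw [← hm, ← Complex.exp_nat_mul]
    congr 1
    ring
  choose m hm using hex
  obtain ⟨-, l, hl⟩ := h.exists_eq_mul_crossTriples hn hm
  have hpos := h.circumference_pos
  have h0 := (hpos 0).ne'
  have hratio : c 1 / c 0 = cubicVal (cosGen n) (crossTriples n m 1) /
      cubicVal (cosGen n) (crossTriples n m 0) := by
    rw [hl 1, hl 0]
    rw [hl] at h0
    exact mul_div_mul_left _ _ (left_ne_zero_of_mul h0)
  have hirr : ∀ r : ℚ, c 1 / c 0 ≠ r := fun r hr => h.ne_ratCast_mul r (by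
    rw [← hr]
    field_simp)
  rw [← adjoin_eq_of_finrank_eq_three h.finrank_adjoin_range (y := c 1 / c 0)
    (div_mem (IntermediateField.subset_adjoin _ _ ⟨1, rfl⟩)
      (IntermediateField.subset_adjoin _ _ ⟨0, rfl⟩)) hirr]
  refine adjoin_eq_of_finrank_eq_three (finrank_adjoin_cosGen hn) ?_ hirr
  rw [hratio]
  exact div_mem (cubicVal_mem_adjoin _ _) (cubicVal_mem_adjoin _ _)

end IsAdmissible


/-! ### Construction of admissible solutions -/

/-- The trace of the number with coordinates `v`, where `e` is the vector of `t ^ 3`. -/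
def tripleTrace (e v : ℤ × ℤ × ℤ) : ℤ :=
  3 * v.1 + e.2.2 * v.2.1 + (e.2.2 ^ 2 + 2 * e.2.1) * v.2.2

/-- The image of a coordinate vector under `2 cos (2 π / n) ↦ 2 cos (2 π u / n)`. -/
def tripleConj (n u : ℕ) (v : ℤ × ℤ × ℤ) : ℤ × ℤ × ℤ :=
  let s := cosTriple n u
  (v.1, 0, 0) + tripleSMul v.2.1 s + tripleSMul v.2.2 (tripleMul (cubicRel n) s s)

/-- The sum of the squares of the coordinates of the cross product with weights `w`. -/
def weightedSquare (n : ℕ) (m w : Fin 3 → ℕ) : ℤ × ℤ × ℤ :=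
  let v := crossTriples n m
  tripleSMul (w 0) (tripleMul (cubicRel n) (v 0) (v 0)) +
    tripleSMul (w 1) (tripleMul (cubicRel n) (v 1) (v 1)) +
    tripleSMul (w 2) (tripleMul (cubicRel n) (v 2) (v 2))

/-- The product of the two proper conjugates of `weightedSquare n m w`: its inverse, up to the
norm. -/
def weightedAdjoint (n : ℕ) (m w : Fin 3 → ℕ) : ℤ × ℤ × ℤ :=
  let u := if n = 18 then 5 else 3
  let a := tripleConj n u (weightedSquare n m w)
  tripleMul (cubicRel n) a (tripleConj n u a)

/-- The norm of `weightedSquare n m w`; being a rational integer, it is given by its first coordinate. -/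
def weightedNorm (n : ℕ) (m w : Fin 3 → ℕ) : ℤ :=
  (tripleMul (cubicRel n) (weightedSquare n m w) (weightedAdjoint n m w)).1

/-- The exponents `m`, the weights `w` and the sign `ε` define an admissible solution: the
circumferences are `ε` times the cross product, the heights are proportional to their products
with the weights, and the last two conditions say that these bases are dual up to a factor. -/
def solutionTest (n : ℕ) (m w : Fin 3 → ℕ) (ε : ℤ) : Bool :=
  let v := crossTriples n m
  let a := weightedAdjoint n m w
  (decide (∀ j, 0 < tripleLower n (tripleSMul ε (v j))) &&
    decide (∀ i, 0 < tripleLower n (tripleSMul ε (lengthTriples n m v i)))) &&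
  (decide (∀ j, 0 < w j ∧ 0 < m j ∧ m j < n ∧ 2 * m j ≠ n) &&
    decide (∀ i j, i ≠ j → m i ≠ m j ∧ m i + m j ≠ n)) &&
  (decide (ε ^ 2 = 1 ∧ weightedNorm n m w ≠ 0 ∧
      tripleMul (cubicRel n) (weightedSquare n m w) a = (weightedNorm n m w, 0, 0)) &&
    decide (∀ j k, tripleTrace (cubicRel n) (tripleMul (cubicRel n) (v j)
      (tripleSMul (w k) (tripleMul (cubicRel n) (v k) a))) =
        if j = k then weightedNorm n m w else 0))

/-- Weights proportional to the moduli that occur. -/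
def weightList : List (Fin 3 → ℕ) :=
  [![1, 1, 1], ![1, 2, 6], ![1, 6, 2], ![2, 1, 6], ![2, 6, 1], ![6, 1, 2], ![6, 2, 1],
    ![2, 3, 6], ![2, 6, 3], ![3, 2, 6], ![3, 6, 2], ![6, 2, 3], ![6, 3, 2]]

set_option maxRecDepth 10000 in
theorem solutionTest_of_mem {n : ℕ} (hn : n = 7 ∨ n = 14 ∨ n = 18) {m : Fin 3 → ℕ}
    (hm : (m 0, m 1, m 2) ∈ exponentTriples n) :
    ∃ (w : Fin 3 → ℕ) (ε : ℤ), solutionTest n m w ε = true := by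
  have h : ∀ n ∈ [7, 14, 18], ((exponentTriples n).all fun p => weightList.any fun w =>
      [1, -1].any fun ε => solutionTest n ![p.1, p.2.1, p.2.2] w ε) = true := by
    decide +kernel
  have h' := List.all_eq_true.1 (h n (by simpa using hn)) _ hm
  have hm3 : ![m 0, m 1, m 2] = m := by
    ext j
    fin_cases j <;> rfl
  simp only [List.any_eq_true, hm3] at h'
  obtain ⟨w, -, ε, -, h1⟩ := h'
  exact ⟨w, ε, h1⟩


theorem pos_of_tripleLower {n : ℕ} (hn : n = 7 ∨ n = 14 ∨ n = 18) {v : ℤ × ℤ × ℤ}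
    (h : 0 < tripleLower n v) : 0 < cubicVal (cosGen n) v := by
  have h1 := tripleLower_le hn v
  have h2 : (0 : ℝ) < tripleLower n v := by exact_mod_cast h
  linarith

/-- The parity conditions make the cubic polynomial of `t` irreducible modulo `2`. -/
theorem trace_cubicVal {K : Type*} [Field K] [Algebra ℚ K] [FiniteDimensional ℚ K]
    (hK : Module.finrank ℚ K = 3) {e : ℤ × ℤ × ℤ} {t : K} (h : t ^ 3 = cubicVal t e)
    (he : Odd (e.2.1 + e.2.2)) (he' : Odd e.1) (v : ℤ × ℤ × ℤ) :
    Algebra.trace ℚ K (cubicVal t v) = tripleTrace e v := by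
  simp only [cubicVal] at h
  have t1 : Algebra.trace ℚ K t = e.2.2 := by
    rw [trace_of_cubic hK (a := -e.2.2) (b := -e.2.1) (c := -e.1)
      (by rw [← neg_add, add_comm]; exact he.neg) he'.neg
      (by push_cast; linear_combination h)]
    push_cast
    ring
  have t2 : Algebra.trace ℚ K (t ^ 2) = e.2.2 ^ 2 + 2 * e.2.1 := by
    rw [trace_of_cubic hK (a := -(e.2.2 ^ 2 + 2 * e.2.1)) (b := e.2.1 ^ 2 - 2 * e.1 * e.2.2)
      (c := -e.1 ^ 2) (by
        rw [Int.odd_iff] at he ⊢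
        have h1 := Int.emod_two_eq_zero_or_one e.2.1
        have h2 := Int.emod_two_eq_zero_or_one e.2.2
        have h3 : (e.2.1 ^ 2 + e.2.2 ^ 2) % 2 = 1 := by
          rcases h1 with h1 | h1 <;> rcases h2 with h2 | h2 <;>
            simp [pow_two, Int.add_emod, Int.mul_emod, h1, h2] at he ⊢
        have h4 : -(e.2.2 ^ 2 + 2 * e.2.1) + (e.2.1 ^ 2 - 2 * e.1 * e.2.2) =
          (e.2.1 ^ 2 + e.2.2 ^ 2) + 2 * (-e.2.2 ^ 2 - e.2.1 - e.1 * e.2.2) := by ring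
        rw [h4]
        omega) he'.pow.neg
      (by
        push_cast
        linear_combination (t ^ 3 + e.2.2 * t ^ 2 - e.2.1 * t + e.1) * h)]
    push_cast
    ring
  have h1 : Algebra.trace ℚ K (1 : K) = 3 := by
    have := Algebra.trace_algebraMap (R := ℚ) (S := K) (1 : ℚ)
    rw [map_one, hK] at this
    simpa using this
  have h2 : cubicVal t v = (v.1 : ℚ) • (1 : K) + (v.2.1 : ℚ) • t + (v.2.2 : ℚ) • t ^ 2 := by
    simp only [cubicVal, Algebra.smul_def, mul_one, map_intCast]
  rw [h2, map_add, map_add, map_smul, map_smul, map_smul, h1, t1, t2, tripleTrace]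
  push_cast
  simp only [smul_eq_mul]
  ring

/-- A family with a dual family for the trace pairing is linearly independent. -/
theorem linearIndependent_of_trace_eq {K ι : Type*} [Field K] [Algebra ℚ K] [Fintype ι]
    [DecidableEq ι] (b b' : ι → K)
    (htr : ∀ j k, Algebra.trace ℚ K (b j * b' k) = if j = k then 1 else 0) :
    LinearIndependent ℚ b := by
  rw [Fintype.linearIndependent_iff]
  intro g hg k
  have h1 := congrArg (fun y => Algebra.trace ℚ K (y * b' k)) hg
  simpa [Finset.sum_mul, htr] using h1

theorem mem_of_pow_gcd {F : IntermediateField ℚ ℂ} {ζ : ℂ} (hζ : ζ ≠ 0) {a b : ℕ}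
    (ha : ζ ^ a ∈ F) (hb : ζ ^ b ∈ F) : ζ ^ Nat.gcd a b ∈ F := by
  rw [← zpow_natCast, Nat.gcd_eq_gcd_ab, zpow_add₀ hζ, zpow_mul, zpow_mul, zpow_natCast,
    zpow_natCast]
  exact mul_mem (zpow_mem ha _) (zpow_mem hb _)

theorem ofReal_mem_of_mem_adjoin {F : IntermediateField ℚ ℂ} {t : ℝ} (ht : (t : ℂ) ∈ F) {a : ℝ}
    (ha : a ∈ IntermediateField.adjoin ℚ {t}) : (a : ℂ) ∈ F := by
  have h : IntermediateField.adjoin ℚ {t} ≤ F.comap (IsScalarTower.toAlgHom ℚ ℝ ℂ) := by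
    rw [IntermediateField.adjoin_simple_le_iff]
    exact ht
  exact h ha

theorem cosGen_mem {F : IntermediateField ℚ ℂ} {n : ℕ}
    (h : Complex.exp (2 * Real.pi * Complex.I / n) ∈ F) : (cosGen n : ℂ) ∈ F := by
  have h1 : (cosGen n : ℂ) = Complex.exp (2 * Real.pi * Complex.I / n) +
      (Complex.exp (2 * Real.pi * Complex.I / n))⁻¹ := by
    rw [cosGen, ← Complex.exp_neg]
    push_cast
    rw [Complex.two_cos]
    congr 2 <;> ring
  rw [h1]
  exact add_mem h (inv_mem h)

theorem sum_mul_sinDiff_crossReal (k : Fin 3 → ℕ) (r : ℕ) (hr : r = 1 ∨ r = 2) :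
    ∑ j, (crossReal 1 (k (j + 1)) (k (j + 2)) : ℂ) *
      sinDiff (Complex.exp (2 * Real.pi * Complex.I / 504)) (r * k j) = 0 := by
  have h : ∀ i j, (crossReal 1 i j : ℂ) =
      -(1 / 8) * crossDiff (Complex.exp (2 * Real.pi * Complex.I / 504)) 1 i j := by
    intro i j
    rw [crossDiff_exp]
    push_cast
    ring
  simp only [h, Fin.sum_univ_three, crossDiff, one_mul, mul_one, Fin.isValue, zero_add,
    Fin.reduceAdd]
  rcases hr with rfl | rfl
  · simp only [one_mul]
    ring
  · ring

theorem ofReal_mem_adjoin_exp {n : ℕ} (hn0 : n ≠ 0) {m : Fin 3 → ℕ}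
    (hgcd : Nat.gcd (Nat.gcd (m 0) (m 1)) (Nat.gcd (m 2) n) = 1) {a : ℝ}
    (ha : a ∈ IntermediateField.adjoin ℚ {cosGen n}) :
    (a : ℂ) ∈ IntermediateField.adjoin ℚ
      (Set.range fun j => Complex.exp (2 * Real.pi * Complex.I * m j / n)) := by
  have hζ := Complex.isPrimitiveRoot_exp n hn0
  refine ofReal_mem_of_mem_adjoin (cosGen_mem ?_) ha
  set ζ := Complex.exp (2 * Real.pi * Complex.I / n)
  set F := IntermediateField.adjoin ℚ
    (Set.range fun j => Complex.exp (2 * Real.pi * Complex.I * m j / n)) with hF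
  have hmem : ∀ j, ζ ^ m j ∈ F := fun j => by
    have : ζ ^ m j = Complex.exp (2 * Real.pi * Complex.I * m j / n) := by
      rw [← Complex.exp_nat_mul]
      congr 1
      ring
    rw [this, hF]
    exact IntermediateField.subset_adjoin ℚ _ ⟨j, rfl⟩
  have h0 := hζ.ne_zero hn0
  have h1 := mem_of_pow_gcd h0 (mem_of_pow_gcd h0 (hmem 0) (hmem 1))
    (mem_of_pow_gcd h0 (hmem 2) (by rw [hζ.pow_eq_one]; exact one_mem F))
  rwa [hgcd, pow_one] at h1

theorem nodup_of_pow {n : ℕ} {ζ : ℂ} (hζ : IsPrimitiveRoot ζ n) {x : Fin 3 → ℂ} {m : Fin 3 → ℕ}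
    (hx : ∀ j, x j = ζ ^ m j) (hm : ∀ j, 0 < m j ∧ m j < n ∧ 2 * m j ≠ n)
    (hd : ∀ i j, i ≠ j → m i ≠ m j ∧ m i + m j ≠ n) :
    [1, -1, x 0, (x 0)⁻¹, x 1, (x 1)⁻¹, x 2, (x 2)⁻¹].Nodup := by
  have hn0 : n ≠ 0 := by
    have := hm 0
    omega
  have h0 : ∀ j, x j ≠ 0 := fun j => by
    rw [hx]
    exact pow_ne_zero _ (hζ.ne_zero hn0)
  have hpow : ∀ k, 0 < k → k < 2 * n → k ≠ n → ζ ^ k ≠ 1 := by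
    intro k hk hk' hkn h1
    obtain ⟨d, rfl⟩ := hζ.dvd_of_pow_eq_one k h1
    have : d = 1 := by
      have : 0 < d := Nat.pos_of_mul_pos_left hk
      have : d < 2 := by
        by_contra! h2
        nlinarith
      omega
    subst this
    omega
  have h2 : ∀ j, x j ^ 2 ≠ 1 := fun j => by
    have := hm j
    rw [hx, ← pow_mul]
    exact hpow _ (by omega) (by omega) (by omega)
  have hne : ∀ i j, i ≠ j → x i ≠ x j := fun i j hij h3 => by
    rw [hx, hx] at h3
    exact (hd i j hij).1 (hζ.pow_inj (hm i).2.1 (hm j).2.1 h3)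
  have hne' : ∀ i j, i ≠ j → x i * x j ≠ 1 := fun i j hij => by
    have := hm i
    have := hm j
    have := hd i j hij
    rw [hx, hx, ← pow_add]
    exact hpow _ (by omega) (by omega) (by omega)
  have hinv : ∀ i j, i ≠ j → x i ≠ (x j)⁻¹ := fun i j hij h3 => hne' i j hij (by
    rw [h3, inv_mul_cancel₀ (h0 j)])
  have hinv' : ∀ i j, i ≠ j → (x i)⁻¹ ≠ x j := fun i j hij h3 => hne' i j hij (by
    rw [← h3, mul_inv_cancel₀ (h0 i)])
  have hself : ∀ j, x j ≠ (x j)⁻¹ := fun j h3 => h2 j (by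
    rw [pow_two]
    nth_rewrite 2 [h3]
    exact mul_inv_cancel₀ (h0 j))
  have h1 : ∀ j, 1 ≠ x j ∧ 1 ≠ (x j)⁻¹ ∧ -1 ≠ x j ∧ -1 ≠ (x j)⁻¹ := fun j => by
    refine ⟨fun h3 => h2 j ?_, fun h3 => h2 j ?_, fun h3 => h2 j ?_, fun h3 => h2 j ?_⟩
    · rw [← h3, one_pow]
    · rw [← inv_inv (x j), ← h3, inv_one, one_pow]
    · rw [← h3, neg_one_sq]
    · rw [← inv_inv (x j), ← h3, inv_neg, inv_one, neg_one_sq]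
  have h11 : (1 : ℂ) ≠ -1 := by norm_num
  have n01 : (0 : Fin 3) ≠ 1 := by decide
  have n02 : (0 : Fin 3) ≠ 2 := by decide
  have n12 : (1 : Fin 3) ≠ 2 := by decide
  simp only [List.nodup_cons, List.mem_cons, List.not_mem_nil, or_false, not_or, not_false_eq_true,
    List.nodup_nil, and_true]
  exact ⟨⟨h11, (h1 0).1, (h1 0).2.1, (h1 1).1, (h1 1).2.1, (h1 2).1, (h1 2).2.1⟩,
    ⟨(h1 0).2.2.1, (h1 0).2.2.2, (h1 1).2.2.1, (h1 1).2.2.2, (h1 2).2.2.1, (h1 2).2.2.2⟩,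
    ⟨hself 0, hne 0 1 n01, hinv 0 1 n01, hne 0 2 n02, hinv 0 2 n02⟩,
    ⟨hinv' 0 1 n01, inv_injective.ne (hne 0 1 n01), hinv' 0 2 n02, inv_injective.ne (hne 0 2 n02)⟩,
    ⟨hself 1, hne 1 2 n12, hinv 1 2 n12⟩, ⟨hinv' 1 2 n12, inv_injective.ne (hne 1 2 n12)⟩, hself 2⟩

/-- Two families whose trace pairing is the identity matrix are dual bases as soon as their size is
the degree of the field. -/
theorem isDualPair_of_trace_eq {K : IntermediateField ℚ ℝ} (hK : Module.finrank ℚ K = 3)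
    {b b' : Fin 3 → K} (htr : ∀ j k, Algebra.trace ℚ K (b j * b' k) = if j = k then 1 else 0)
    {c h : Fin 3 → ℝ} (hb : ∀ j, (b j : ℝ) = c j) (hb' : ∀ j, (b' j : ℝ) = h j) {x : Fin 3 → ℂ}
    (hmem : ∀ a ∈ K, (a : ℂ) ∈ IntermediateField.adjoin ℚ (Set.range x))
    (hq : ∀ j k, ∃ q : ℚ, (h j / c j) / (h k / c k) = (q : ℝ)) : IsDualPair c h x := by
  have hcard : Fintype.card (Fin 3) = Module.finrank ℚ K := by rw [hK, Fintype.card_fin]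
  have hli := linearIndependent_of_trace_eq b b' htr
  have hli' := linearIndependent_of_trace_eq b' b fun j k => by
    rw [mul_comm, htr]
    exact if_congr eq_comm rfl rfl
  refine ⟨⟨K, basisOfLinearIndependentOfCardEqFinrank hli hcard,
    basisOfLinearIndependentOfCardEqFinrank hli' hcard, ?_, ?_, ?_, hmem⟩, hq⟩
  · simpa using hb
  · simpa using hb'
  · simpa using htr

/-- The heights are proportional to the weighted circumferences, the factor being determined by
duality. -/
theorem exists_isAdmissible {n : ℕ} (hn : n = 7 ∨ n = 14 ∨ n = 18) {m : Fin 3 → ℕ}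
    (hm : (m 0, m 1, m 2) ∈ exponentTriples n)
    (hgcd : Nat.gcd (Nat.gcd (m 0) (m 1)) (Nat.gcd (m 2) n) = 1) :
    ∃ c : Fin 3 → ℝ,
      IsAdmissible c fun j => Complex.exp (2 * Real.pi * Complex.I * m j / n) := by
  obtain ⟨w, ε, ht⟩ := solutionTest_of_mem hn hm
  simp only [solutionTest, Bool.and_eq_true, decide_eq_true_eq] at ht
  obtain ⟨⟨⟨hv, hlen⟩, hwm, hdist⟩, ⟨hε, hD, hMA⟩, htr⟩ := ht
  have hn0 : n ≠ 0 := by omega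
  have hnC : (n : ℂ) ≠ 0 := by exact_mod_cast hn0
  set v := crossTriples n m
  set a := weightedAdjoint n m w
  set D := weightedNorm n m w
  set t := cosGen n with htdef
  have hcube : t ^ 3 = cubicVal t (cubicRel n) := cosGen_cube_eq_cubicVal hn
  set c : Fin 3 → ℝ := fun j => ε * cubicVal t (v j) with hc
  have hcpos : ∀ j, 0 < c j := fun j => by
    have := pos_of_tripleLower hn (hv j)
    rwa [cubicVal_smul] at this
  set M : ℝ := ∑ j, w j * c j ^ 2 with hM
  -- The heights are `w j * c j / M`, so that the trace of `∑ j, c j * h j` comes out as `3`.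
  have hMpos : 0 < M := Finset.sum_pos (fun j _ => by
    have := (hwm j).1
    have := hcpos j
    positivity) ⟨0, Finset.mem_univ _⟩
  have hεR : (ε : ℝ) ^ 2 = 1 := by exact_mod_cast hε
  have hMval : cubicVal t (weightedSquare n m w) = M := by
    simp only [weightedSquare, cubicVal_add, cubicVal_smul, cubicVal_mul hcube, hM, hc,
      Fin.sum_univ_three, mul_pow, hεR]
    push_cast
    ring
  have hDR : (D : ℝ) ≠ 0 := by exact_mod_cast hD
  have hMa : M * cubicVal t a = D := by
    rw [← hMval, ← cubicVal_mul hcube, hMA]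
    simp [cubicVal]
  -- Up to the norm `D`, the inverse of `M` is the product `a` of its proper conjugates.
  have hinv : M⁻¹ = cubicVal t a / D := by
    rw [← hMa]
    have : cubicVal t a ≠ 0 := by
      intro h0
      rw [h0, mul_zero] at hMa
      exact hDR hMa.symm
    field_simp
  -- The number field and the two bases.
  set K := IntermediateField.adjoin ℚ {t} with hK
  have hfin : Module.finrank ℚ K = 3 := finrank_adjoin_cosGen hn
  have hfd : FiniteDimensional ℚ K := Module.finite_of_finrank_pos (by omega)
  set τ : K := ⟨t, IntermediateField.mem_adjoin_simple_self ℚ t⟩ with hτ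
  have hval : ∀ u, ((cubicVal τ u : K) : ℝ) = cubicVal t u := fun u => by
    simp only [cubicVal]
    push_cast
    rfl
  have hcubeK : τ ^ 3 = cubicVal τ (cubicRel n) := Subtype.ext (by rw [hval]; exact hcube)
  set h : Fin 3 → ℝ := fun j => w j * c j / M with hh
  let b : Fin 3 → K := fun j => ε * cubicVal τ (v j)
  let b' : Fin 3 → K := fun j => w j * (ε * cubicVal τ (v j)) * (cubicVal τ a / D)
  have hb : ∀ j, (b j : ℝ) = c j := fun j => by
    simp only [b, hc]
    push_cast
    rw [hval]
  have hb' : ∀ j, (b' j : ℝ) = h j := fun j => by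
    simp only [b', hh, hc, div_eq_mul_inv _ M, hinv]
    push_cast
    rw [hval, hval]
  have hεK : (ε : K) ^ 2 = 1 := by exact_mod_cast congrArg (Int.cast : ℤ → K) hε
  have hpar : Odd ((cubicRel n).2.1 + (cubicRel n).2.2) ∧ Odd (cubicRel n).1 := by
    rcases hn with rfl | rfl | rfl <;> decide
  have htrK : ∀ j k, Algebra.trace ℚ K (b j * b' k) = if j = k then 1 else 0 := by
    intro j k
    have h1 : b j * b' k = ((D : ℚ)⁻¹) • cubicVal τ (tripleMul (cubicRel n) (v j)
        (tripleSMul (w k) (tripleMul (cubicRel n) (v k) a))) := by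
      rw [cubicVal_mul hcubeK, cubicVal_smul, cubicVal_mul hcubeK, Algebra.smul_def, map_inv₀,
        eq_ratCast, Rat.cast_intCast]
      simp only [b, b', div_eq_mul_inv]
      push_cast
      linear_combination cubicVal τ (v j) * w k * cubicVal τ (v k) * cubicVal τ a * (D : K)⁻¹ * hεK
    rw [h1, map_smul, trace_cubicVal hfin hcubeK hpar.1 hpar.2, htr j k, smul_eq_mul]
    have : (D : ℚ) ≠ 0 := by exact_mod_cast hD
    split_ifs
    · exact inv_mul_cancel₀ this
    · simp
  have hratio : ∀ j k, ∃ q : ℚ, (h j / c j) / (h k / c k) = (q : ℝ) := by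
    intro j k
    refine ⟨w j / w k, ?_⟩
    have := (hcpos j).ne'
    have := (hcpos k).ne'
    have := hMpos.ne'
    have : (w k : ℝ) ≠ 0 := by exact_mod_cast (hwm k).1.ne'
    simp only [hh]
    push_cast
    field_simp
  have hdual := isDualPair_of_trace_eq hfin htrK hb hb'
    (fun y hy => ofReal_mem_adjoin_exp hn0 hgcd hy) hratio
  have hexp : ∀ j, Complex.exp (2 * Real.pi * Complex.I * m j / n) =
      Complex.exp (2 * Real.pi * Complex.I / 504) ^ (m j * (504 / n)) := fun j => by
    rw [← Complex.exp_nat_mul]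
    congr 1
    rcases hn with rfl | rfl | rfl <;> push_cast <;> ring
  have hexp' : ∀ j, Complex.exp (2 * Real.pi * Complex.I * m j / n) =
      Complex.exp (2 * Real.pi * Complex.I / n) ^ m j := fun j => by
    rw [← Complex.exp_nat_mul]
    congr 1
    ring
  have hz : Complex.exp (2 * Real.pi * Complex.I / 504) ^ 504 = 1 := by
    rw [← Complex.exp_nat_mul, Complex.exp_eq_one_iff]
    exact ⟨1, by push_cast; ring⟩
  have hζ := Complex.isPrimitiveRoot_exp n hn0
  set ζ := Complex.exp (2 * Real.pi * Complex.I / n)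
  have hrel : ∀ r, r = 1 ∨ r = 2 → ∑ j, (c j : ℂ) *
      sinDiff (Complex.exp (2 * Real.pi * Complex.I / 504)) (r * (m j * (504 / n))) = 0 := by
    intro r hr
    have h1 := sum_mul_sinDiff_crossReal (fun j => m j * (504 / n)) r hr
    have h2 : ∀ j, (c j : ℂ) = 8 * ε *
        (crossReal 1 (m (j + 1) * (504 / n)) (m (j + 2) * (504 / n)) : ℂ) := fun j => by
      have h3 := crossReal_eq hn (m (j + 1)) (m (j + 2))
      have h4 : c j = 8 * ε * crossReal 1 (m (j + 1) * (504 / n)) (m (j + 2) * (504 / n)) := by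
        simp only [hc, v, crossTriples]
        rw [← h3]
        ring
      rw [h4]
      push_cast
      ring
    simp only [h2, mul_assoc _ (crossReal _ _ _ : ℂ), ← Finset.mul_sum]
    rw [h1, mul_zero]
  refine ⟨c, hcpos, ⟨h, fun j => ?_, hdual⟩, ?_, ?_, ?_, ?_, ?_⟩
  · exact div_pos (mul_pos (by exact_mod_cast (hwm j).1) (hcpos j)) hMpos
  · intro j
    refine ⟨n, Nat.pos_of_ne_zero hn0, ?_⟩
    rw [hexp', ← pow_mul, mul_comm, pow_mul, hζ.pow_eq_one, one_pow]
  · exact nodup_of_pow hζ hexp' (fun j => (hwm j).2) hdist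
  · refine (Finset.sum_congr rfl fun j _ => ?_).trans (hrel 1 (Or.inl rfl))
    rw [sinDiff_eq hz, one_mul, ← hexp]
  · refine (Finset.sum_congr rfl fun j _ => ?_).trans (hrel 2 (Or.inr rfl))
    rw [sinDiff_eq hz, pow_mul', ← hexp, inv_pow]
  · rw [hasPositiveLengths_iff (fun j => (hwm j).2.1) (fun j => (hwm j).2.2.1)
      (fun j => (hwm j).2.2.2)]
    intro i
    rw [scaledLength_cubicVal]
    have := pos_of_tripleLower hn (hlen i)
    rwa [cubicVal_smul] at this


/-! ### Orders and exponents -/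

/-- The common order of the roots of unity is `n` if their exponents and `n` have no common factor. -/
theorem pow_eq_one_iff_of_gcd_eq_one {n : ℕ} (hn : n ≠ 0) {m : Fin 3 → ℕ}
    (hgcd : Nat.gcd (Nat.gcd (m 0) (m 1)) (Nat.gcd (m 2) n) = 1) (k : ℕ) :
    (∀ j, Complex.exp (2 * Real.pi * Complex.I * m j / n) ^ k = 1) ↔ n ∣ k := by
  have hζ := Complex.isPrimitiveRoot_exp n hn
  have h1 : ∀ j, Complex.exp (2 * Real.pi * Complex.I * m j / n) ^ k = 1 ↔ n ∣ m j * k := by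
    intro j
    rw [← hζ.pow_eq_one_iff_dvd, pow_mul, ← Complex.exp_nat_mul _ (m j)]
    congr! 3
    ring
  simp only [h1]
  refine ⟨fun h => ?_, fun h j => h.mul_left _⟩
  have h2 := Nat.dvd_gcd (Nat.dvd_gcd (h 0) (h 1)) (Nat.dvd_gcd (h 2) (Dvd.intro k rfl : n ∣ n * k))
  rwa [Nat.gcd_mul_right, Nat.gcd_mul_right, Nat.gcd_mul_right, hgcd, one_mul] at h2

theorem order_eq_of_mem_exponentTriples {n : ℕ} {p : ℕ × ℕ × ℕ} (h : p ∈ exponentTriples n) :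
    n = 7 ∨ n = 14 ∨ n = 18 := by
  by_contra! hn
  simp [exponentTriples, hn] at h

theorem theorem3p3 :
    (∀ (c : Fin 3 → ℝ) (x : Fin 3 → ℂ), IsAdmissible c x →
      ∀ n : ℕ, n = Nat.lcm (Nat.lcm (orderOf (x 0)) (orderOf (x 1))) (orderOf (x 2)) →
        ((n = 7 ∨ n = 14) ∧
          IntermediateField.adjoin ℚ (Set.range c) =
            IntermediateField.adjoin ℚ {Real.cos (Real.pi / 7)}) ∨
        (n = 18 ∧
          IntermediateField.adjoin ℚ (Set.range c) =
            IntermediateField.adjoin ℚ {Real.cos (Real.pi / 9)})) ∧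
    (∀ n n₁ n₂ n₃ : ℕ, n₁ < n → n₂ < n → n₃ < n →
      Nat.gcd (Nat.gcd n₁ n₂) (Nat.gcd n₃ n) = 1 →
        ((∃ c : Fin 3 → ℝ, IsAdmissible c
            ![Complex.exp (2 * (Real.pi : ℂ) * Complex.I * (n₁ : ℂ) / (n : ℂ)),
              Complex.exp (2 * (Real.pi : ℂ) * Complex.I * (n₂ : ℂ) / (n : ℂ)),
              Complex.exp (2 * (Real.pi : ℂ) * Complex.I * (n₃ : ℂ) / (n : ℂ))]) ↔
          (n₁, n₂, n₃) ∈ exponentTriples n)) := by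
  refine ⟨fun c x h n hn => ?_, fun n n₁ n₂ n₃ h₁ h₂ h₃ hgcd => ?_⟩
  · have hx : ∀ k, (∀ j, x j ^ k = 1) ↔ n ∣ k := fun k => by
      rw [hn, Nat.lcm_dvd_iff, Nat.lcm_dvd_iff, Fin.forall_fin_succ, Fin.forall_fin_two,
        orderOf_dvd_iff_pow_eq_one, orderOf_dvd_iff_pow_eq_one, orderOf_dvd_iff_pow_eq_one,
        and_assoc]
      rfl
    have hn' := h.order_eq hx
    have hK := h.adjoin_range_eq hn' ((hx n).2 dvd_rfl)
    rcases hn' with rfl | rfl | rfl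
    · exact Or.inl ⟨Or.inl rfl, hK.trans adjoin_cosGen_seven⟩
    · exact Or.inl ⟨Or.inr rfl, hK.trans adjoin_cosGen_fourteen⟩
    · exact Or.inr ⟨rfl, hK.trans adjoin_cosGen_eighteen⟩
  · have hvec : ![Complex.exp (2 * (Real.pi : ℂ) * Complex.I * (n₁ : ℂ) / (n : ℂ)),
        Complex.exp (2 * (Real.pi : ℂ) * Complex.I * (n₂ : ℂ) / (n : ℂ)),
        Complex.exp (2 * (Real.pi : ℂ) * Complex.I * (n₃ : ℂ) / (n : ℂ))] =
        fun j => Complex.exp (2 * Real.pi * Complex.I * (![n₁, n₂, n₃] j : ℕ) / n) := by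
      funext j
      fin_cases j <;> rfl
    rw [hvec]
    have hn0 : n ≠ 0 := by omega
    constructor
    · rintro ⟨c, h⟩
      have hx := pow_eq_one_iff_of_gcd_eq_one hn0 (m := ![n₁, n₂, n₃]) hgcd
      refine h.mem_exponentTriples (h.order_eq hx) (m := ![n₁, n₂, n₃]) ?_ (fun j => rfl) hgcd
      intro j
      fin_cases j
      · exact h₁
      · exact h₂
      · exact h₃
    · intro h
      exact exists_isAdmissible (order_eq_of_mem_exponentTriples h) (m := ![n₁, n₂, n₃]) h hgcd
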